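/- Let $M$ be a connected smooth ($C^\infty$) manifold of dimension $4$ and let $f\colon M\to\mathbb R^n$ be a smooth immersion, so that $M$ is a (possibly only immersed) submanifold of $\mathbb R^n$. Suppose that (i) $M$ is *austere*: for each point $p\in M$ and each normal vector $\nu$ at $p$, the eigenvalues (with multiplicity) of the quadratic form $\langle \mathrm{II}_p(\cdot,\cdot),\nu\rangle$ on $T_pM$ are symmetrically arranged around zero, where $\mathrm{II}$ is the second fundamental form (the normal component of the Euclidean derivative $D_XY$ of tangent vector fields); (ii) $M$ is *ruled by $3$-planes*: there is a smooth field $E$ of $3$-dimensional subspaces $E_p\subset T_pM$ such that through each point $p$ there passes an open piece of the affine $3$-plane $f(p)+E_p$ contained in $M$, with $E$ constant along this piece. Then $M$ is congruent to an open piece of a generalized helicoid. That is, there are an integer $0\le s<4$ and constants $\lambda_0,\lambda_1,\dots,\lambda_s$ with $\lambda_1,\dots,\lambda_s$ nonzero such that, with $h\colon\mathbb R^4\to\mathbb R^{4+s}$, $$h(x_0,\dots,x_3)=\bigl(\lambda_0x_0,\;x_1\cos(\lambda_1x_0),\;x_1\sin(\lambda_1x_0),\dots,x_s\cos(\lambda_sx_0),\;x_s\sin(\lambda_sx_0),\;x_{s+1},\dots,x_3\bigr),$$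 and for suitable affine isometric embeddings $A\colon\mathbb R^n\to\mathbb R^N$ and $B\colon\mathbb R^{4+s}\to\mathbb R^N$ into a common Euclidean space, $A\circ f$ agrees with $B\circ h$ near every point up to a change of parameters: each $p\in M$ has a neighbourhood on which $A\circ f=B\circ h\circ\psi$ for a map $\psi$ into $\mathbb R^4$ that is a local diffeomorphism at $p$. (The numbers $s,\lambda_i$ and the maps $A,B$ are the same for all $p$; for $s=0$ the helicoid is a $4$-plane.) -/

import Mathlib

open scoped Manifold ContDiff Topology InnerProductSpace

-- So that `ℝⁿ` gets its usual one-chart manifold structure `chartedSpaceSelf` syntactically.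
attribute [-instance] TopCat.of.chartedSpace

noncomputable section

/-- Euclidean space `ℝⁿ` with its standard inner product. -/
abbrev EucSp (n : ℕ) : Type := EuclideanSpace ℝ (Fin n)

section Immersed

variable {M : Type*} [TopologicalSpace M]

/-- The differential of `f` at `p`, tangent vectors of `M` at `p` being given (as in Mathlib) by
their components in the preferred chart at `p`. -/
def differentialAt (m : ℕ) {n : ℕ} [ChartedSpace (EucSp m) M] (f : M → EucSp n) (p : M) :
    EucSp m →L[ℝ] EucSp n :=
  mfderiv (𝓡 m) (𝓡 n) f p

/-- `f : M → ℝⁿ` is a smooth immersion of the `m`-dimensional manifold `M`, i.e. it makes `M` an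
(immersed) submanifold of `ℝⁿ`. -/
def IsSmoothImmersion (m : ℕ) {n : ℕ} [ChartedSpace (EucSp m) M] (f : M → EucSp n) : Prop :=
  ContMDiff (𝓡 m) (𝓡 n) ∞ f ∧ ∀ p : M, Function.Injective (differentialAt m f p)

/-- The tangent space of the submanifold at `p`, as a linear subspace of `ℝⁿ`: the image of
the differential of `f` at `p`. -/
def tangentPlane (m : ℕ) {n : ℕ} [ChartedSpace (EucSp m) M] (f : M → EucSp n) (p : M) :
    Submodule ℝ (EucSp n) :=
  (differentialAt m f p).range

/-- The second fundamental form of `f` at `p`, with values in the normal space.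
Tangent vectors are given by their components in the preferred chart at `p`;
`II (v, w)` is the normal component of the Euclidean derivative `D_V W` at `p`, where `V`, `W` are
the extensions of `v`, `w` with constant components in that chart, i.e. the normal component of the
second derivative of `f` in the chart. -/
def secondFundamentalForm (m : ℕ) {n : ℕ} [ChartedSpace (EucSp m) M] (f : M → EucSp n) (p : M)
    (v w : EucSp m) : EucSp n :=
  (tangentPlane m f p)ᗮ.starProjection
    (fderiv ℝ (fderiv ℝ (f ∘ (extChartAt (𝓡 m) p).symm)) (extChartAt (𝓡 m) p p) v w)

/-- `f` is austere: at each point `p` and for each normal vector `ν` at `p`, the eigenvalues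
(with multiplicity) of the quadratic form `⟨II, ν⟩` on the tangent space are symmetrically arranged
around zero. The eigenvalues are those of the symmetric matrix of `⟨II, ν⟩` in an orthonormal basis
of the tangent space. -/
def IsAustere (m : ℕ) {n : ℕ} [ChartedSpace (EucSp m) M] (f : M → EucSp n) : Prop :=
  ∀ (p : M) (e : Fin m → EucSp m),
    Orthonormal ℝ (fun i => differentialAt m f p (e i)) →
    ∀ ν ∈ (tangentPlane m f p)ᗮ,
      let S : Matrix (Fin m) (Fin m) ℝ :=
        Matrix.of fun i j => ⟪secondFundamentalForm m f p (e i) (e j), ν⟫_ℝ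
      S.charpoly.roots.map (fun t => -t) = S.charpoly.roots

/-- `E` is a smooth field of `k`-planes tangent to the submanifold: `E p` is a `k`-dimensional
subspace of the tangent space at `p`, and `E` is locally spanned by `k` smooth vector fields. -/
structure IsSmoothPlaneField (m : ℕ) {n : ℕ} [ChartedSpace (EucSp m) M] (k : ℕ)
    (f : M → EucSp n) (E : M → Submodule ℝ (EucSp n)) : Prop where
  finrank_eq : ∀ p, Module.finrank ℝ (E p) = k
  le_tangent : ∀ p, E p ≤ tangentPlane m f p
  smooth : ∀ p, ∃ U : Set M, IsOpen U ∧ p ∈ U ∧ ∃ X : Fin k → M → EucSp n,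
    (∀ i, ContMDiffOn (𝓡 m) (𝓡 n) ∞ (X i) U) ∧
      ∀ q ∈ U, E q = Submodule.span ℝ (Set.range fun i => X i q)

/-- The submanifold is ruled by `k`-planes tangent to `E`: through each point `p` there passes an
open piece of the affine `k`-plane `f p + E p` that lies in the submanifold and along which `E` is
the direction of that plane. (Only open pieces of planes are required, not complete planes; the
map `σ` picks the piece in `M`, as `f` need not be injective.) -/
def IsRuledAlong {n : ℕ} (f : M → EucSp n) (E : M → Submodule ℝ (EucSp n)) : Prop :=
  ∀ p : M, ∃ ε > 0, ∃ σ : E p → M, ContinuousOn σ (Metric.ball 0 ε) ∧ σ 0 = p ∧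
    ∀ v ∈ Metric.ball (0 : E p) ε, f (σ v) = f p + (v : EucSp n) ∧ E (σ v) = E p

/-- The submanifold is ruled by `k`-planes. -/
def IsRuledByPlanes (m : ℕ) {n : ℕ} [ChartedSpace (EucSp m) M] (k : ℕ) (f : M → EucSp n) : Prop :=
  ∃ E : M → Submodule ℝ (EucSp n), IsSmoothPlaneField m k f E ∧ IsRuledAlong f E

end Immersed

/-- The Euclidean space `ℝ^(1 + 2 s + r)` with coordinates grouped as
`(1 coordinate, s pairs of coordinates, r coordinates)`. With `m = s + 1 + r` it is `ℝ^(m + s)`. -/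
abbrev HelicoidSpace (s r : ℕ) : Type := EuclideanSpace ℝ (Unit ⊕ (Fin s × Fin 2) ⊕ Fin r)

/-- The parametrization of the generalized helicoid of dimension `m = s + 1 + r`:
`(x₀, (x₁, …, xₛ), (xₛ₊₁, …, xₘ₋₁)) ↦ (λ₀ x₀, x₁ cos (λ₁ x₀), x₁ sin (λ₁ x₀), …,
xₛ cos (λₛ x₀), xₛ sin (λₛ x₀), xₛ₊₁, …, xₘ₋₁)`. -/
def helicoidParam {s r : ℕ} (l₀ : ℝ) (l : Fin s → ℝ) (x : ℝ × EucSp s × EucSp r) :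
    HelicoidSpace s r :=
  WithLp.toLp 2 (Sum.elim (fun _ => l₀ * x.1) (Sum.elim
    (fun ij => x.2.1 ij.1 * (if ij.2 = 0 then Real.cos (l ij.1 * x.1)
      else Real.sin (l ij.1 * x.1)))
    (fun j => x.2.2 j)))

/-- The immersed `m`-dimensional submanifold `f : M → ℝⁿ` is congruent to (an open piece of) a
generalized helicoid: there are `s < m` and constants `λ₀`, and nonzero `λ₁, …, λₛ`, such that,
after `ℝⁿ` and `ℝ^(m + s)` are placed in a common Euclidean space by affine isometries `A` and `B`,
`f` is near every point the parametrization of this one helicoid up to a change of parameters. -/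
def IsGeneralizedHelicoid {M : Type*} [TopologicalSpace M] (m : ℕ) {n : ℕ}
    [ChartedSpace (EucSp m) M] (f : M → EucSp n) : Prop :=
  ∃ s r : ℕ, s + 1 + r = m ∧ ∃ (l₀ : ℝ) (l : Fin s → ℝ), (∀ i, l i ≠ 0) ∧
    ∃ (N : ℕ) (A : EucSp n →ᵃⁱ[ℝ] EucSp N) (B : HelicoidSpace s r →ᵃⁱ[ℝ] EucSp N),
      ∀ p : M, ∃ ψ : M → ℝ × EucSp s × EucSp r,
        IsLocalDiffeomorphAt (𝓡 m) 𝓘(ℝ, ℝ × EucSp s × EucSp r) ∞ ψ p ∧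
        ∀ᶠ q in 𝓝 p, A (f q) = B (helicoidParam l₀ l (ψ q))

end

/-! Austerity enters only through the trace: a spectrum symmetric about zero has sum zero. Since the
second fundamental form vanishes on each ruling `E`, and `E` is a hyperplane of the tangent space,
the trace condition says that it also vanishes on the tangent direction orthogonal to `E`
(`apply_apply_mem_range_of_austere`). `RuledMinimal` records what is left of the hypotheses in a
chart.

Locally the rulings form a one-parameter family of affine planes, encoded by the projection `P(t)`
onto the direction and the foot `a(t)` of the perpendicular from the origin. A point `y` of the
plane has normal velocity `w(y) = P'y + a'`, and minimality says that `P''y + a''` is a multiple of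
`w(y)` modulo the plane (`normalAcceleration_mem_span`). Both are affine in `y`. So, as soon as some
`P'e` with `e` in the plane is not parallel to `w`, the factor `μ` is the same along the whole
plane. The Killing field with rotation `K = [P', P]` and translation `k = a' + 2P'a`, which
generates the motion of the planes, then satisfies `K' = μK` and `k' = μk`
(`IsRulingPatch.gen_deriv`). After a change of parameter it is constant, so the planes are the orbit
of one plane under a one-parameter group of rigid motions. Diagonalizing `-K²` on the plane exhibits
this orbit as a helicoid (`exists_isHelicoidFrame`).

The orbit of a helicoid frame is nondegenerate at every point (`IsHelicoidFrame.isScrewMotion`).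
Hence agreement with the orbit is both an open and a closed condition, and it spreads from a single
nondegenerate point over a patch and then over the connected `M`. If there is no nondegenerate
point, the rulings turn only inside the tangent spaces. The tangent spaces are then parallel
(`RuledMinimal.hasFDerivAt_tangentProj`) and `M` lies in a plane, the case `s = 0`. -/

noncomputable section

/-! ### Tools from calculus and linear algebra -/

open ContinuousLinearMap in
/-- The orthogonal projection onto the range of an injective operator depends smoothly on it. -/
theorem contDiffAt_starProjection_range {W X Y : Type*} [NormedAddCommGroup W] [NormedSpace ℝ W]
    [NormedAddCommGroup X] [InnerProductSpace ℝ X] [FiniteDimensional ℝ X]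
    [NormedAddCommGroup Y] [InnerProductSpace ℝ Y] [FiniteDimensional ℝ Y]
    {k : WithTop ℕ∞} {A : W → X →L[ℝ] Y} {x : W} (hA : ContDiffAt ℝ k A x)
    (hinj : ∀ᶠ y in 𝓝 x, Function.Injective (A y)) :
    ContDiffAt ℝ k (fun y => (A y).range.starProjection) x := by
  have : CompleteSpace X := FiniteDimensional.complete ℝ X
  have : CompleteSpace Y := FiniteDimensional.complete ℝ Y
  have key : ∀ T : X →L[ℝ] Y, Function.Injective T → (adjoint T ∘L T).IsInvertible := by
    intro T hT
    have hi : Function.Injective (adjoint T ∘L T) := by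
      rw [injective_iff_map_eq_zero]
      intro v hv
      apply hT
      have h1 : ⟪T v, T v⟫_ℝ = 0 := by
        rw [← adjoint_inner_right]
        have : (adjoint T) (T v) = 0 := hv
        rw [this, inner_zero_right]
      rw [map_zero]
      exact inner_self_eq_zero.1 h1
    refine ⟨(LinearEquiv.ofInjectiveEndo ((adjoint T ∘L T : X →L[ℝ] X) : X →ₗ[ℝ] X)
      hi).toContinuousLinearEquiv, ?_⟩
    ext v
    rfl
  have hadj : ContDiffAt ℝ k (fun y => adjoint (A y)) x :=
    (adjoint : (X →L[ℝ] Y) ≃ₗᵢ⋆[ℝ] (Y →L[ℝ] X)).toContinuousLinearEquiv.toContinuousLinearMap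
      |>.contDiff.contDiffAt.comp x hA
  have hB : ContDiffAt ℝ k (fun y => adjoint (A y) ∘L A y) x := hadj.clm_comp hA
  have hinv : ContDiffAt ℝ k (fun y => (adjoint (A y) ∘L A y).inverse) x :=
    (((key _ hinj.self_of_nhds).contDiffAt_map_inverse (n := k)).comp x hB :)
  -- The projection is `A (A* A)⁻¹ A*`, and inversion is smooth at invertible operators.
  refine ((hA.clm_comp hinv).clm_comp hadj).congr_of_eventuallyEq ?_
  filter_upwards [hinj] with y hy
  ext v
  have hI := key _ hy
  refine Submodule.eq_starProjection_of_mem_of_inner_eq_zero ?_ ?_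
  · exact ⟨_, rfl⟩
  · rintro _ ⟨z, rfl⟩
    have h2 : adjoint (A y) (A y ((adjoint (A y) ∘L A y).inverse (adjoint (A y) v)))
        = adjoint (A y) v := by
      have := hI.self_comp_inverse
      exact congrArg (fun T : X →L[ℝ] X => T (adjoint (A y) v)) this
    change ⟪v - A y ((adjoint (A y) ∘L A y).inverse (adjoint (A y) v)), A y z⟫_ℝ = 0
    rw [← adjoint_inner_left, map_sub, h2, sub_self, inner_zero_left]

/-- Two affine maps along a plane, pointwise proportional near a point, have a constant ratio unless
the second one stays on a line. This is what makes `μ` constant along a ruling. -/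
theorem eq_smul_of_forall_mem_span_add_smul {Y : Type*} [NormedAddCommGroup Y]
    [NormedSpace ℝ Y] (E : Submodule ℝ Y) {w : Y} (hw : w ≠ 0) {μ : ℝ} {L L' : Y →L[ℝ] Y}
    (h : ∀ e ∈ E, ∀ᶠ s : ℝ in 𝓝 0, μ • w + s • L' e ∈ Submodule.span ℝ {w + s • L e})
    {e₀ : Y} (he₀ : e₀ ∈ E) (hL : L e₀ ∉ Submodule.span ℝ {w}) :
    ∀ e ∈ E, L' e = μ • L e := by
  have main : ∀ e ∈ E, L e ∉ Submodule.span ℝ {w} → L' e = μ • L e := by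
    intro e he hLe
    obtain ⟨ε, hε, hb⟩ := Metric.eventually_nhds_iff.1 (h e he)
    have get : ∀ s : ℝ, s ≠ 0 → |s| < ε → ∃ a : ℝ, L' e - μ • L e = a • (w + s • L e) := by
      intro s hs hse
      obtain ⟨c, hc⟩ := Submodule.mem_span_singleton.1 (hb (y := s) (by simpa using hse))
      refine ⟨s⁻¹ * (c - μ), ?_⟩
      rw [mul_smul, sub_smul, hc, smul_add, eq_inv_smul_iff₀ hs]
      module
    -- The left side of `get` does not depend on `s`. Comparing two values of `s` and using that `w`
    -- and `L e` are independent forces the coefficient to be zero.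
    obtain ⟨a, ha⟩ := get (ε / 2) (by positivity) (by rw [abs_of_pos (by positivity)]; linarith)
    obtain ⟨b, hb'⟩ := get (ε / 3) (by positivity) (by rw [abs_of_pos (by positivity)]; linarith)
    have hab : (a - b) • w + (a * (ε / 2) - b * (ε / 3)) • L e = 0 := by
      have := ha.symm.trans hb'
      rw [← sub_eq_zero] at this
      rw [← this]; module
    have h2 : a * (ε / 2) - b * (ε / 3) = 0 := by
      by_contra hne
      apply hLe
      rw [Submodule.mem_span_singleton]
      refine ⟨-((a * (ε / 2) - b * (ε / 3))⁻¹ * (a - b)), ?_⟩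
      rw [add_comm, ← eq_neg_iff_add_eq_zero] at hab
      rw [neg_smul, mul_smul, ← smul_neg, ← hab, inv_smul_smul₀ hne]
    rw [h2, zero_smul, add_zero] at hab
    have h3 : a = b := by
      rcases smul_eq_zero.1 hab with h | h
      · linarith
      · exact absurd h hw
    have h4 : a = 0 := by subst h3; nlinarith
    rw [h4, zero_smul, sub_eq_zero] at ha
    exact ha
  intro e he
  by_cases hLe : L e ∈ Submodule.span ℝ {w}
  -- When `L e` is parallel to `w`, both `e + e₀` and `e₀` are covered by `main`, and their
  -- difference gives `e`.
  · have h1 := main (e + e₀) (E.add_mem he he₀) (by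
      rw [map_add]
      intro h
      exact hL ((Submodule.add_mem_iff_right _ hLe).1 h))
    have h2 := main e₀ he₀ hL
    rw [map_add, map_add, h2, smul_add] at h1
    exact add_right_cancel h1
  · exact main e he hLe

/-- Inverse function theorem, with smoothness of the inverse at all points of its domain. -/
theorem exists_openPartialHomeomorph_contDiffAt_symm {W X : Type*}
    [NormedAddCommGroup W] [NormedSpace ℝ W] [CompleteSpace W]
    [NormedAddCommGroup X] [NormedSpace ℝ X]
    {ψ : W → X} {V : Set W} (hV : IsOpen V) (hψ : ContDiffOn ℝ ∞ ψ V) {x₀ : W} (hx₀ : x₀ ∈ V)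
    (A : W ≃L[ℝ] X) (hA : fderiv ℝ ψ x₀ = A) :
    ∃ Φ : OpenPartialHomeomorph W X, x₀ ∈ Φ.source ∧ Φ.source ⊆ V ∧ (∀ x, Φ x = ψ x) ∧
      (∀ y ∈ Φ.target, ContDiffAt ℝ ∞ Φ.symm y) ∧
      ∀ x ∈ Φ.source, ∃ B : W ≃L[ℝ] X, fderiv ℝ ψ x = B := by
  have hc : ContDiffAt ℝ ∞ ψ x₀ := hψ.contDiffAt (hV.mem_nhds hx₀)
  have hd : HasFDerivAt ψ (A : W →L[ℝ] X) x₀ := hA ▸ (hc.differentiableAt (by simp)).hasFDerivAt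
  let Φ₀ := hc.toOpenPartialHomeomorph ψ hd (by simp)
  have hcont : ContinuousOn (fderiv ℝ ψ) V := hψ.continuousOn_fderiv_of_isOpen hV (by simp)
  -- Restricting to points with invertible derivative makes the inverse smooth on the whole target,
  -- not only at the image of `x₀`.
  have hO : IsOpen (V ∩ fderiv ℝ ψ ⁻¹' Set.range ((↑) : (W ≃L[ℝ] X) → W →L[ℝ] X)) :=
    hcont.isOpen_inter_preimage hV ContinuousLinearEquiv.isOpen
  let Φ := Φ₀.restrOpen _ hO
  have hcoe : ∀ x, Φ x = ψ x := fun x => rfl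
  have hsrc : Φ.source = Φ₀.source ∩ (V ∩ fderiv ℝ ψ ⁻¹' Set.range ((↑) : (W ≃L[ℝ] X) → W →L[ℝ] X)) :=
    Φ₀.restrOpen_source _ hO
  refine ⟨Φ, ?_, ?_, hcoe, ?_, ?_⟩
  · rw [hsrc]
    exact ⟨hc.mem_toOpenPartialHomeomorph_source hd (by simp), hx₀, A, hA.symm⟩
  · rw [hsrc]; exact fun x hx => hx.2.1
  · intro y hy
    have hx : Φ.symm y ∈ Φ.source := Φ.map_target hy
    rw [hsrc] at hx
    obtain ⟨-, hxV, B, hB⟩ := hx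
    have hcx : ContDiffAt ℝ ∞ ψ (Φ.symm y) := hψ.contDiffAt (hV.mem_nhds hxV)
    refine Φ.contDiffAt_symm (f₀' := B) hy ?_ hcx
    rw [hB]
    exact (hcx.differentiableAt (by simp)).hasFDerivAt
  · intro x hx
    rw [hsrc] at hx
    obtain ⟨-, -, B, hB⟩ := hx
    exact ⟨B, hB.symm⟩

theorem exists_primitive_contDiffOn_Ioo {a b t₀ : ℝ} {g : ℝ → ℝ}
    (ht₀ : t₀ ∈ Set.Ioo a b) (hg : ContDiffOn ℝ ∞ g (Set.Ioo a b)) (c : ℝ) :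
    ∃ G : ℝ → ℝ, ContDiffOn ℝ ∞ G (Set.Ioo a b) ∧ G t₀ = c ∧
      ∀ t ∈ Set.Ioo a b, HasDerivAt G (g t) t := by
  let G : ℝ → ℝ := fun t => c + ∫ s in t₀..t, g s
  have hd : ∀ t ∈ Set.Ioo a b, HasDerivAt G (g t) t := by
    intro t ht
    refine HasDerivAt.const_add _ ?_
    have hsub : Set.uIcc t₀ t ⊆ Set.Ioo a b := Set.ordConnected_Ioo.uIcc_subset ht₀ ht
    exact intervalIntegral.integral_hasDerivAt_right
      ((hg.continuousOn.mono hsub).intervalIntegrable)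
      (hg.continuousOn.stronglyMeasurableAtFilter isOpen_Ioo t ht)
      (hg.continuousOn.continuousAt (isOpen_Ioo.mem_nhds ht))
  refine ⟨G, ?_, by simp [G], hd⟩
  rw [contDiffOn_infty_iff_deriv_of_isOpen isOpen_Ioo]
  exact ⟨fun t ht => (hd t ht).differentiableAt.differentiableWithinAt,
    hg.congr fun t ht => (hd t ht).deriv⟩

/-! ### Projections and feet of a field of affine planes -/

section PlaneFields

variable {X Y : Type*} [NormedAddCommGroup Y] [InnerProductSpace ℝ Y] [FiniteDimensional ℝ Y]

/-- The orthogonal projection onto the plane `E x`. -/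
def planeProj (E : X → Submodule ℝ Y) (x : X) : Y →L[ℝ] Y := (E x).starProjection

/-- The point of the affine plane `F x + E x` nearest to the origin. -/
def planeFoot (F : X → Y) (E : X → Submodule ℝ Y) (x : X) : Y := F x - planeProj E x (F x)

theorem planeProj_mul_self (E : X → Submodule ℝ Y) (x : X) :
    planeProj E x * planeProj E x = planeProj E x :=
  (E x).isIdempotentElem_starProjection

theorem planeProj_isSymmetric (E : X → Submodule ℝ Y) (x : X) :
    (planeProj E x : Y →ₗ[ℝ] Y).IsSymmetric :=
  (E x).starProjection_isSymmetric

theorem planeProj_apply_planeProj (E : X → Submodule ℝ Y) (x : X) (y : Y) :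
    planeProj E x (planeProj E x y) = planeProj E x y :=
  DFunLike.congr_fun (planeProj_mul_self E x) y

theorem planeProj_planeFoot (F : X → Y) (E : X → Submodule ℝ Y) (x : X) :
    planeProj E x (planeFoot F E x) = 0 := by
  rw [planeFoot, map_sub, planeProj_apply_planeProj, sub_self]

end PlaneFields

/-! ### Ruled minimal submanifolds and local coordinates adapted to the rulings -/

section RuledMinimal

variable {W Y : Type*} [NormedAddCommGroup W] [NormedSpace ℝ W]
  [NormedAddCommGroup Y] [InnerProductSpace ℝ Y] [FiniteDimensional ℝ Y]

/-- A parametrized submanifold foliated by open pieces of affine hyperplanes of its tangent spaces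
(with direction `E`), and minimal in the sense that its second fundamental form vanishes on
vectors normal to the rulings. -/
structure RuledMinimal (V : Set W) (F : W → Y) (E : W → Submodule ℝ Y) : Prop where
  isOpen : IsOpen V
  smooth : ContDiffOn ℝ ∞ F V
  injective : ∀ x ∈ V, Function.Injective (fderiv ℝ F x)
  le_range : ∀ x ∈ V, E x ≤ (fderiv ℝ F x).range
  finrank_eq : ∀ x ∈ V, Module.finrank ℝ (E x) + 1 = Module.finrank ℝ W
  smooth_proj : ContDiffOn ℝ ∞ (planeProj E) V
  fderiv_proj : ∀ x ∈ V, ∀ ξ, fderiv ℝ F x ξ ∈ E x → fderiv ℝ (planeProj E) x ξ = 0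
  ruled : ∀ x ∈ V, ∀ e ∈ E x, ∃ γ : ℝ → W, ContinuousAt γ 0 ∧ γ 0 = x ∧
    ∀ᶠ s in 𝓝 (0 : ℝ), F (γ s) = F x + s • e ∧ E (γ s) = E x
  minimal : ∀ x ∈ V, ∀ ξ, fderiv ℝ F x ξ ∈ (E x)ᗮ →
    fderiv ℝ (fderiv ℝ F) x ξ ξ ∈ (fderiv ℝ F x).range

/-- A neighbourhood `U` on which the ruling planes depend only on a real coordinate `t` with values
in `(a, b)`, together with a curve `c` transverse to the rulings and parametrized by `t`. -/
structure IsRulingPatch (F : W → Y) (E : W → Submodule ℝ Y) (U : Set W) (a b : ℝ) (t : W → ℝ)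
    (c : ℝ → W) : Prop where
  isOpen : IsOpen U
  smooth_t : ContDiffOn ℝ ∞ t U
  smooth_c : ContDiffOn ℝ ∞ c (Set.Ioo a b)
  t_mem : ∀ x ∈ U, t x ∈ Set.Ioo a b
  c_mem : ∀ s ∈ Set.Ioo a b, c s ∈ U
  t_c : ∀ s ∈ Set.Ioo a b, t (c s) = s
  proj_eq : ∀ x ∈ U, planeProj E x = planeProj E (c (t x))
  foot_eq : ∀ x ∈ U, planeFoot F E x = planeFoot F E (c (t x))
  t_congr : ∀ x ∈ U, ∀ y ∈ U, planeProj E x = planeProj E y → planeFoot F E x = planeFoot F E y →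
    t x = t y
  fderiv_t_eq_zero_iff : ∀ x ∈ U, ∀ ξ, fderiv ℝ t x ξ = 0 ↔ fderiv ℝ F x ξ ∈ E x
  fderiv_t_ne_zero : ∀ x ∈ U, fderiv ℝ t x ≠ 0

variable {V : Set W} {F : W → Y} {E : W → Submodule ℝ Y}

namespace RuledMinimal

theorem smooth_foot (h : RuledMinimal V F E) : ContDiffOn ℝ ∞ (planeFoot F E) V :=
  h.smooth.sub (h.smooth_proj.clm_apply h.smooth)

theorem hasFDerivAt (h : RuledMinimal V F E) {x : W} (hx : x ∈ V) :
    HasFDerivAt F (fderiv ℝ F x) x :=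
  ((h.smooth.contDiffAt (h.isOpen.mem_nhds hx)).differentiableAt (by simp)).hasFDerivAt

theorem hasFDerivAt_proj (h : RuledMinimal V F E) {x : W} (hx : x ∈ V) :
    HasFDerivAt (planeProj E) (fderiv ℝ (planeProj E) x) x :=
  ((h.smooth_proj.contDiffAt (h.isOpen.mem_nhds hx)).differentiableAt (by simp)).hasFDerivAt

theorem hasFDerivAt_foot (h : RuledMinimal V F E) {x : W} (hx : x ∈ V) :
    HasFDerivAt (planeFoot F E) (fderiv ℝ F x - (planeProj E x ∘L fderiv ℝ F x +
      (fderiv ℝ (planeProj E) x).flip (F x))) x :=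
  (h.hasFDerivAt hx).sub ((h.hasFDerivAt_proj hx).clm_apply (h.hasFDerivAt hx))

theorem fderiv_foot (h : RuledMinimal V F E) {x : W} (hx : x ∈ V) {ξ : W}
    (hξ : fderiv ℝ F x ξ ∈ E x) : fderiv ℝ (planeFoot F E) x ξ = 0 := by
  have h2 : planeProj E x (fderiv ℝ F x ξ) = fderiv ℝ F x ξ :=
    Submodule.starProjection_eq_self_iff.2 hξ
  rw [(h.hasFDerivAt_foot hx).fderiv]
  simp [h.fderiv_proj x hx ξ hξ, h2]

/-- A unit vector spanning the normal direction of the ruling within the tangent space. -/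
theorem exists_unit_normal [FiniteDimensional ℝ W] (h : RuledMinimal V F E) {x : W} (hx : x ∈ V) :
    ∃ ν : Y, ‖ν‖ = 1 ∧ ν ∈ (E x)ᗮ ∧ ν ∈ (fderiv ℝ F x).range ∧
      ∀ y ∈ (fderiv ℝ F x).range, ⟪ν, y⟫_ℝ = 0 → planeProj E x y = 0 → y = 0 := by
  have h1 := Submodule.finrank_add_inf_finrank_orthogonal (h.le_range x hx)
  have h2 : Module.finrank ℝ (fderiv ℝ F x).range = Module.finrank ℝ W :=
    LinearMap.finrank_range_of_inj (h.injective x hx)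
  have h3 : Module.finrank ℝ ↥((E x)ᗮ ⊓ (fderiv ℝ F x).range) = 1 := by
    have := h.finrank_eq x hx
    omega
  obtain ⟨v, hv0, hv⟩ := finrank_eq_one_iff'.1 h3
  have hv0' : (v : Y) ≠ 0 := by simpa using hv0
  have hn : ‖(v : Y)‖ ≠ 0 := norm_ne_zero_iff.2 hv0'
  refine ⟨‖(v : Y)‖⁻¹ • (v : Y), ?_, Submodule.smul_mem _ _ v.2.1, Submodule.smul_mem _ _ v.2.2,
    ?_⟩
  · rw [norm_smul, norm_inv, norm_norm, inv_mul_cancel₀ hn]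
  · intro y hy hνy hpy
    have hyE : y ∈ (E x)ᗮ := by
      exact (Submodule.starProjection_apply_eq_zero_iff (K := E x)).1 hpy
    obtain ⟨c, hc⟩ := hv ⟨y, hyE, hy⟩
    have hc' : c • (v : Y) = y := congrArg Subtype.val hc
    rw [← hc', inner_smul_left, inner_smul_right, real_inner_self_eq_norm_sq] at hνy
    have : c = 0 := by simpa [hn] using hνy
    rw [← hc', this, zero_smul]

/-- One coordinate labels the ruling plane and the others are the position along the fixed plane `E
x₀`. Together they are invertible at `x₀`, and the direction and foot of the ruling are constant on
the convex slices where the first coordinate is fixed. -/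
theorem exists_isRulingPatch [FiniteDimensional ℝ W] (h : RuledMinimal V F E) {x₀ : W}
    (hx₀ : x₀ ∈ V) :
    ∃ (U : Set W) (a b : ℝ) (t : W → ℝ) (c : ℝ → W), x₀ ∈ U ∧ U ⊆ V ∧
      IsRulingPatch F E U a b t c := by
  have : CompleteSpace W := FiniteDimensional.complete ℝ W
  obtain ⟨ν, hν1, hνE, hνT, hν⟩ := h.exists_unit_normal hx₀
  set o := F x₀ with ho
  -- The vector paired with `ν` runs from `o` to the nearest point of the ruling plane at `x`. So
  -- `t` depends on the plane alone, which gives `t_congr`, and its derivative at `x₀` is the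
  -- `ν`-component of the derivative of `F`.
  set t : W → ℝ := fun x => ⟪ν, planeFoot F E x - (o - planeProj E x o)⟫_ℝ with ht
  set q : Y →L[ℝ] E x₀ := (E x₀).orthogonalProjectionOnto with hq
  set ψ : W → ℝ × E x₀ := fun x => (t x, q (F x - o)) with hψ
  have hts : ContDiffOn ℝ ∞ t V :=
    contDiffOn_const.inner ℝ (h.smooth_foot.sub
      (contDiffOn_const.sub (h.smooth_proj.clm_apply contDiffOn_const)))
  have hus : ContDiffOn ℝ ∞ (fun x => q (F x - o)) V :=
    q.contDiff.comp_contDiffOn (h.smooth.sub contDiffOn_const)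
  have hψs : ContDiffOn ℝ ∞ ψ V := hts.prodMk hus
  have htd : ∀ x ∈ V, ∀ ξ, fderiv ℝ t x ξ = ⟪ν, fderiv ℝ (planeFoot F E) x ξ +
      fderiv ℝ (planeProj E) x ξ o⟫_ℝ := by
    intro x hx ξ
    have h1 : HasFDerivAt (fun x => planeFoot F E x - (o - planeProj E x o))
        (fderiv ℝ (planeFoot F E) x - (0 - (fderiv ℝ (planeProj E) x).flip o)) x := by
      have h2 := (h.hasFDerivAt_proj hx).clm_apply (hasFDerivAt_const o x)
      simp only [ContinuousLinearMap.comp_zero, zero_add] at h2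
      exact (h.hasFDerivAt_foot hx).differentiableAt.hasFDerivAt.sub
        ((hasFDerivAt_const o x).sub h2)
    have h3 := ((innerSL ℝ ν).hasFDerivAt.comp x h1).fderiv
    have h4 : fderiv ℝ t x = (innerSL ℝ ν) ∘L
      (fderiv ℝ (planeFoot F E) x - (0 - (fderiv ℝ (planeProj E) x).flip o)) := h3
    rw [h4]
    simp [inner_add_right]
  have hud : ∀ x ∈ V, HasFDerivAt (fun x => q (F x - o)) (q ∘L fderiv ℝ F x) x := fun x hx =>
    q.hasFDerivAt.comp x ((h.hasFDerivAt hx).sub_const o)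
  have htE : ∀ x ∈ V, ∀ ξ, fderiv ℝ F x ξ ∈ E x → fderiv ℝ t x ξ = 0 := by
    intro x hx ξ hξ
    rw [htd x hx, h.fderiv_foot hx hξ, h.fderiv_proj x hx ξ hξ]
    simp
  have hψd : ∀ x ∈ V, ∀ ξ, fderiv ℝ ψ x ξ = (fderiv ℝ t x ξ, q (fderiv ℝ F x ξ)) := by
    intro x hx ξ
    have h1 : HasFDerivAt ψ ((fderiv ℝ t x).prod (q ∘L fderiv ℝ F x)) x :=
      ((hts.contDiffAt (h.isOpen.mem_nhds hx)).differentiableAt (by simp)).hasFDerivAt.prodMk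
        (hud x hx)
    rw [h1.fderiv]; rfl
  have hinj : Function.Injective (fderiv ℝ ψ x₀) := by
    rw [injective_iff_map_eq_zero]
    intro ξ hξ
    rw [hψd x₀ hx₀, Prod.mk_eq_zero] at hξ
    have hp : planeProj E x₀ (fderiv ℝ F x₀ ξ) = 0 := by
      have : ((q (fderiv ℝ F x₀ ξ) : E x₀) : Y) = 0 := by rw [hξ.2]; rfl
      exact this
    have h0 : ⟪ν, fderiv ℝ F x₀ ξ⟫_ℝ = 0 := by
      rw [← hξ.1, htd x₀ hx₀, (h.hasFDerivAt_foot hx₀).fderiv]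
      simp [hp, ← ho]
    have := hν _ ⟨ξ, rfl⟩ h0 hp
    exact h.injective x₀ hx₀ (this.trans (map_zero _).symm)
  have hdim : Module.finrank ℝ W = Module.finrank ℝ (ℝ × E x₀) := by
    rw [Module.finrank_prod, Module.finrank_self, ← h.finrank_eq x₀ hx₀, add_comm]
  obtain ⟨Φ, hΦ0, hΦV, hΦ, hΦs, hΦd⟩ := exists_openPartialHomeomorph_contDiffAt_symm h.isOpen hψs hx₀
    (LinearEquiv.ofInjectiveOfFinrankEq (fderiv ℝ ψ x₀ : W →ₗ[ℝ] ℝ × E x₀) hinj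
      hdim).toContinuousLinearEquiv (by ext v <;> rfl)
  have hψ0 : ψ x₀ = 0 := by
    simp [hψ, ht, planeFoot, ← ho]
  have h0t : (0 : ℝ × E x₀) ∈ Φ.target := by rw [← hψ0, ← hΦ]; exact Φ.map_source hΦ0
  obtain ⟨δ, hδ, hball⟩ := Metric.isOpen_iff.1 Φ.open_target 0 h0t
  have hbox : ∀ s u, s ∈ Set.Ioo (-δ) δ → u ∈ Metric.ball (0 : E x₀) δ → (s, u) ∈ Φ.target := by
    intro s u hs hu
    apply hball
    rw [← Prod.mk_zero_zero, ← ball_prod_same, Real.ball_eq_Ioo]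
    exact ⟨by simpa using hs, hu⟩
  have htΦ : ∀ y ∈ Φ.target, t (Φ.symm y) = y.1 := fun y hy => by
    have := Φ.right_inv hy
    rw [hΦ] at this
    exact congrArg Prod.fst this
  have hballψ : ∀ x, ψ x ∈ Metric.ball 0 δ ↔ t x ∈ Set.Ioo (-δ) δ ∧
      q (F x - o) ∈ Metric.ball (0 : E x₀) δ := by
    intro x
    rw [← Prod.mk_zero_zero, ← ball_prod_same, Real.ball_eq_Ioo]
    simp [hψ]
  set U : Set W := Φ.source ∩ Φ ⁻¹' Metric.ball 0 δ with hU
  have hUV : U ⊆ V := fun x hx => hΦV hx.1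
  have hUo : IsOpen U := Φ.isOpen_inter_preimage Metric.isOpen_ball
  have hne : ∀ x ∈ U, fderiv ℝ t x ≠ 0 := by
    intro x hx h0
    obtain ⟨B, hB⟩ := hΦd x hx.1
    obtain ⟨ξ, hξ⟩ := B.surjective (1, 0)
    have h1 := hψd x (hUV hx) ξ
    rw [hB, h0] at h1
    have h2 := congrArg Prod.fst (hξ.symm.trans h1)
    simp at h2
  have hker : ∀ x ∈ U, ∀ ξ, fderiv ℝ t x ξ = 0 ↔ fderiv ℝ F x ξ ∈ E x := by
    intro x hx ξ
    -- Since `t` is constant along rulings, one inclusion is clear; both spaces have codimension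
    -- one, hence coincide.
    have hle : (E x).comap (fderiv ℝ F x : W →ₗ[ℝ] Y) ≤
        LinearMap.ker (fderiv ℝ t x : W →ₗ[ℝ] ℝ) := fun η hη => htE x (hUV hx) η hη
    have hd1 : Module.finrank ℝ ((E x).comap (fderiv ℝ F x : W →ₗ[ℝ] Y)) =
        Module.finrank ℝ (E x) := by
      rw [(Submodule.equivMapOfInjective (fderiv ℝ F x : W →ₗ[ℝ] Y)
        (h.injective x (hUV hx)) _).finrank_eq, Submodule.map_comap_eq,
        inf_eq_right.2 (h.le_range x (hUV hx))]
    have hd2 : Module.finrank ℝ (LinearMap.ker (fderiv ℝ t x : W →ₗ[ℝ] ℝ)) + 1 =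
        Module.finrank ℝ W := by
      refine Module.Dual.finrank_ker_add_one_of_ne_zero (f := (fderiv ℝ t x : W →ₗ[ℝ] ℝ)) ?_
      intro h0
      exact hne x hx (by ext v; exact LinearMap.congr_fun h0 v)
    have hd3 := h.finrank_eq x (hUV hx)
    have heq := Submodule.eq_of_le_of_finrank_eq hle (by omega)
    exact (SetLike.ext_iff.1 heq ξ).symm
  have hmemU : ∀ s u, s ∈ Set.Ioo (-δ) δ → u ∈ Metric.ball (0 : E x₀) δ → Φ.symm (s, u) ∈ U := by
    intro s u hs hu
    refine ⟨Φ.map_target (hbox s u hs hu), ?_⟩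
    rw [Set.mem_preimage, Φ.right_inv (hbox s u hs hu), ← Prod.mk_zero_zero, ← ball_prod_same,
      Real.ball_eq_Ioo]
    exact ⟨by simpa using hs, hu⟩
  have hconst : ∀ {G : Type _} [NormedAddCommGroup G] [NormedSpace ℝ G] (g : W → G),
      DifferentiableOn ℝ g V → (∀ x ∈ V, ∀ ξ, fderiv ℝ F x ξ ∈ E x → fderiv ℝ g x ξ = 0) →
      ∀ x ∈ U, g x = g (Φ.symm (t x, 0)) := by
    intro G _ _ g hg hg0 x hx
    have hx2 := hx.2
    rw [Set.mem_preimage, hΦ, hballψ] at hx2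
    have hd : ∀ u ∈ Metric.ball (0 : E x₀) δ,
        HasFDerivAt (fun u => g (Φ.symm (t x, u))) (0 : E x₀ →L[ℝ] G) u := by
      intro u hu
      have hmem := hmemU _ u hx2.1 hu
      have h1 : HasFDerivAt (fun u => Φ.symm (t x, u)) ((fderiv ℝ Φ.symm (t x, u)) ∘L
          ContinuousLinearMap.inr ℝ ℝ (E x₀)) u :=
        ((hΦs _ (hbox _ u hx2.1 hu)).differentiableAt (by simp)).hasFDerivAt.comp u
          (hasFDerivAt_prodMk_right _ _)
      have h2 : HasFDerivAt g (fderiv ℝ g (Φ.symm (t x, u))) (Φ.symm (t x, u)) :=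
        (hg.differentiableAt (h.isOpen.mem_nhds (hUV hmem))).hasFDerivAt
      have h3 : HasFDerivAt t (fderiv ℝ t (Φ.symm (t x, u))) (Φ.symm (t x, u)) :=
        ((hts.contDiffAt (h.isOpen.mem_nhds (hUV hmem))).differentiableAt (by simp)).hasFDerivAt
      -- On a slice `t` is constant, so slice directions lie in the kernel of its derivative and are
      -- therefore tangent to the ruling.
      have h4 := (h3.comp u h1).unique ((hasFDerivAt_const (t x) u).congr_of_eventuallyEq (by
        filter_upwards [Metric.isOpen_ball.mem_nhds hu] with v hv
        exact htΦ _ (hbox _ v hx2.1 hv)))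
      convert! h2.comp u h1 using 1
      ext v
      exact (hg0 _ (hUV hmem) _ ((hker _ hmem _).1 (DFunLike.congr_fun h4 v))).symm
    have hc := Metric.isOpen_ball.is_const_of_fderiv_eq_zero
      (convex_ball (0 : E x₀) δ).isPreconnected
      (fun u hu => (hd u hu).differentiableAt.differentiableWithinAt)
      (fun u hu => (hd u hu).fderiv) hx2.2 (Metric.mem_ball_self hδ)
    rw [← hc]
    have : (t x, q (F x - o)) = Φ x := (hΦ x).symm
    simp only [this, Φ.left_inv hx.1]
  have hxU : ∀ x ∈ U, t x ∈ Set.Ioo (-δ) δ := by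
    intro x hx
    have := hx.2
    rw [Set.mem_preimage, hΦ, hballψ] at this
    exact this.1
  have h0 : (0 : E x₀) ∈ Metric.ball (0 : E x₀) δ := Metric.mem_ball_self hδ
  refine ⟨U, -δ, δ, t, fun s => Φ.symm (s, 0), ⟨hΦ0, ?_⟩, hUV, hUo, hts.mono hUV, ?_, hxU,
    fun s hs => hmemU s 0 hs h0, fun s hs => htΦ _ (hbox s 0 hs h0), ?_, ?_, ?_, hker, hne⟩
  · rw [Set.mem_preimage, hΦ, hψ0]; exact Metric.mem_ball_self hδ
  · intro s hs
    have h1 := hΦs _ (hbox s 0 hs h0)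
    exact (h1.comp s (contDiffAt_id.prodMk contDiffAt_const)).contDiffWithinAt
  · exact hconst _ (h.smooth_proj.differentiableOn (by simp)) h.fderiv_proj
  · exact hconst _ (h.smooth_foot.differentiableOn (by simp)) fun x hx ξ hξ => h.fderiv_foot hx hξ
  · intro x _ y _ h1 h2
    simp only [ht, h1, h2]

end RuledMinimal
end RuledMinimal

/-! ### Algebra of a moving affine plane and its generating Killing field -/

section ProjectionAlgebra

/-- If the derivatives of a curve of projections `p` satisfy `p'' p ≡ μ p' p` modulo `p`, then
the generator `[p', p]` of its parallel transport satisfies `[p', p]' = μ [p', p]`. -/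
theorem commutator_deriv_eq_smul {R : Type*} [Ring R] [Algebra ℝ R] {p p₁ p₂ : R}
    {μ : ℝ} (hA : p₂ * p - p * p₂ * p = μ • (p₁ * p)) (hA' : p * p₂ - p * p₂ * p = μ • (p * p₁)) :
    p₂ * p - p * p₂ = μ • (p₁ * p - p * p₁) := by
  rw [smul_sub, ← hA, ← hA']; abel

/-- The left side is the derivative of `a₁ + 2 • p₁ a`. The hypothesis `hB` is the proportionality
of normal acceleration and velocity at the foot, and `ha₂` is `p a = 0` differentiated twice. -/
theorem translation_deriv_eq_smul {Y : Type*} [NormedAddCommGroup Y] [NormedSpace ℝ Y]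
    {p p₁ p₂ : Y →L[ℝ] Y} {a a₁ a₂ : Y} {μ : ℝ}
    (hp : p * p = p) (hp₁ : p₁ * p + p * p₁ = p₁)
    (ha : p a = 0) (ha₂ : p₂ a + 2 • p₁ a₁ + p a₂ = 0)
    (hA' : p * p₂ - p * p₂ * p = μ • (p * p₁))
    (hB : (a₂ + p₂ a) - p (a₂ + p₂ a) = μ • (p₁ a + a₁)) :
    a₂ + 2 • p₂ a + 2 • p₁ a₁ = μ • (a₁ + 2 • p₁ a) := by
  have e (T S : Y →L[ℝ] Y) (h : T = S) (v : Y) : T v = S v := by rw [h]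
  have h1 := e _ _ hp₁ a
  have h2 := e _ _ hA' a
  have h3 := congrArg p ha₂
  have h4 := e _ _ hp a₂
  have h5 := e _ _ hp (p₂ a)
  simp only [add_apply, mul_apply_eq_comp, ha, map_zero,
    sub_apply, sub_zero, map_add, map_nsmul,
    smul_apply, zero_add] at h1 h2 h3 h4 h5 hB
  rw [h4] at h3
  have e1 : μ • (a₁ + 2 • p₁ a) = μ • (p₁ a + a₁) + μ • p₁ a := by module
  rw [e1, ← hB, ← h1, ← h2]
  have e2 : p a₂ = - (p₂ a + 2 • p₁ a₁) := by
    rw [eq_neg_iff_add_eq_zero, ← ha₂]; abel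
  rw [e2]
  abel

/-- The derivative of a projection exchanges its range and kernel, so `p * p₁ * p = 0` and the
commutator with `p` undoes the passage from `p₁` to `[p₁, p]`. Thus the generator determines the
velocity of the plane. -/
theorem proj_deriv_eq_commutator {R : Type*} [Ring R] {p p₁ : R}
    (hp : p * p = p) (hp₁ : p₁ * p + p * p₁ = p₁) :
    (p₁ * p - p * p₁) * p - p * (p₁ * p - p * p₁) = p₁ := by
  have h0 : p * p₁ * p = 0 := by
    have := congrArg (p * ·) hp₁
    simp only [mul_add, ← mul_assoc, hp] at this
    simpa using this
  have h1 : p₁ * p * p = p₁ * p := by rw [mul_assoc, hp]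
  have h2 : p * (p * p₁) = p * p₁ := by rw [← mul_assoc, hp]
  rw [sub_mul, mul_sub, h1, h2, ← mul_assoc, h0]
  simpa using hp₁

/-- Since `p a = 0`, one has `p (p₁ a) = p₁ a`, so the rotation moves the foot by `-p₁ a`. This
accounts for the factor `2` in the translation part. -/
theorem foot_deriv_eq {Y : Type*} [NormedAddCommGroup Y] [NormedSpace ℝ Y]
    {p p₁ : Y →L[ℝ] Y} {a a₁ : Y} (hp₁ : p₁ * p + p * p₁ = p₁)
    (ha : p a = 0) (ha₁ : p₁ a + p a₁ = 0) :
    (p₁ * p - p * p₁) a + (a₁ + 2 • p₁ a) - p (a₁ + 2 • p₁ a) = a₁ := by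
  have e (T S : Y →L[ℝ] Y) (h : T = S) (v : Y) : T v = S v := by rw [h]
  have h1 := e _ _ hp₁ a
  simp only [add_apply, mul_apply_eq_comp, ha, map_zero,
    sub_apply, zero_add, map_add, map_nsmul, zero_sub] at h1 ⊢
  have e2 : p a₁ = - p₁ a := by
    rw [eq_neg_iff_add_eq_zero, ← ha₁]; abel
  rw [e2, h1]
  abel

/-- The normal velocity of a moving affine plane, in terms of its Killing field. -/
theorem killing_apply_eq {Y : Type*} [NormedAddCommGroup Y] [NormedSpace ℝ Y]
    {p p₁ : Y →L[ℝ] Y} {a a₁ y : Y} (hp : p * p = p) (hp₁ : p₁ * p + p * p₁ = p₁)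
    (hy : y - p y = a) :
    (p₁ * p - p * p₁) y + (a₁ + 2 • p₁ a) = p₁ y + a₁ := by
  have e (T S : Y →L[ℝ] Y) (h : T = S) (v : Y) : T v = S v := by rw [h]
  have h3 := e _ _ hp₁ a
  have ha : p a = 0 := by
    rw [← hy, map_sub, sub_eq_zero]
    exact (e _ _ hp y).symm
  have h4 : p (p₁ (p y)) = 0 := by
    have := e _ _ hp₁ (p y)
    have h5 := e _ _ hp y
    simp only [add_apply, mul_apply_eq_comp] at this h5
    rw [h5] at this
    simpa using this
  have hy' : y = p y + a := by rw [← hy]; abel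
  have h6 : p₁ y = p₁ (p y) + p₁ a := by rw [← map_add, ← hy']
  simp only [add_apply, mul_apply_eq_comp, ha, map_zero, zero_add, sub_apply] at h3 ⊢
  rw [h6, map_add, h4, h3]
  abel

end ProjectionAlgebra

/-! ### Derivatives of symmetric and of idempotent curves -/

section Curves

variable {Y : Type*} [NormedAddCommGroup Y] [InnerProductSpace ℝ Y]

theorem HasDerivAt.isSymmetric {P : ℝ → Y →L[ℝ] Y} {P' : Y →L[ℝ] Y} {s : ℝ}
    (hP : HasDerivAt P P' s) (hs : ∀ᶠ r in 𝓝 s, (P r : Y →ₗ[ℝ] Y).IsSymmetric) :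
    (P' : Y →ₗ[ℝ] Y).IsSymmetric := by
  intro x y
  have h1 : HasDerivAt (fun r => ⟪P r x, y⟫_ℝ) ⟪P' x, y⟫_ℝ s := by
    simpa using (hP.clm_apply (hasDerivAt_const s x)).inner ℝ (hasDerivAt_const s y)
  have h2 : HasDerivAt (fun r => ⟪x, P r y⟫_ℝ) ⟪x, P' y⟫_ℝ s := by
    simpa using (hasDerivAt_const s x).inner ℝ (hP.clm_apply (hasDerivAt_const s y))
  refine h1.unique (h2.congr_of_eventuallyEq ?_)
  filter_upwards [hs] with r hr
  exact hr x y

theorem HasDerivAt.mul_eq_of_idempotent {P : ℝ → Y →L[ℝ] Y} {P' : Y →L[ℝ] Y} {s : ℝ}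
    (hP : HasDerivAt P P' s) (hs : ∀ r, P r * P r = P r) :
    P' * P s + P s * P' = P' := by
  have h := hP.mul hP
  have h2 : P * P = P := funext hs
  rw [h2] at h
  exact h.unique hP

end Curves

/-! ### Velocity and acceleration of the ruling planes in a patch -/

section RuledMinimal

variable {W Y : Type*} [NormedAddCommGroup W] [NormedSpace ℝ W]
  [NormedAddCommGroup Y] [InnerProductSpace ℝ Y] [FiniteDimensional ℝ Y]
  {V : Set W} {F : W → Y} {E : W → Submodule ℝ Y} {U : Set W} {a b : ℝ} {t : W → ℝ} {c : ℝ → W}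

/-- The velocity of the direction of the ruling plane along a curve. -/
def projVelocity (E : W → Submodule ℝ Y) (c : ℝ → W) (s : ℝ) : Y →L[ℝ] Y :=
  deriv (fun r => planeProj E (c r)) s

/-- The velocity of the foot of the ruling plane along a curve. -/
def footVelocity (F : W → Y) (E : W → Submodule ℝ Y) (c : ℝ → W) (s : ℝ) : Y :=
  deriv (fun r => planeFoot F E (c r)) s

/-- The velocity, normal to the ruling, of the ruling plane at the point `F x`. -/
def normalVelocity (F : W → Y) (E : W → Submodule ℝ Y) (t : W → ℝ) (c : ℝ → W) (x : W) : Y :=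
  projVelocity E c (t x) (F x) + footVelocity F E c (t x)

namespace IsRulingPatch

theorem hasFDerivAt_t (hP : IsRulingPatch F E U a b t c) {x : W} (hx : x ∈ U) :
    HasFDerivAt t (fderiv ℝ t x) x :=
  ((hP.smooth_t.contDiffAt (hP.isOpen.mem_nhds hx)).differentiableAt (by simp)).hasFDerivAt

variable (h : RuledMinimal V F E) (hU : U ⊆ V) (hP : IsRulingPatch F E U a b t c)
include h hU hP

theorem contDiffOn_proj : ContDiffOn ℝ ∞ (fun s => planeProj E (c s)) (Set.Ioo a b) :=
  h.smooth_proj.comp hP.smooth_c fun s hs => hU (hP.c_mem s hs)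

theorem contDiffOn_foot : ContDiffOn ℝ ∞ (fun s => planeFoot F E (c s)) (Set.Ioo a b) :=
  h.smooth_foot.comp hP.smooth_c fun s hs => hU (hP.c_mem s hs)

theorem contDiffOn_projVelocity : ContDiffOn ℝ ∞ (projVelocity E c) (Set.Ioo a b) :=
  ((contDiffOn_infty_iff_deriv_of_isOpen isOpen_Ioo).1 (contDiffOn_proj h hU hP)).2

theorem contDiffOn_footVelocity : ContDiffOn ℝ ∞ (footVelocity F E c) (Set.Ioo a b) :=
  ((contDiffOn_infty_iff_deriv_of_isOpen isOpen_Ioo).1 (contDiffOn_foot h hU hP)).2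

theorem hasDerivAt_proj {s : ℝ} (hs : s ∈ Set.Ioo a b) :
    HasDerivAt (fun s => planeProj E (c s)) (projVelocity E c s) s :=
  (((contDiffOn_proj h hU hP).contDiffAt (isOpen_Ioo.mem_nhds hs)).differentiableAt
    (by simp)).hasDerivAt

theorem hasDerivAt_foot {s : ℝ} (hs : s ∈ Set.Ioo a b) :
    HasDerivAt (fun s => planeFoot F E (c s)) (footVelocity F E c s) s :=
  (((contDiffOn_foot h hU hP).contDiffAt (isOpen_Ioo.mem_nhds hs)).differentiableAt
    (by simp)).hasDerivAt

theorem hasDerivAt_projVelocity {s : ℝ} (hs : s ∈ Set.Ioo a b) :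
    HasDerivAt (projVelocity E c) (deriv (projVelocity E c) s) s :=
  (((contDiffOn_projVelocity h hU hP).contDiffAt (isOpen_Ioo.mem_nhds hs)).differentiableAt
    (by simp)).hasDerivAt

theorem hasDerivAt_footVelocity {s : ℝ} (hs : s ∈ Set.Ioo a b) :
    HasDerivAt (footVelocity F E c) (deriv (footVelocity F E c) s) s :=
  (((contDiffOn_footVelocity h hU hP).contDiffAt (isOpen_Ioo.mem_nhds hs)).differentiableAt
    (by simp)).hasDerivAt

theorem projVelocity_mul {s : ℝ} (hs : s ∈ Set.Ioo a b) :
    projVelocity E c s * planeProj E (c s) + planeProj E (c s) * projVelocity E c s =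
      projVelocity E c s :=
  (hasDerivAt_proj h hU hP hs).mul_eq_of_idempotent fun _ => planeProj_mul_self E _

theorem projVelocity_foot {s : ℝ} (hs : s ∈ Set.Ioo a b) :
    projVelocity E c s (planeFoot F E (c s)) + planeProj E (c s) (footVelocity F E c s) = 0 := by
  have h1 := (hasDerivAt_proj h hU hP hs).clm_apply (hasDerivAt_foot h hU hP hs)
  simp only [planeProj_planeFoot] at h1
  exact h1.unique (hasDerivAt_const s (0 : Y))

theorem projVelocity_deriv_foot {s : ℝ} (hs : s ∈ Set.Ioo a b) :
    deriv (projVelocity E c) s (planeFoot F E (c s)) +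
      2 • projVelocity E c s (footVelocity F E c s) +
      planeProj E (c s) (deriv (footVelocity F E c) s) = 0 := by
  have h1 := ((hasDerivAt_projVelocity h hU hP hs).clm_apply (hasDerivAt_foot h hU hP hs)).add
    ((hasDerivAt_proj h hU hP hs).clm_apply (hasDerivAt_footVelocity h hU hP hs))
  have h2 := h1.unique ((hasDerivAt_const s (0 : Y)).congr_of_eventuallyEq (by
    filter_upwards [isOpen_Ioo.mem_nhds hs] with r hr
    exact projVelocity_foot h hU hP hr))
  rw [← h2]
  abel

theorem projVelocity_isSymmetric {s : ℝ} (hs : s ∈ Set.Ioo a b) :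
    (projVelocity E c s : Y →ₗ[ℝ] Y).IsSymmetric :=
  (hasDerivAt_proj h hU hP hs).isSymmetric (.of_forall fun _ => planeProj_isSymmetric E _)

theorem deriv_projVelocity_isSymmetric {s : ℝ} (hs : s ∈ Set.Ioo a b) :
    ((deriv (projVelocity E c) s : Y →L[ℝ] Y) : Y →ₗ[ℝ] Y).IsSymmetric :=
  (hasDerivAt_projVelocity h hU hP hs).isSymmetric (by
    filter_upwards [isOpen_Ioo.mem_nhds hs] with r hr
    exact projVelocity_isSymmetric h hU hP hr)

theorem fderiv_proj {x : W} (hx : x ∈ U) (ξ : W) :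
    fderiv ℝ (planeProj E) x ξ = fderiv ℝ t x ξ • projVelocity E c (t x) := by
  have h1 := (hasDerivAt_proj h hU hP (hP.t_mem x hx)).hasFDerivAt.comp x (hP.hasFDerivAt_t hx)
  have h2 := h1.congr_of_eventuallyEq (f₁ := planeProj E) (by
    filter_upwards [hP.isOpen.mem_nhds hx] with y hy
    exact hP.proj_eq y hy)
  rw [h2.fderiv]
  simp

theorem fderiv_foot {x : W} (hx : x ∈ U) (ξ : W) :
    fderiv ℝ (planeFoot F E) x ξ = fderiv ℝ t x ξ • footVelocity F E c (t x) := by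
  have h1 := (hasDerivAt_foot h hU hP (hP.t_mem x hx)).hasFDerivAt.comp x (hP.hasFDerivAt_t hx)
  have h2 := h1.congr_of_eventuallyEq (f₁ := planeFoot F E) (by
    filter_upwards [hP.isOpen.mem_nhds hx] with y hy
    exact hP.foot_eq y hy)
  rw [h2.fderiv]
  simp

/-- This is the derivative of `planeFoot`, in which every term except the derivative of `F` depends
on `ξ` only through the derivative of `t`. Modulo the ruling, the tangent space is thus spanned by
the normal velocity. -/
theorem fderiv_sub_proj {x : W} (hx : x ∈ U) (ξ : W) :
    fderiv ℝ F x ξ - planeProj E x (fderiv ℝ F x ξ) =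
      fderiv ℝ t x ξ • normalVelocity F E t c x := by
  have h1 := fderiv_foot h hU hP hx ξ
  rw [(h.hasFDerivAt_foot (hU hx)).fderiv] at h1
  simp only [sub_apply, add_apply, ContinuousLinearMap.coe_comp, Function.comp_apply,
    ContinuousLinearMap.flip_apply, fderiv_proj h hU hP hx, smul_apply] at h1
  rw [normalVelocity, smul_add, ← h1]
  abel

theorem exists_fderiv_eq_normalVelocity {x : W} (hx : x ∈ U) :
    ∃ ξ, fderiv ℝ t x ξ = 1 ∧ fderiv ℝ F x ξ = normalVelocity F E t c x := by
  obtain ⟨ξ, hξ⟩ : ∃ ξ, fderiv ℝ t x ξ ≠ 0 := by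
    by_contra! h0
    exact hP.fderiv_t_ne_zero x hx (by ext v; exact h0 v)
  set ζ := (fderiv ℝ t x ξ)⁻¹ • ξ with hζ
  have hζ1 : fderiv ℝ t x ζ = 1 := by rw [hζ, map_smul, smul_eq_mul, inv_mul_cancel₀ hξ]
  have hmem : planeProj E x (fderiv ℝ F x ζ) ∈ E x := Submodule.starProjection_apply_mem _ _
  obtain ⟨η, hη⟩ := h.le_range x (hU hx) hmem
  have hη' : fderiv ℝ F x η = planeProj E x (fderiv ℝ F x ζ) := hη
  refine ⟨ζ - η, ?_, ?_⟩
  · rw [map_sub, hζ1, (hP.fderiv_t_eq_zero_iff x hx η).2 (hη' ▸ hmem), sub_zero]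
  · rw [map_sub, hη', fderiv_sub_proj h hU hP hx, hζ1, one_smul]

theorem planeProj_normalVelocity {x : W} (hx : x ∈ U) :
    planeProj E x (normalVelocity F E t c x) = 0 := by
  obtain ⟨ξ, h1, h2⟩ := exists_fderiv_eq_normalVelocity h hU hP hx
  have := fderiv_sub_proj h hU hP hx ξ
  rw [h1, h2, one_smul] at this
  simpa using this

theorem normalVelocity_ne_zero {x : W} (hx : x ∈ U) : normalVelocity F E t c x ≠ 0 := by
  obtain ⟨ξ, h1, h2⟩ := exists_fderiv_eq_normalVelocity h hU hP hx
  intro h0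
  rw [h0] at h2
  have : ξ = 0 := h.injective x (hU hx) (h2.trans (map_zero _).symm)
  rw [this, map_zero] at h1
  exact zero_ne_one h1

theorem sub_planeProj_mem_span {x : W} (hx : x ∈ U) {y : Y} (hy : y ∈ (fderiv ℝ F x).range) :
    y - planeProj E x y ∈ Submodule.span ℝ {normalVelocity F E t c x} := by
  obtain ⟨ξ, rfl⟩ := hy
  exact Submodule.mem_span_singleton.2 ⟨_, (fderiv_sub_proj h hU hP hx ξ).symm⟩

theorem projVelocity_mem {x : W} (hx : x ∈ U) {y : Y} (hy : planeProj E x y = 0) :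
    planeProj E x (projVelocity E c (t x) y) = projVelocity E c (t x) y := by
  have h1 := DFunLike.congr_fun (projVelocity_mul h hU hP (hP.t_mem x hx)) y
  rw [← hP.proj_eq x hx] at h1
  simpa [hy] using h1

/-- The normal component of the second derivative in the direction of the normal velocity. -/
theorem normalAcceleration_mem_span {x : W} (hx : x ∈ U) :
    (deriv (projVelocity E c) (t x) (F x) + deriv (footVelocity F E c) (t x)) -
      planeProj E x (deriv (projVelocity E c) (t x) (F x) + deriv (footVelocity F E c) (t x)) ∈
      Submodule.span ℝ {normalVelocity F E t c x} := by
  obtain ⟨ξ, h1, h2⟩ := exists_fderiv_eq_normalVelocity h hU hP hx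
  set w := normalVelocity F E t c x with hw
  have hxV := hU hx
  have hwE : planeProj E x w = 0 := planeProj_normalVelocity h hU hP hx
  have hmin : fderiv ℝ (fderiv ℝ F) x ξ ξ ∈ (fderiv ℝ F x).range :=
    h.minimal x hxV ξ (by
      rw [h2]; exact (Submodule.starProjection_apply_eq_zero_iff _).1 hwE)
  have hline : HasDerivAt (fun r : ℝ => x + r • ξ) ξ 0 := by
    simpa using ((hasDerivAt_id (0 : ℝ)).smul_const ξ).const_add x
  have hx0 : x + (0 : ℝ) • ξ = x := by simp
  have hx0' : (fun r : ℝ => x + r • ξ) 0 = x := hx0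
  have dF : HasDerivAt (fun r : ℝ => F (x + r • ξ)) w 0 :=
    h2 ▸ (h.hasFDerivAt hxV).hasLineDerivAt ξ
  have dt : HasDerivAt (fun r : ℝ => t (x + r • ξ)) 1 0 :=
    h1 ▸ (hP.hasFDerivAt_t hx).hasLineDerivAt ξ
  have ddF : HasDerivAt (fun r : ℝ => fderiv ℝ F (x + r • ξ) ξ) (fderiv ℝ (fderiv ℝ F) x ξ ξ) 0 := by
    have h3 : HasFDerivAt (fderiv ℝ F) (fderiv ℝ (fderiv ℝ F) x) x :=
      (((h.smooth.fderiv_of_isOpen h.isOpen (m := ∞) (by simp)).contDiffAt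
        (h.isOpen.mem_nhds hxV)).differentiableAt (by simp)).hasFDerivAt
    simpa using HasDerivAt.clm_apply (h3.hasLineDerivAt ξ) (hasDerivAt_const (0 : ℝ) ξ)
  -- The value of the second derivative of `t` is irrelevant: it only contributes a multiple of `w`.
  obtain ⟨T₂, ddt⟩ : ∃ T₂, HasDerivAt (fun r : ℝ => fderiv ℝ t (x + r • ξ) ξ) T₂ 0 := by
    have h3 : HasFDerivAt (fderiv ℝ t) (fderiv ℝ (fderiv ℝ t) x) x :=
      (((hP.smooth_t.fderiv_of_isOpen hP.isOpen (m := ∞) (by simp)).contDiffAt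
        (hP.isOpen.mem_nhds hx)).differentiableAt (by simp)).hasFDerivAt
    exact ⟨_, HasDerivAt.clm_apply (h3.hasLineDerivAt ξ) (hasDerivAt_const (0 : ℝ) ξ)⟩
  have dπ : HasDerivAt (fun r : ℝ => planeProj E (x + r • ξ)) (projVelocity E c (t x)) 0 := by
    have := (h.hasFDerivAt_proj hxV).hasLineDerivAt ξ
    rwa [fderiv_proj h hU hP hx, h1, one_smul] at this
  have ht0 : t (x + (0 : ℝ) • ξ) = t x := by rw [hx0]
  have dP : HasDerivAt (fun r : ℝ => projVelocity E c (t (x + r • ξ)))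
      (deriv (projVelocity E c) (t x)) 0 := by
    have := (hasDerivAt_projVelocity h hU hP (hP.t_mem x hx))
    rw [← ht0] at this
    have h5 := this.scomp (0 : ℝ) dt
    rw [one_smul, ht0] at h5
    exact h5
  have dA : HasDerivAt (fun r : ℝ => footVelocity F E c (t (x + r • ξ)))
      (deriv (footVelocity F E c) (t x)) 0 := by
    have := (hasDerivAt_footVelocity h hU hP (hP.t_mem x hx))
    rw [← ht0] at this
    have h5 := this.scomp (0 : ℝ) dt
    rw [one_smul, ht0] at h5
    exact h5
  have lhs := ddF.sub (dπ.clm_apply ddF)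
  have rhs := ddt.smul ((dP.clm_apply dF).add dA)
  -- `fderiv_sub_proj` is differentiated along the line through `x` in the direction `ξ`. The terms
  -- with the velocity of the projection applied to `w` lie in the ruling plane, and the second
  -- derivative of `F` is tangent by minimality.
  have key := lhs.unique (rhs.congr_of_eventuallyEq (by
    have hn : ∀ᶠ r : ℝ in 𝓝 0, x + r • ξ ∈ U :=
      hline.continuousAt.eventually (by simpa using hP.isOpen.mem_nhds hx)
    filter_upwards [hn] with r hr
    exact fderiv_sub_proj h hU hP hr ξ))
  simp only [Pi.add_apply, zero_smul, add_zero, h1, h2, one_smul] at key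
  have hPw := projVelocity_mem h hU hP hx hwE
  have e1 : deriv (projVelocity E c) (t x) (F x) + deriv (footVelocity F E c) (t x) =
      (fderiv ℝ (fderiv ℝ F) x ξ ξ - planeProj E x (fderiv ℝ (fderiv ℝ F) x ξ ξ)) -
        2 • projVelocity E c (t x) w - T₂ • w := by
    have e0 : projVelocity E c (t x) (F x) + footVelocity F E c (t x) = w := rfl
    rw [e0] at key
    linear_combination (norm := module) -key
  rw [e1]
  have e2 : planeProj E x ((fderiv ℝ (fderiv ℝ F) x ξ ξ -
      planeProj E x (fderiv ℝ (fderiv ℝ F) x ξ ξ)) -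
        2 • projVelocity E c (t x) w - T₂ • w) = - (2 • projVelocity E c (t x) w) := by
    rw [map_sub, map_sub, map_sub, planeProj_apply_planeProj, map_nsmul, map_smul, hwE, hPw]
    simp
  rw [e2]
  have e3 := sub_planeProj_mem_span h hU hP hx hmin
  have e4 := Submodule.sub_mem _ e3 (Submodule.smul_mem _ T₂ (Submodule.mem_span_singleton_self w))
  convert! e4 using 1
  abel

/-- The ruling planes are open pieces of affine planes, contained in the patch. -/
theorem eventually_exists_add_smul {x : W} (hx : x ∈ U) {e : Y} (he : e ∈ E x) :
    ∀ᶠ s : ℝ in 𝓝 0, ∃ y ∈ U, t y = t x ∧ planeProj E y = planeProj E x ∧ F y = F x + s • e := by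
  obtain ⟨γ, hγ, hγ0, hγe⟩ := h.ruled x (hU hx) e he
  have hn : ∀ᶠ s : ℝ in 𝓝 0, γ s ∈ U :=
    hγ.eventually (by rw [hγ0]; exact hP.isOpen.mem_nhds hx)
  filter_upwards [hγe, hn] with s hs hsU
  have hp : planeProj E (γ s) = planeProj E x := by simp only [planeProj, hs.2]
  have hpe : planeProj E x e = e := Submodule.starProjection_eq_self_iff.2 he
  refine ⟨γ s, hsU, hP.t_congr _ hsU _ hx hp ?_, hp, hs.1⟩
  rw [planeFoot, planeFoot, hp, hs.1, map_add, map_smul, hpe]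
  abel

end IsRulingPatch
end RuledMinimal

/-- The factor `κ` is bounded near `s`, so the right-hand side is uniformly Lipschitz there and
solutions of the equation are unique. -/
theorem eventuallyEq_of_hasDerivAt_smul {Z : Type*} [NormedAddCommGroup Z] [NormedSpace ℝ Z]
    {g : Z → Z} {C : NNReal} (hg : LipschitzWith C g) {κ : ℝ → ℝ} {s : ℝ} (hκ : ContinuousAt κ s)
    {f₁ f₂ : ℝ → Z} (h₁ : ∀ᶠ r in 𝓝 s, HasDerivAt f₁ (κ r • g (f₁ r)) r)
    (h₂ : ∀ᶠ r in 𝓝 s, HasDerivAt f₂ (κ r • g (f₂ r)) r) (h : f₁ s = f₂ s) :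
    f₁ =ᶠ[𝓝 s] f₂ := by
  refine ODE_solution_unique_of_eventually (v := fun r z => κ r • g z) (s := fun _ => Set.univ)
    (K := (‖κ s‖₊ + 1) * C) ?_ (h₁.mono fun r hr => ⟨hr, trivial⟩)
    (h₂.mono fun r hr => ⟨hr, trivial⟩) h
  have hb : ∀ᶠ r in 𝓝 s, ‖κ r‖₊ < ‖κ s‖₊ + 1 :=
    hκ.nnnorm.eventually (gt_mem_nhds (lt_add_one _))
  filter_upwards [hb] with r hr
  refine LipschitzWith.lipschitzOnWith ((LipschitzWith.weaken ?_ (mul_le_mul_left hr.le C)))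
  refine LipschitzWith.of_dist_le_mul fun x y => ?_
  rw [dist_eq_norm, ← smul_sub, norm_smul, ← dist_eq_norm, NNReal.coe_mul, mul_assoc]
  exact mul_le_mul_of_nonneg_left (hg.dist_le_mul x y) (norm_nonneg _)

/-- The right side is continuous in both vectors, so not being parallel is an open condition. -/
theorem mem_span_singleton_iff_norm_sq_smul {Y : Type*} [NormedAddCommGroup Y]
    [InnerProductSpace ℝ Y] {w : Y} (hw : w ≠ 0) (u : Y) :
    u ∈ Submodule.span ℝ {w} ↔ ⟪w, w⟫_ℝ • u - ⟪w, u⟫_ℝ • w = 0 := by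
  have hn : ⟪w, w⟫_ℝ ≠ 0 := inner_self_ne_zero.2 hw
  rw [Submodule.mem_span_singleton, sub_eq_zero]
  constructor
  · rintro ⟨r, rfl⟩
    rw [inner_smul_right, smul_smul, mul_comm]
  · intro h
    refine ⟨⟪w, u⟫_ℝ / ⟪w, w⟫_ℝ, ?_⟩
    rw [div_eq_inv_mul, mul_smul, ← h, inv_smul_smul₀ hn]

/-! ### The ruling planes move by a one-parameter group of rigid motions -/

section RuledMinimal

variable {W Y : Type*} [NormedAddCommGroup W] [NormedSpace ℝ W]
  [NormedAddCommGroup Y] [InnerProductSpace ℝ Y] [FiniteDimensional ℝ Y]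
  {V : Set W} {F : W → Y} {E : W → Submodule ℝ Y} {U : Set W} {a b : ℝ} {t : W → ℝ} {c : ℝ → W}

/-- The infinitesimal rotation that generates the motion of the ruling planes. -/
def rotationGen (E : W → Submodule ℝ Y) (c : ℝ → W) (s : ℝ) : Y →L[ℝ] Y :=
  projVelocity E c s * planeProj E (c s) - planeProj E (c s) * projVelocity E c s

/-- The infinitesimal translation that generates the motion of the ruling planes. -/
def translationGen (F : W → Y) (E : W → Submodule ℝ Y) (c : ℝ → W) (s : ℝ) : Y :=
  footVelocity F E c s + 2 • projVelocity E c s (planeFoot F E (c s))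

/-- The orbit of an affine plane (with direction the range of the projection `Q` and foot `q`)
under the one-parameter group of rigid motions with Killing field `y ↦ K y + k`, with the
nondegeneracy condition that the orbit is not contained in an affine space of dimension one more. -/
structure IsScrewMotion (K : Y →L[ℝ] Y) (k : Y) (Q : ℝ → Y →L[ℝ] Y) (q : ℝ → Y) : Prop where
  hasDerivAt_proj : ∀ r, HasDerivAt Q (K * Q r - Q r * K) r
  hasDerivAt_foot : ∀ r, HasDerivAt q (K (q r) + k - Q r k) r
  rotation_eq : ∀ r, (K * Q r - Q r * K) * Q r - Q r * (K * Q r - Q r * K) = K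
  translation_eq : ∀ r, (K (q r) + k - Q r k) + 2 • (K * Q r - Q r * K) (q r) = k
  ne_zero : K ≠ 0
  nondegenerate : ∀ r y, y - Q r y = q r → K y + k ≠ 0 →
    ∃ e, Q r e = e ∧ K e ∉ Submodule.span ℝ {K y + k}

namespace IsRulingPatch

variable (h : RuledMinimal V F E) (hU : U ⊆ V) (hP : IsRulingPatch F E U a b t c)
include h hU hP

/-- At the point `F x + σ • e` of the ruling the normal velocity and the normal acceleration are
affine in `σ`, with proportionality at every small `σ`. By `hne`, the factor `μ` found at `x`
therefore serves the entire plane, and the projection algebra converts this into the equations for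
the generators. -/
theorem gen_deriv {x : W} (hx : x ∈ U) {e₀ : Y} (he₀ : e₀ ∈ E x)
    (hne : projVelocity E c (t x) e₀ ∉ Submodule.span ℝ {normalVelocity F E t c x}) {μ : ℝ}
    (hμ : (deriv (projVelocity E c) (t x) (F x) + deriv (footVelocity F E c) (t x)) -
      planeProj E x (deriv (projVelocity E c) (t x) (F x) + deriv (footVelocity F E c) (t x)) =
      μ • normalVelocity F E t c x) :
    HasDerivAt (rotationGen E c) (μ • rotationGen E c (t x)) (t x) ∧
    HasDerivAt (translationGen F E c) (μ • translationGen F E c (t x)) (t x) := by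
  have hs := hP.t_mem x hx
  set s := t x with hsx
  have hpx := hP.proj_eq x hx
  have hax := hP.foot_eq x hx
  rw [← hsx] at hpx hax
  set p := planeProj E x with hp
  set p₁ := projVelocity E c s with hp₁
  set p₂ := deriv (projVelocity E c) s with hp₂
  set y := planeFoot F E x with hy
  set y₁ := footVelocity F E c s with hy₁
  set y₂ := deriv (footVelocity F E c) s with hy₂
  have hL := eq_smul_of_forall_mem_span_add_smul (E x) (normalVelocity_ne_zero h hU hP hx) (μ := μ)
    (L := p₁) (L' := p₂ - p * p₂) (by
      intro e he
      filter_upwards [eventually_exists_add_smul h hU hP hx he] with σ hσ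
      obtain ⟨z, hz, htz, hpz, hFz⟩ := hσ
      have h1 := normalAcceleration_mem_span h hU hP hz
      have h2 : normalVelocity F E t c z = normalVelocity F E t c x + σ • p₁ e := by
        rw [normalVelocity, normalVelocity, htz, hFz, map_add, map_smul, ← hsx]
        abel
      rw [h2, htz, hpz, ← hsx, hFz] at h1
      convert! h1 using 1
      rw [← hμ]
      simp only [map_add, map_smul, sub_apply, mul_apply_eq_comp, smul_sub]
      abel) he₀ hne
  have hpp : p * p = p := planeProj_mul_self E x
  have hA : p₂ * p - p * p₂ * p = μ • (p₁ * p) := by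
    ext v
    exact hL (p v) (Submodule.starProjection_apply_mem _ _)
  have sp : (p : Y →ₗ[ℝ] Y).IsSymmetric := planeProj_isSymmetric E x
  have sp₁ : (p₁ : Y →ₗ[ℝ] Y).IsSymmetric := projVelocity_isSymmetric h hU hP hs
  have sp₂ : (p₂ : Y →ₗ[ℝ] Y).IsSymmetric := deriv_projVelocity_isSymmetric h hU hP hs
  -- This is the adjoint of `hA`, because `p`, `p₁` and `p₂` are symmetric.
  have hA' : p * p₂ - p * p₂ * p = μ • (p * p₁) := by
    ext v
    refine ext_inner_right ℝ fun u => ?_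
    have h1 := congrArg (fun z => ⟪v, z⟫_ℝ) (DFunLike.congr_fun hA u)
    simp only [sub_apply, mul_apply_eq_comp, smul_apply, inner_sub_right, inner_smul_right,
      inner_sub_left, inner_smul_left] at h1 ⊢
    have a1 : ∀ x y, ⟪p x, y⟫_ℝ = ⟪x, p y⟫_ℝ := sp
    have a2 : ∀ x y, ⟪p₁ x, y⟫_ℝ = ⟪x, p₁ y⟫_ℝ := sp₁
    have a3 : ∀ x y, ⟪p₂ x, y⟫_ℝ = ⟪x, p₂ y⟫_ℝ := sp₂
    rw [a1, a3, a1, a3, a1, a1, a2, h1]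
    rfl
  have hF : F x = p (F x) + y := by rw [hy, planeFoot, ← hp]; abel
  -- Subtracting the part of `hμ` that comes from the ruling component `p (F x)` leaves the relation
  -- at the foot.
  have hB : (y₂ + p₂ y) - p (y₂ + p₂ y) = μ • (p₁ y + y₁) := by
    have h1 := hL (p (F x)) (Submodule.starProjection_apply_mem _ _)
    have h2 := hμ
    rw [normalVelocity, ← hsx, ← hp₁, ← hy₁, hF] at h2
    simp only [map_add, smul_add, sub_apply, mul_apply_eq_comp] at h1 h2 ⊢
    linear_combination (norm := module) h2 - h1
  have hd₁ := projVelocity_mul h hU hP hs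
  have hf₁ := projVelocity_foot h hU hP hs
  have hf₂ := projVelocity_deriv_foot h hU hP hs
  rw [← hpx, ← hp₁] at hd₁
  rw [← hpx, ← hax, ← hp₁, ← hy₁] at hf₁
  rw [← hpx, ← hax, ← hp₁, ← hy₁, ← hp₂, ← hy₂] at hf₂
  have k1 := commutator_deriv_eq_smul hA hA'
  have k2 := translation_deriv_eq_smul hpp hd₁ (planeProj_planeFoot F E x) hf₂ hA' hB
  have dP := hasDerivAt_proj h hU hP hs
  have dP' := hasDerivAt_projVelocity h hU hP hs
  have dA := hasDerivAt_foot h hU hP hs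
  have dA' := hasDerivAt_footVelocity h hU hP hs
  constructor
  · have h1 := (dP'.mul dP).sub (dP.mul dP')
    rw [rotationGen, ← hpx, ← hp₁, ← k1]
    convert! h1 using 1
    rw [← hpx]; abel
  · have h1 := dA'.add ((dP'.clm_apply dA).const_smul (2 : ℕ))
    rw [translationGen, ← hax, ← hp₁, ← k2]
    convert! h1 using 1
    rw [← hax, smul_add]; abel

/-- If the ruling plane at one point of a patch moves along a screw motion, then so do all ruling
planes of the patch. -/
theorem exists_screwMotion {K : Y →L[ℝ] Y} {k : Y} {Q : ℝ → Y →L[ℝ] Y} {q : ℝ → Y}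
    (hS : IsScrewMotion K k Q q) {s₀ r₀ ρ₀ : ℝ} (hs₀ : s₀ ∈ Set.Ioo a b) (hρ₀ : ρ₀ ≠ 0)
    (hQ : planeProj E (c s₀) = Q r₀) (hq : planeFoot F E (c s₀) = q r₀)
    (hQ' : projVelocity E c s₀ = ρ₀ • (K * Q r₀ - Q r₀ * K))
    (hq' : footVelocity F E c s₀ = ρ₀ • (K (q r₀) + k - Q r₀ k)) :
    ∃ r ρ : ℝ → ℝ, ContDiffOn ℝ ∞ r (Set.Ioo a b) ∧ ∀ s ∈ Set.Ioo a b, ρ s ≠ 0 ∧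
      planeProj E (c s) = Q (r s) ∧ planeFoot F E (c s) = q (r s) ∧
      projVelocity E c s = ρ s • (K * Q (r s) - Q (r s) * K) ∧
      footVelocity F E c s = ρ s • (K (q (r s)) + k - Q (r s) k) := by
  set I := Set.Ioo a b with hI
  have hIo : IsOpen I := isOpen_Ioo
  set w : ℝ → Y := fun s => projVelocity E c s (F (c s)) + footVelocity F E c s with hw
  set N : ℝ → Y := fun s => deriv (projVelocity E c) s (F (c s)) + deriv (footVelocity F E c) s
    with hN
  -- This factor is defined and smooth at every parameter. Only at nondegenerate planes is it known
  -- to be the common factor for the whole plane.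
  set μ : ℝ → ℝ := fun s => ⟪w s, N s - planeProj E (c s) (N s)⟫_ℝ / ⟪w s, w s⟫_ℝ with hμ
  have hwv : ∀ s ∈ I, normalVelocity F E t c (c s) = w s := fun s hs => by
    rw [normalVelocity, hP.t_c s hs]
  have hw0 : ∀ s ∈ I, w s ≠ 0 := fun s hs => by
    rw [← hwv s hs]; exact normalVelocity_ne_zero h hU hP (hP.c_mem s hs)
  have cF : ContDiffOn ℝ ∞ (fun s => F (c s)) I :=
    h.smooth.comp hP.smooth_c fun s hs => hU (hP.c_mem s hs)
  have cP := contDiffOn_proj h hU hP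
  have cA := contDiffOn_foot h hU hP
  have cP' := contDiffOn_projVelocity h hU hP
  have cA' := contDiffOn_footVelocity h hU hP
  have cw : ContDiffOn ℝ ∞ w I := (cP'.clm_apply cF).add cA'
  have cN : ContDiffOn ℝ ∞ N I :=
    ((((contDiffOn_infty_iff_deriv_of_isOpen isOpen_Ioo).1 cP').2).clm_apply cF).add
      ((contDiffOn_infty_iff_deriv_of_isOpen isOpen_Ioo).1 cA').2
  have cμ : ContDiffOn ℝ ∞ μ I :=
    (cw.inner ℝ (cN.sub (cP.clm_apply cN))).div (cw.inner ℝ cw)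
      fun s hs => inner_self_ne_zero.2 (hw0 s hs)
  obtain ⟨m, cm, hm0, hm⟩ := exists_primitive_contDiffOn_Ioo hs₀ cμ 0
  -- The generators should be `ρ • K` and `ρ • k` with `ρ' = μ * ρ`; the parameter `r` along the
  -- orbit then has derivative `ρ`.
  set ρ : ℝ → ℝ := fun s => ρ₀ * Real.exp (m s) with hρ
  have cρ : ContDiffOn ℝ ∞ ρ I := contDiffOn_const.mul (Real.contDiff_exp.comp_contDiffOn cm)
  have hρ0 : ∀ s, ρ s ≠ 0 := fun s => mul_ne_zero hρ₀ (Real.exp_ne_zero _)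
  have hρd : ∀ s ∈ I, HasDerivAt ρ (μ s * ρ s) s := fun s hs => by
    convert! ((hm s hs).exp.const_mul ρ₀) using 1
    rw [hρ]; ring
  obtain ⟨r, cr, hr0, hr⟩ := exists_primitive_contDiffOn_Ioo hs₀ cρ r₀
  have recover : ∀ s ∈ I, rotationGen E c s = ρ s • K → translationGen F E c s = ρ s • k →
      projVelocity E c s = ρ s • (K * planeProj E (c s) - planeProj E (c s) * K) ∧
      footVelocity F E c s = ρ s • (K (planeFoot F E (c s)) + k - planeProj E (c s) k) := by
    intro s hs h3 h4
    have e1 := proj_deriv_eq_commutator (planeProj_mul_self E (c s)) (projVelocity_mul h hU hP hs)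
    have e2 := foot_deriv_eq (a₁ := footVelocity F E c s) (projVelocity_mul h hU hP hs)
      (planeProj_planeFoot F E (c s)) (projVelocity_foot h hU hP hs)
    change rotationGen E c s * _ - _ * rotationGen E c s = _ at e1
    change rotationGen E c s _ + translationGen F E c s -
      planeProj E (c s) (translationGen F E c s) = _ at e2
    rw [h3] at e1
    rw [h3, h4] at e2
    rw [← e1, ← e2]
    constructor
    · rw [smul_mul_assoc, mul_smul_comm, smul_sub]
    · rw [map_smul, smul_apply, smul_sub, smul_add]
  -- Agreement of the generators is included along with agreement of the planes: without it the
  -- agreement could not be continued.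
  set J : Set ℝ := {s | s ∈ I ∧ planeProj E (c s) = Q (r s) ∧ planeFoot F E (c s) = q (r s) ∧
      rotationGen E c s = ρ s • K ∧ translationGen F E c s = ρ s • k} with hJ
  have hJ0 : s₀ ∈ J := by
    have hρs : ρ s₀ = ρ₀ := by rw [hρ]; simp [hm0]
    refine ⟨hs₀, by rw [hr0, hQ], by rw [hr0, hq], ?_, ?_⟩
    · rw [rotationGen, hQ', hQ, hρs, smul_mul_assoc, mul_smul_comm, ← smul_sub, hS.rotation_eq]
    · rw [translationGen, hQ', hq', hq, hρs]
      conv_rhs => rw [← hS.translation_eq r₀]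
      rw [smul_apply, smul_add, smul_comm (2 : ℕ) ρ₀]
  have hJo : IsOpen J := by
    rw [isOpen_iff_mem_nhds]
    rintro s ⟨hs, h1, h2, h3, h4⟩
    have hn := hIo.mem_nhds hs
    have kw : w s = ρ s • (K (F (c s)) + k) := by
      have := killing_apply_eq (a₁ := footVelocity F E c s) (planeProj_mul_self E (c s))
        (projVelocity_mul h hU hP hs) (y := F (c s)) (a := planeFoot F E (c s)) rfl
      change rotationGen E c s (F (c s)) + translationGen F E c s = w s at this
      rw [← this, h3, h4, smul_apply, smul_add]
    have hKk : K (F (c s)) + k ≠ 0 := fun h0 => hw0 s hs (by rw [kw, h0, smul_zero])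
    -- At `s` the patch agrees with the screw motion and inherits its nondegeneracy. This persists
    -- for nearby `s'`, so `gen_deriv` applies there.
    obtain ⟨e, heQ, heK⟩ := hS.nondegenerate (r s) (F (c s)) (by rw [← h1, ← h2]; rfl) hKk
    rw [← h1] at heQ
    have hPe : projVelocity E c s e = ρ s • K e := by
      have e1 := DFunLike.congr_fun (projVelocity_mul h hU hP hs) e
      have e2 := DFunLike.congr_fun h3 e
      simp only [rotationGen, sub_apply, add_apply, mul_apply_eq_comp, smul_apply, heQ,
        add_eq_left] at e1 e2
      rw [← e2, e1, sub_zero]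
    set g : ℝ → Y := fun s => projVelocity E c s (planeProj E (c s) e) with hg
    have hgs : g s ∉ Submodule.span ℝ {w s} := by
      simp only [hg]
      rw [heQ, hPe, kw, Submodule.span_singleton_smul_eq (IsUnit.mk0 _ (hρ0 s))]
      exact fun hmem => heK ((Submodule.smul_mem_iff _ (hρ0 s)).1 hmem)
    have cg : ContDiffOn ℝ ∞ g I := cP'.clm_apply (cP.clm_apply contDiffOn_const)
    have cG : ContinuousAt (fun s => ⟪w s, w s⟫_ℝ • g s - ⟪w s, g s⟫_ℝ • w s) s :=
      ((((cw.inner ℝ cw).smul cg).sub ((cw.inner ℝ cg).smul cw)).continuousOn).continuousAt hn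
    have hG : ∀ᶠ s' in 𝓝 s, ⟪w s', w s'⟫_ℝ • g s' - ⟪w s', g s'⟫_ℝ • w s' ≠ 0 :=
      cG.eventually_ne (fun h0 => hgs ((mem_span_singleton_iff_norm_sq_smul (hw0 s hs) _).2 h0))
    have hgen : ∀ᶠ s' in 𝓝 s, HasDerivAt (rotationGen E c) (μ s' • rotationGen E c s') s' ∧
        HasDerivAt (translationGen F E c) (μ s' • translationGen F E c s') s' := by
      filter_upwards [hG, hn] with s' hG' hs'
      have ht := hP.t_c s' hs'
      have := gen_deriv h hU hP (hP.c_mem s' hs') (e₀ := planeProj E (c s') e) (μ := μ s')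
        (Submodule.starProjection_apply_mem _ _)
        (by rw [ht, hwv s' hs', mem_span_singleton_iff_norm_sq_smul (hw0 s' hs')]; exact hG')
        (by
          have h5 := normalAcceleration_mem_span h hU hP (hP.c_mem s' hs')
          rw [hwv s' hs', mem_span_singleton_iff_norm_sq_smul (hw0 s' hs'), sub_eq_zero, ht] at h5
          rw [hwv s' hs', ht]
          change _ = (⟪w s', N s' - planeProj E (c s') (N s')⟫_ℝ / ⟪w s', w s'⟫_ℝ) • w s'
          rw [div_eq_inv_mul, mul_smul, ← h5, inv_smul_smul₀ (inner_self_ne_zero.2 (hw0 s' hs'))])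
      rwa [ht] at this
    -- Both pairs of generators solve the same linear equation with factor `μ`, so they agree near
    -- `s`.
    have hgeq := eventuallyEq_of_hasDerivAt_smul (g := id) LipschitzWith.id
      (cμ.continuousOn.continuousAt hn) (f₁ := fun s => (rotationGen E c s, translationGen F E c s))
      (f₂ := fun s => (ρ s • K, ρ s • k))
      (hgen.mono fun s' hs' => hs'.1.prodMk hs'.2)
      (by
        filter_upwards [hn] with s' hs'
        convert! ((hρd s' hs').smul_const K).prodMk ((hρd s' hs').smul_const k) using 1
        simp [mul_smul])
      (by simp only [h3, h4])
    have hrec : ∀ᶠ s' in 𝓝 s, s' ∈ I ∧ rotationGen E c s' = ρ s' • K ∧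
        translationGen F E c s' = ρ s' • k := by
      filter_upwards [hn, hgeq] with s' hs' he
      exact ⟨hs', congrArg Prod.fst he, congrArg Prod.snd he⟩
    let G : ((Y →L[ℝ] Y) × Y) →L[ℝ] ((Y →L[ℝ] Y) × Y) :=
      ((ContinuousLinearMap.mul ℝ (Y →L[ℝ] Y) K -
          (ContinuousLinearMap.mul ℝ (Y →L[ℝ] Y)).flip K) ∘L ContinuousLinearMap.fst ℝ _ _).prod
        (K ∘L ContinuousLinearMap.snd ℝ _ _ -
          ContinuousLinearMap.apply ℝ Y k ∘L ContinuousLinearMap.fst ℝ _ _)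
    -- With the generators known, `recover` gives both families of planes the same first-order
    -- equation, with right-hand side `ρ` times an affine field.
    have hpq := eventuallyEq_of_hasDerivAt_smul (g := fun z => G z + (0, k))
      (C := ‖G‖₊) (LipschitzWith.of_dist_le_mul fun x y => by
        rw [dist_add_right]; exact G.lipschitz.dist_le_mul x y) (κ := ρ)
      (cρ.continuousOn.continuousAt hn)
      (f₁ := fun s => (planeProj E (c s), planeFoot F E (c s)))
      (f₂ := fun s => (Q (r s), q (r s)))
      (by
        filter_upwards [hrec] with s' hs'
        have h5 := recover s' hs'.1 hs'.2.1 hs'.2.2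
        convert! (hasDerivAt_proj h hU hP hs'.1).prodMk (hasDerivAt_foot h hU hP hs'.1) using 1
        rw [h5.1, h5.2]
        simp [G]
        module)
      (by
        filter_upwards [hn] with s' hs'
        convert! ((hS.hasDerivAt_proj (r s')).scomp s' (hr s' hs')).prodMk
          ((hS.hasDerivAt_foot (r s')).scomp s' (hr s' hs')) using 1
        simp [G]
        module)
      (by simp only [h1, h2])
    filter_upwards [hrec, hpq] with s' h5 h6
    exact ⟨h5.1, congrArg Prod.fst h6, congrArg Prod.snd h6, h5.2⟩
  have hJc : closure J ∩ I ⊆ J := by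
    rintro s ⟨hsJ, hs⟩
    rw [mem_closure_iff_frequently] at hsJ
    have hn := hIo.mem_nhds hs
    have kr : ContinuousAt r s := (hr s hs).continuousAt
    have kρ : ContinuousAt ρ s := (hρd s hs).continuousAt
    have kP := (hasDerivAt_proj h hU hP hs).continuousAt
    have kA := (hasDerivAt_foot h hU hP hs).continuousAt
    have kP' := (hasDerivAt_projVelocity h hU hP hs).continuousAt
    have kA' := (hasDerivAt_footVelocity h hU hP hs).continuousAt
    have kQ : ContinuousAt (fun s => Q (r s)) s :=
      ContinuousAt.comp (f := r) (g := Q) (hS.hasDerivAt_proj (r s)).continuousAt kr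
    have kq : ContinuousAt (fun s => q (r s)) s :=
      ContinuousAt.comp (f := r) (g := q) (hS.hasDerivAt_foot (r s)).continuousAt kr
    have kG : ContinuousAt (rotationGen E c) s := (kP'.mul kP).sub (kP.mul kP')
    have kT : ContinuousAt (translationGen F E c) s := kA'.add ((kP'.clm_apply kA).const_smul 2)
    exact ⟨hs, tendsto_nhds_unique_of_frequently_eq kP kQ (hsJ.mono fun s hs => hs.2.1),
      tendsto_nhds_unique_of_frequently_eq kA kq (hsJ.mono fun s hs => hs.2.2.1),
      tendsto_nhds_unique_of_frequently_eq kG (kρ.smul continuousAt_const)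
        (hsJ.mono fun s hs => hs.2.2.2.1),
      tendsto_nhds_unique_of_frequently_eq kT (kρ.smul continuousAt_const)
        (hsJ.mono fun s hs => hs.2.2.2.2)⟩
  have hsub : I ⊆ J := isPreconnected_Ioo.subset_of_closure_inter_subset hJo ⟨s₀, hs₀, hJ0⟩ hJc
  refine ⟨r, ρ, cr, fun s hs => ?_⟩
  obtain ⟨-, h1, h2, h3, h4⟩ := hsub hs
  have h5 := recover s hs h3 h4
  rw [h1, h2] at h5
  exact ⟨hρ0 s, h1, h2, h5⟩

end IsRulingPatch

/-- The ruling plane at `x` is a member of the family `(Q, q)`, and moves infinitesimally as the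
family `(Q, q)` does under the Killing field `(K, k)`. -/
def MovesAlong (F : W → Y) (E : W → Submodule ℝ Y) (K : Y →L[ℝ] Y) (k : Y) (Q : ℝ → Y →L[ℝ] Y)
    (q : ℝ → Y) (x : W) : Prop :=
  ∃ (r : ℝ) (ξ : W), planeProj E x = Q r ∧ planeFoot F E x = q r ∧
    fderiv ℝ (planeProj E) x ξ = K * Q r - Q r * K ∧
    fderiv ℝ (planeFoot F E) x ξ = K (q r) + k - Q r k

/-- The vector `ξ` in `MovesAlong` is not normalized, so the initial speed is the inverse of the
derivative of `t` on `ξ`. That derivative is nonzero because otherwise `rotation_eq` would give `K =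
0`. -/
theorem IsRulingPatch.exists_forall_movesAlong (h : RuledMinimal V F E) (hU : U ⊆ V)
    (hP : IsRulingPatch F E U a b t c) {K : Y →L[ℝ] Y} {k : Y} {Q : ℝ → Y →L[ℝ] Y} {q : ℝ → Y}
    (hS : IsScrewMotion K k Q q) {x₀ : W} (hx₀ : x₀ ∈ U) (hM : MovesAlong F E K k Q q x₀) :
    ∃ r : W → ℝ, ContDiffOn ℝ ∞ r U ∧ ∀ x ∈ U, planeProj E x = Q (r x) ∧
      planeFoot F E x = q (r x) ∧ MovesAlong F E K k Q q x := by
  obtain ⟨r₀, ξ, h1, h2, h3, h4⟩ := hM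
  rw [fderiv_proj h hU hP hx₀] at h3
  rw [fderiv_foot h hU hP hx₀] at h4
  have hne : fderiv ℝ t x₀ ξ ≠ 0 := by
    intro h0
    apply hS.ne_zero
    have := hS.rotation_eq r₀
    rw [← h3, h0, zero_smul, zero_mul, mul_zero, sub_zero] at this
    exact this.symm
  obtain ⟨r, ρ, cr, hr⟩ := exists_screwMotion h hU hP hS (hP.t_mem x₀ hx₀) (inv_ne_zero hne)
    (hP.proj_eq x₀ hx₀ ▸ h1) (hP.foot_eq x₀ hx₀ ▸ h2)
    (by rw [← h3, inv_smul_smul₀ hne]) (by rw [← h4, inv_smul_smul₀ hne])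
  refine ⟨fun x => r (t x), cr.comp hP.smooth_t hP.t_mem, fun x hx => ?_⟩
  obtain ⟨hρ, e1, e2, e3, e4⟩ := hr (t x) (hP.t_mem x hx)
  rw [← hP.proj_eq x hx] at e1
  rw [← hP.foot_eq x hx] at e2
  obtain ⟨ζ, hζ, -⟩ := exists_fderiv_eq_normalVelocity h hU hP hx
  refine ⟨e1, e2, r (t x), (ρ (t x))⁻¹ • ζ, e1, e2, ?_, ?_⟩
  · rw [fderiv_proj h hU hP hx, map_smul, hζ, e3, smul_eq_mul, mul_one, inv_smul_smul₀ hρ]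
  · rw [fderiv_foot h hU hP hx, map_smul, hζ, e4, smul_eq_mul, mul_one, inv_smul_smul₀ hρ]

end RuledMinimal

/-! ### Helicoids as orbits of a plane under a Killing field -/

section Helicoid

variable {Y : Type*} [NormedAddCommGroup Y] [InnerProductSpace ℝ Y]
  {ι : Type*} [Fintype ι]

/-- The operator `x ↦ ⟪u, x⟫ w`, as a bilinear map in `u` and `w`. -/
def dyad (Y : Type*) [NormedAddCommGroup Y] [InnerProductSpace ℝ Y] : Y →L[ℝ] Y →L[ℝ] Y →L[ℝ] Y :=
  LinearMap.mkContinuous₂ (LinearMap.mk₂ ℝ (fun u w : Y => (innerSL ℝ u).smulRight w)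
    (fun u u' w => by ext x; simp [add_smul])
    (fun c u w => by ext x; simp [mul_smul])
    (fun u w w' => by ext x; simp)
    (fun c u w => by ext x; simp [smul_smul, mul_comm])) 1
    (fun u w => by
      rw [LinearMap.mk₂_apply, ContinuousLinearMap.norm_smulRight_apply, innerSL_apply_norm, one_mul])

theorem dyad_apply (u w x : Y) : dyad Y u w x = ⟪u, x⟫_ℝ • w := by
  simp [dyad]

/-- The operator `x ↦ ∑ i, ⟪e i, x⟫ e i`; the orthogonal projection onto the span of `e` if `e` is
orthonormal. -/
def frameProj (e : ι → Y) : Y →L[ℝ] Y :=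
  ∑ i, dyad Y (e i) (e i)

theorem frameProj_apply (e : ι → Y) (x : Y) : frameProj e x = ∑ i, ⟪e i, x⟫_ℝ • e i := by
  simp [frameProj, dyad_apply]

/-- Initial data of a generalized helicoid: a Killing field `y ↦ K y + k` that translates the point
`o` with velocity `v` and rotates the orthonormal vector `e i` in the plane of `e i` and `d i` with
angular velocity `l i`. -/
structure IsHelicoidFrame (K : Y →L[ℝ] Y) (k : Y) (e d : ι → Y) (l : ι → ℝ) (o v : Y) : Prop where
  orthonormal : Orthonormal ℝ e
  skew : ∀ x y, ⟪K x, y⟫_ℝ = -⟪x, K y⟫_ℝ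
  map_e : ∀ i, K (e i) = l i • d i
  map_d : ∀ i, K (d i) = -(l i • e i)
  map_o : K o + k = v
  map_v : K v = 0
  v_e : ∀ i, ⟪v, e i⟫_ℝ = 0
  offDiag : K * frameProj e + frameProj e * K = K
  nondegenerate : (∃ i j, i ≠ j ∧ l i ≠ 0 ∧ l j ≠ 0) ∨ (v ≠ 0 ∧ ∃ i, l i ≠ 0)

/-- The frame of the ruling of a helicoid. -/
def helicoidFrame (e d : ι → Y) (l : ι → ℝ) (r : ℝ) (i : ι) : Y :=
  Real.cos (l i * r) • e i + Real.sin (l i * r) • d i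

namespace IsHelicoidFrame

variable {K : Y →L[ℝ] Y} {k : Y} {e d : ι → Y} {l : ι → ℝ} {o v : Y}

theorem _root_.helicoidFrame_zero {ι : Type*} {e d : ι → Y} {l : ι → ℝ} :
    helicoidFrame e d l 0 = e := by
  funext i; simp [helicoidFrame]

section
variable (h : IsHelicoidFrame K k e d l o v)
include h

theorem hasDerivAt_frame (i : ι) (r : ℝ) :
    HasDerivAt (fun r => helicoidFrame e d l r i) (K (helicoidFrame e d l r i)) r := by
  have h1 : HasDerivAt (fun r => l i * r) (l i) r := by
    simpa using (hasDerivAt_id r).const_mul (l i)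
  convert! (h1.cos.smul_const (e i)).add (h1.sin.smul_const (d i)) using 1
  rw [helicoidFrame, map_add, map_smul, map_smul, h.map_e, h.map_d]
  module

theorem map_map_frame (i : ι) (r : ℝ) :
    K (K (helicoidFrame e d l r i)) = -(l i ^ 2) • helicoidFrame e d l r i := by
  simp only [helicoidFrame, map_add, map_smul, h.map_e, h.map_d, map_neg]
  module

theorem orthonormal_frame (r : ℝ) : Orthonormal ℝ (helicoidFrame e d l r) := by
  classical
  have h1 : ∀ i j, ⟪helicoidFrame e d l r i, helicoidFrame e d l r j⟫_ℝ = ⟪e i, e j⟫_ℝ := by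
    intro i j
    have hd : ∀ r, HasDerivAt (fun r => ⟪helicoidFrame e d l r i, helicoidFrame e d l r j⟫_ℝ) 0 r := by
      intro r
      convert! (h.hasDerivAt_frame i r).inner ℝ (h.hasDerivAt_frame j r) using 1
      rw [h.skew]; ring
    have := is_const_of_deriv_eq_zero (fun r => (hd r).differentiableAt) (fun r => (hd r).deriv) r 0
    rw [this, helicoidFrame_zero]
  rw [orthonormal_iff_ite]
  intro i j
  rw [h1]
  exact (orthonormal_iff_ite.1 h.orthonormal) i j

theorem inner_v_frame (r : ℝ) (i : ι) : ⟪v, helicoidFrame e d l r i⟫_ℝ = 0 := by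
  have hd : ∀ r, HasDerivAt (fun r => ⟪v, helicoidFrame e d l r i⟫_ℝ) 0 r := by
    intro r
    convert! (hasDerivAt_const r v).inner ℝ (h.hasDerivAt_frame i r) using 1
    have := h.skew v (helicoidFrame e d l r i)
    rw [h.map_v, inner_zero_left] at this
    rw [inner_zero_left]; linarith
  have := is_const_of_deriv_eq_zero (fun r => (hd r).differentiableAt) (fun r => (hd r).deriv) r 0
  rw [this, helicoidFrame_zero, h.v_e]

theorem inner_map_frame (r : ℝ) (i j : ι) :
    ⟪K (helicoidFrame e d l r i), K (helicoidFrame e d l r j)⟫_ℝ =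
      l j ^ 2 * ⟪helicoidFrame e d l r i, helicoidFrame e d l r j⟫_ℝ := by
  rw [h.skew, h.map_map_frame, inner_smul_right]; ring

theorem hasDerivAt_frameProj (r : ℝ) :
    HasDerivAt (fun r => frameProj (helicoidFrame e d l r))
      (K * frameProj (helicoidFrame e d l r) - frameProj (helicoidFrame e d l r) * K) r := by
  have h2 : ∀ i, HasDerivAt (fun r => dyad Y (helicoidFrame e d l r i))
      (dyad Y (K (helicoidFrame e d l r i))) r := fun i =>
    HasFDerivAt.comp_hasDerivAt (l := dyad Y) r (dyad Y).hasFDerivAt (h.hasDerivAt_frame i r)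
  have h3 : ∀ i, HasDerivAt (fun r => dyad Y (helicoidFrame e d l r i) (helicoidFrame e d l r i))
      (dyad Y (K (helicoidFrame e d l r i)) (helicoidFrame e d l r i) +
        dyad Y (helicoidFrame e d l r i) (K (helicoidFrame e d l r i))) r := fun i =>
    HasDerivAt.clm_apply (h2 i) (h.hasDerivAt_frame i r)
  have h4 : HasDerivAt (fun r => frameProj (helicoidFrame e d l r)) (∑ i,
      (dyad Y (K (helicoidFrame e d l r i)) (helicoidFrame e d l r i) +
        dyad Y (helicoidFrame e d l r i) (K (helicoidFrame e d l r i)))) r :=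
    HasDerivAt.fun_sum (u := Finset.univ) fun i _ => h3 i
  convert! h4 using 1
  ext x
  simp only [frameProj, sub_apply, mul_apply_eq_comp, sum_apply, map_sum]
  rw [← Finset.sum_sub_distrib]
  refine Finset.sum_congr rfl fun i _ => ?_
  simp [h.skew, dyad_apply]
  abel

/-- The derivative in `r` is the commutator of `K * K` with the frame projection. It vanishes
because the frame vectors are eigenvectors of `K * K`. -/
theorem offDiag_frame (r : ℝ) :
    K * frameProj (helicoidFrame e d l r) + frameProj (helicoidFrame e d l r) * K = K := by
  have hd : ∀ r, HasDerivAt (fun r => K * frameProj (helicoidFrame e d l r) +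
      frameProj (helicoidFrame e d l r) * K) 0 r := by
    intro r
    convert! ((h.hasDerivAt_frameProj r).const_mul K).add ((h.hasDerivAt_frameProj r).mul_const K)
      using 1
    have : K * K * frameProj (helicoidFrame e d l r) =
        frameProj (helicoidFrame e d l r) * (K * K) := by
      ext x
      simp only [mul_apply_eq_comp, frameProj_apply, map_sum, map_smul]
      refine Finset.sum_congr rfl fun i _ => ?_
      have : ⟪helicoidFrame e d l r i, K (K x)⟫_ℝ =
          -(l i ^ 2) * ⟪helicoidFrame e d l r i, x⟫_ℝ := by
        have h1 := h.skew (helicoidFrame e d l r i) (K x)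
        have h2 := h.skew (K (helicoidFrame e d l r i)) x
        rw [h.map_map_frame, inner_smul_left] at h2
        simp at h2
        linarith
      rw [h.map_map_frame, this]
      module
    rw [mul_sub, sub_mul, ← mul_assoc, this]
    noncomm_ring
  have := is_const_of_deriv_eq_zero (fun r => (hd r).differentiableAt) (fun r => (hd r).deriv) r 0
  rw [this, helicoidFrame_zero, h.offDiag]

end

theorem frameProj_mul_self {e : ι → Y} (he : Orthonormal ℝ e) :
    frameProj e * frameProj e = frameProj e := by
  classical
  ext x
  simp only [mul_apply_eq_comp, frameProj_apply, inner_sum, inner_smul_right,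
    orthonormal_iff_ite.1 he]
  simp

/-- The point `o` moves along `o + r • v` because `K v = 0`, and `v` stays orthogonal to the frame;
the foot is thus that of the plane through `o + r • v`. Nondegeneracy at `r = 0` propagates since
the lengths and angles of the vectors `K (e i)` are preserved. -/
theorem isScrewMotion (h : IsHelicoidFrame K k e d l o v) :
    IsScrewMotion K k (fun r => frameProj (helicoidFrame e d l r))
      (fun r => o + r • v - frameProj (helicoidFrame e d l r) o) := by
  set Q : ℝ → Y →L[ℝ] Y := fun r => frameProj (helicoidFrame e d l r) with hQ
  have hQQ : ∀ r, Q r * Q r = Q r := fun r => frameProj_mul_self (h.orthonormal_frame r)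
  have hQv : ∀ r, Q r v = 0 := by
    intro r
    simp only [hQ, frameProj_apply]
    refine Finset.sum_eq_zero fun i _ => ?_
    rw [real_inner_comm, h.inner_v_frame, zero_smul]
  have hoff : ∀ r y, K (Q r y) + Q r (K y) = K y := fun r y =>
    DFunLike.congr_fun (h.offDiag_frame r) y
  have hQKQ : ∀ r, Q r * K * Q r = 0 := by
    intro r
    have h1 : K * Q r + Q r * K = K := h.offDiag_frame r
    have h2 := congrArg (Q r * ·) h1
    simp only [mul_add, ← mul_assoc, hQQ] at h2
    simpa using h2
  have hk : k = v - K o := by rw [← h.map_o]; abel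
  refine ⟨h.hasDerivAt_frameProj, ?_, ?_, ?_, ?_, ?_⟩
  · intro r
    have h1 := ((hasDerivAt_const r o).add ((hasDerivAt_id r).smul_const v)).sub
      ((h.hasDerivAt_frameProj r).clm_apply (hasDerivAt_const r o))
    convert! h1 using 1
    change _ = 0 + (1 : ℝ) • v - ((K * Q r - Q r * K) o + Q r 0)
    change K (o + r • v - Q r o) + k - Q r k = _
    rw [hk]
    simp [h.map_v, hQv]
    abel
  · intro r
    rw [sub_mul, mul_sub, mul_assoc, hQQ, hQKQ, ← mul_assoc, hQKQ, ← mul_assoc, hQQ]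
    simpa using h.offDiag_frame r
  · intro r
    change K (o + r • v - Q r o) + k - Q r k + 2 • (K * Q r - Q r * K) (o + r • v - Q r o) = k
    have h1 := DFunLike.congr_fun (hQQ r) o
    have h2 := DFunLike.congr_fun (hQKQ r) o
    have h3 := hoff r o
    rw [hk]
    simp only [mul_apply_eq_comp, zero_apply] at h1 h2
    simp only [sub_apply, mul_apply_eq_comp, map_sub, map_add, map_smul, h.map_v, hQv, h1, h2,
      smul_zero, add_zero, sub_zero, map_zero]
    linear_combination (norm := module) -h3
  · intro h0
    have : ∀ i, l i = 0 := by
      intro i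
      have h1 := h.map_map_frame i 0
      rw [h0] at h1
      have h2 : helicoidFrame e d l 0 i ≠ 0 := (h.orthonormal_frame 0).ne_zero i
      simpa [h2] using h1
    rcases h.nondegenerate with ⟨i, j, -, hi, -⟩ | ⟨-, i, hi⟩ <;> exact hi (this i)
  · intro r y hy hne
    change y - Q r y = o + r • v - Q r o at hy
    have hw : K y + k = v + K (Q r (y - o)) := by
      have : y = o + r • v + Q r (y - o) := by rw [map_sub]; linear_combination (norm := module) hy
      conv_lhs => rw [this]
      rw [hk]
      simp only [map_add, map_smul, h.map_v]
      module
    set w := K y + k with hwdef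
    by_contra! hcon
    have hfix : ∀ i, Q r (helicoidFrame e d l r i) = helicoidFrame e d l r i := by
      classical
      intro i
      simp only [hQ, frameProj_apply, orthonormal_iff_ite.1 (h.orthonormal_frame r)]
      simp
    have hc : ∀ i, ∃ c : ℝ, c • w = K (helicoidFrame e d l r i) := fun i =>
      Submodule.mem_span_singleton.1 (hcon _ (hfix i))
    have hl : ∀ i, K (helicoidFrame e d l r i) = 0 → l i = 0 := by
      intro i h0
      have h1 := h.map_map_frame i r
      rw [h0, map_zero] at h1
      have h2 := (h.orthonormal_frame r).ne_zero i
      simpa [h2] using h1.symm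
    have hww : ⟪w, w⟫_ℝ ≠ 0 := inner_self_ne_zero.2 hne
    -- If every `K (e i)` were parallel to `w`, two rotating directions would give nonzero vectors
    -- that are orthogonal yet parallel. With one rotating direction and `v ≠ 0`, the vector `K (e
    -- i)` is orthogonal to `v` while `w` is not.
    rcases h.nondegenerate with ⟨i, j, hij, hi, hj⟩ | ⟨hv, i, hi⟩
    · obtain ⟨x, hx⟩ := hc i
      obtain ⟨z, hz⟩ := hc j
      have h1 := h.inner_map_frame r i j
      rw [(h.orthonormal_frame r).2 hij, ← hx, ← hz, inner_smul_left, inner_smul_right] at h1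
      have h2 : x = 0 ∨ z = 0 := by simpa [hww, hne] using h1
      rcases h2 with rfl | rfl
      · exact hi (hl i (by rw [← hx, zero_smul]))
      · exact hj (hl j (by rw [← hz, zero_smul]))
    · obtain ⟨x, hx⟩ := hc i
      have hKv : ∀ y, ⟪K y, v⟫_ℝ = 0 := fun y => by rw [h.skew, h.map_v, inner_zero_right, neg_zero]
      have h1 := hKv (helicoidFrame e d l r i)
      rw [← hx, inner_smul_left, hw, inner_add_left, hKv, add_zero] at h1
      have h2 : x = 0 := by simpa [hv] using h1
      exact hi (hl i (by rw [← hx, h2, zero_smul]))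

end IsHelicoidFrame
end Helicoid

/-! ### Normal form of an off-diagonal Killing field -/

section HelicoidFrame

variable {Y : Type*} [NormedAddCommGroup Y] [InnerProductSpace ℝ Y]

theorem frameProj_orthonormalBasis {ι : Type*} [Fintype ι] {E : Submodule ℝ Y}
    [E.HasOrthogonalProjection] (u : OrthonormalBasis ι ℝ E) :
    frameProj (fun i => (u i : Y)) = E.starProjection := by
  ext x
  rw [frameProj_apply]
  refine (Submodule.eq_starProjection_of_mem_of_inner_eq_zero
    (Submodule.sum_mem _ fun i _ => E.smul_mem _ (u i).2) fun y hy => ?_).symm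
  have h1 := u.sum_repr' ⟨y, hy⟩
  have h2 : y = ∑ i, ⟪(u i : Y), y⟫_ℝ • (u i : Y) := by
    have := congrArg (Submodule.subtype E) h1
    simpa using this.symm
  rw [inner_sub_left, sub_eq_zero, sum_inner]
  conv_lhs => rw [h2, inner_sum]
  refine Finset.sum_congr rfl fun i _ => ?_
  rw [inner_smul_left, inner_smul_right, real_inner_comm x]
  simp [mul_comm]

/-- By `hoff`, `K` exchanges `E` and its orthogonal complement, so `-K²` acts on `E` and is
symmetric and nonnegative there. Its eigenvectors are the rotating directions, and sliding the base
point inside the plane removes the part of its velocity that the rotations can produce. -/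
theorem exists_isHelicoidFrame [FiniteDimensional ℝ Y] {E : Submodule ℝ Y} {K : Y →L[ℝ] Y}
    {k a y e₀ : Y} (skew : ∀ x y, ⟪K x, y⟫_ℝ = -⟪x, K y⟫_ℝ)
    (hoff : K * E.starProjection + E.starProjection * K = K)
    (hk : E.starProjection (K a + k) = 0) (hy : y - E.starProjection y = a) (hw : K y + k ≠ 0)
    (he₀ : e₀ ∈ E) (hne : K e₀ ∉ Submodule.span ℝ {K y + k}) {m : ℕ}
    (hm : Module.finrank ℝ E = m) :
    ∃ (e d : Fin m → Y) (l : Fin m → ℝ) (o v : Y), IsHelicoidFrame K k e d l o v ∧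
      frameProj e = E.starProjection ∧ o - E.starProjection o = a := by
  set P := E.starProjection with hP
  have hoff' : ∀ z, K (P z) + P (K z) = K z := fun z => DFunLike.congr_fun hoff z
  have hPE : ∀ z ∈ E, P z = z := fun z hz => Submodule.starProjection_eq_self_iff.2 hz
  have hKE : ∀ z ∈ E, P (K z) = 0 := by
    intro z hz
    have := hoff' z
    rwa [hPE z hz, add_eq_left] at this
  have hKn : ∀ z, P z = 0 → P (K z) = K z := by
    intro z hz
    have := hoff' z
    rwa [hz, map_zero, zero_add] at this
  have hPi : ∀ z, ∀ x ∈ E, ⟪P z, x⟫_ℝ = ⟪z, x⟫_ℝ := by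
    intro z x hx
    rw [hP, Submodule.inner_starProjection_left_eq_right, ← hP, hPE x hx]
  let T : E →ₗ[ℝ] E := -((E.orthogonalProjectionOnto ∘L K ∘L K ∘L E.subtypeL : E →L[ℝ] E) : E →ₗ[ℝ] E)
  have hT : ∀ x : E, ((T x : E) : Y) = -(P (K (K x))) := fun x => rfl
  have hTi : ∀ x z : E, ⟪T x, z⟫_ℝ = ⟪K x, K z⟫_ℝ := by
    intro x z
    rw [Submodule.coe_inner, hT, inner_neg_left, hPi _ _ z.2, skew, neg_neg]
  have hTs : T.IsSymmetric := fun x z => by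
    rw [hTi, real_inner_comm, ← hTi, real_inner_comm]
  let u := hTs.eigenvectorBasis hm
  set e : Fin m → Y := fun i => (u i : Y) with he
  have heE : ∀ i, e i ∈ E := fun i => (u i).2
  have heo : Orthonormal ℝ e := u.orthonormal.comp_linearIsometry E.subtypeₗᵢ
  have hfr : frameProj e = P := frameProj_orthonormalBasis u
  set l : Fin m → ℝ := fun i => ‖K (e i)‖ with hl
  have hKK : ∀ i, K (K (e i)) = -(l i ^ 2) • e i := by
    intro i
    have h1 := hTs.apply_eigenvectorBasis hm i
    have h2 : T (u i) = (hTs.eigenvalues hm i) • u i := h1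
    have h3 : hTs.eigenvalues hm i = l i ^ 2 := by
      have h4 := hTi (u i) (u i)
      rw [h2, inner_smul_left, real_inner_self_eq_norm_sq, u.orthonormal.1 i,
        real_inner_self_eq_norm_sq] at h4
      simpa using h4
    have h5 := congrArg (Submodule.subtype E) h2
    rw [Submodule.subtype_apply, hT, hKn _ (hKE _ (heE i)), h3] at h5
    rw [neg_smul, ← neg_eq_iff_eq_neg]
    simpa using h5
  have hl0 : ∀ i, l i = 0 → K (e i) = 0 := fun i hi => norm_eq_zero.1 hi
  have hKij : ∀ i j, i ≠ j → ⟪K (e i), K (e j)⟫_ℝ = 0 := by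
    intro i j hij
    rw [skew, hKK, inner_smul_right, heo.2 hij, mul_zero, neg_zero]
  set z : Y := K a + k with hz
  -- The coefficients make `v` the component of `z` orthogonal to all `K (e j)`. When `l j = 0` the
  -- inverse is `0` by convention, harmlessly since `K (e j) = 0`.
  set o : Y := a - ∑ j, ((l j ^ 2)⁻¹ * ⟪z, K (e j)⟫_ℝ) • e j with ho
  set v : Y := K o + k with hv
  have hvz : v = z - ∑ j, ((l j ^ 2)⁻¹ * ⟪z, K (e j)⟫_ℝ) • K (e j) := by
    rw [hv, ho, hz, map_sub, map_sum]
    simp only [map_smul]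
    abel
  have hPa : P a = 0 := by
    rw [← hy, map_sub, sub_eq_zero]
    exact (hPE _ (Submodule.starProjection_apply_mem _ _)).symm
  have hPv : P v = 0 := by
    rw [hvz, map_sub, hk, map_sum]
    simp [hKE _ (heE _)]
  have hvK : ∀ i, ⟪v, K (e i)⟫_ℝ = 0 := by
    intro i
    rw [hvz, inner_sub_left, sum_inner, Finset.sum_eq_single i, inner_smul_left,
      real_inner_self_eq_norm_sq]
    · change _ - ((l i ^ 2)⁻¹ * ⟪z, K (e i)⟫_ℝ) * l i ^ 2 = 0
      by_cases h0 : l i = 0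
      · simp [hl0 i h0]
      · field_simp; ring
    · intro j _ hji
      rw [inner_smul_left, hKij j i hji, mul_zero]
    · simp
  have hKv : K v = 0 := by
    rw [← hKn v hPv, ← hfr, frameProj_apply]
    refine Finset.sum_eq_zero fun i _ => ?_
    have := skew (e i) v
    rw [real_inner_comm, hvK] at this
    rw [show ⟪e i, K v⟫_ℝ = 0 by linarith, zero_smul]
  have hexp : ∀ x ∈ E, K x = ∑ i, ⟪e i, x⟫_ℝ • K (e i) := by
    intro x hx
    conv_lhs => rw [← hPE x hx, ← hfr, frameProj_apply, map_sum]
    simp only [map_smul]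
  have hyw : K y + k = v + K (P (y - o)) := by
    have h1 : P o = -∑ j, ((l j ^ 2)⁻¹ * ⟪z, K (e j)⟫_ℝ) • e j := by
      rw [ho, map_sub, hPa, zero_sub, hPE _ (Submodule.sum_mem _ fun i _ => E.smul_mem _ (heE i))]
    have h2 : o = a + P o := by rw [h1, ho]; abel
    have h3 : y = a + P y := by rw [← hy]; abel
    have h5 : y = o + (P y - P o) := by linear_combination (norm := module) h3 - h2
    rw [hv, map_sub P y o]
    conv_lhs => rw [h5]
    rw [map_add K o]; abel
  -- For `l i = 0` the second vector becomes `0`; it is never used as a unit vector.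
  refine ⟨e, fun i => (l i)⁻¹ • K (e i), l, o, v, ⟨heo, skew, ?_, ?_, rfl, hKv, ?_, ?_, ?_⟩, hfr, ?_⟩
  · intro i
    by_cases h0 : l i = 0
    · rw [hl0 i h0]; simp
    · rw [smul_inv_smul₀ h0]
  · intro i
    rw [map_smul, hKK, smul_smul, ← neg_smul]
    congr 1
    by_cases h0 : l i = 0
    · simp [h0]
    · field_simp
  · intro i
    rw [real_inner_comm, ← hPE _ (heE i), hP, Submodule.inner_starProjection_left_eq_right, ← hP,
      hPv, inner_zero_right]
  · rw [hfr, hoff]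
  -- Otherwise `v = 0` and only one direction rotates. Then `K y + k` is a nonzero multiple of the
  -- single vector `K (e i)`, and so is parallel to `K e₀`, against `hne`.
  · by_contra! hcon
    obtain ⟨h1, h2⟩ := hcon
    obtain ⟨i, hi⟩ : ∃ i, l i ≠ 0 := by
      by_contra! h0
      apply hne
      rw [hexp e₀ he₀, Finset.sum_eq_zero fun i _ => by rw [hl0 i (h0 i), smul_zero]]
      exact Submodule.zero_mem _
    have hv0 : v = 0 := by
      by_contra h0
      exact hi (h2 h0 i)
    have hone : ∀ x ∈ E, K x = ⟪e i, x⟫_ℝ • K (e i) := by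
      intro x hx
      rw [hexp x hx, Finset.sum_eq_single i]
      · intro j _ hji
        rw [hl0 j (h1 i j hji.symm hi), smul_zero]
      · simp
    rw [hv0, zero_add, hone _ (Submodule.starProjection_apply_mem _ _)] at hyw
    apply hne
    have hc : ⟪e i, P (y - o)⟫_ℝ ≠ 0 := fun h0 => hw (by rw [hyw, h0, zero_smul])
    rw [hyw, hone e₀ he₀, Submodule.span_singleton_smul_eq (IsUnit.mk0 _ hc)]
    exact Submodule.smul_mem _ _ (Submodule.mem_span_singleton_self _)
  · have : P (∑ j, ((l j ^ 2)⁻¹ * ⟪z, K (e j)⟫_ℝ) • e j) =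
        ∑ j, ((l j ^ 2)⁻¹ * ⟪z, K (e j)⟫_ℝ) • e j :=
      hPE _ (Submodule.sum_mem _ fun i _ => E.smul_mem _ (heE i))
    rw [ho, map_sub, this, hPa]
    abel

end HelicoidFrame

/-! ### Congruence with the parametrized helicoid -/

section Embedding

theorem exists_equiv_sum_fin {m : ℕ} (l : Fin m → ℝ) :
    ∃ (s r : ℕ) (φ : Fin s ⊕ Fin r ≃ Fin m), s + r = m ∧ (∀ i, l (φ (.inl i)) ≠ 0) ∧
      ∀ j, l (φ (.inr j)) = 0 := by
  classical
  let φ := (Equiv.sumCongr (Fintype.equivFin {i // l i ≠ 0}).symm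
    (Fintype.equivFin {i // ¬ l i ≠ 0}).symm).trans (Equiv.sumCompl (fun i => l i ≠ 0))
  refine ⟨_, _, φ, ?_, ?_, ?_⟩
  · have := Fintype.card_congr φ
    rwa [Fintype.card_sum, Fintype.card_fin, Fintype.card_fin, Fintype.card_fin] at this
  · intro i
    exact ((Fintype.equivFin {i // l i ≠ 0}).symm i).2
  · intro j
    exact not_not.1 ((Fintype.equivFin {i // ¬ l i ≠ 0}).symm j).2

/-- One spare dimension is needed when `v = 0`: the helicoid space still has an axis coordinate,
identically zero in that case, and the ambient space may have no direction left for it. -/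
theorem exists_linearIsometry_perp (n : ℕ) :
    ∃ (J : EucSp n →ₗᵢ[ℝ] EucSp (n + 1)) (z : EucSp (n + 1)), ⟪z, z⟫_ℝ = 1 ∧
      ∀ y, ⟪z, J y⟫_ℝ = 0 := by
  let bas := EuclideanSpace.basisFun (Fin n) ℝ
  let f : EucSp n →ₗ[ℝ] EucSp (n + 1) :=
    bas.toBasis.constr ℝ fun i => EuclideanSpace.single i.castSucc (1 : ℝ)
  have hf : ∀ i, f (bas.toBasis i) = EuclideanSpace.single i.castSucc (1 : ℝ) :=
    fun i => bas.toBasis.constr_basis ℝ _ i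
  refine ⟨f.isometryOfOrthonormal (v := bas.toBasis) (by simp [bas.orthonormal]) ?_,
    EuclideanSpace.single (Fin.last n) 1, by simp, ?_⟩
  · rw [orthonormal_iff_ite]
    intro i j
    rw [Function.comp_apply, Function.comp_apply, hf, hf]
    simp [EuclideanSpace.inner_single_left]
  · intro y
    change ⟪_, f y⟫_ℝ = 0
    rw [Module.Basis.constr_apply_fintype, inner_sum]
    refine Finset.sum_eq_zero fun i _ => ?_
    simp [inner_smul_right, EuclideanSpace.inner_single_left, (Fin.castSucc_lt_last i).ne']

/-- A ruled family with frame `helicoidFrame e d l` along the line `o + r v` is congruent to a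
generalized helicoid. -/
theorem exists_congruent_helicoidParam {n m : ℕ} {e d : Fin m → EucSp n} {l : Fin m → ℝ}
    {o v : EucSp n} (he : Orthonormal ℝ e) (hve : ∀ i, ⟪v, e i⟫_ℝ = 0)
    (hdv : ∀ i, l i ≠ 0 → ⟪d i, v⟫_ℝ = 0) (hde : ∀ i j, l i ≠ 0 → ⟪d i, e j⟫_ℝ = 0)
    (hdd : ∀ i j, l i ≠ 0 → l j ≠ 0 → ⟪d i, d j⟫_ℝ = if i = j then 1 else 0) :
    ∃ (s r : ℕ) (φ : Fin s ⊕ Fin r ≃ Fin m) (l₀ : ℝ) (l' : Fin s → ℝ) (N : ℕ)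
      (A : EucSp n →ᵃⁱ[ℝ] EucSp N) (B : HelicoidSpace s r →ᵃⁱ[ℝ] EucSp N),
      s + r = m ∧ (∀ i, l' i ≠ 0) ∧ ∀ (τ : ℝ) (u : Fin m → ℝ),
        A (o + τ • v + ∑ i, u i • helicoidFrame e d l τ i) =
          B (helicoidParam l₀ l' (τ, WithLp.toLp 2 (fun i => u (φ (.inl i))),
            WithLp.toLp 2 (fun j => u (φ (.inr j))))) := by
  classical
  obtain ⟨s, r, φ, hsr, hφ, hφ'⟩ := exists_equiv_sum_fin l
  obtain ⟨inc, z, hz, hzp⟩ := exists_linearIsometry_perp n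
  -- The unit vector of the axis, with `λ₀ = ‖v‖`; the spare direction is used when the axis
  -- degenerates.
  let z₀ : EucSp (n + 1) := if v = 0 then z else inc (‖v‖⁻¹ • v)
  have hz₀ : ‖v‖ • z₀ = inc v := by
    by_cases hv : v = 0
    · simp [hv]
    · simp only [z₀, hv, if_false, map_smul]
      rw [smul_inv_smul₀ (norm_ne_zero_iff.2 hv)]
  have hz₀n : ⟪z₀, z₀⟫_ℝ = 1 := by
    by_cases hv : v = 0
    · simp only [z₀, hv, if_true, hz]
    · simp only [z₀, hv, if_false, inc.inner_map_map, inner_smul_left, inner_smul_right,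
        real_inner_self_eq_norm_sq]
      have := norm_ne_zero_iff.2 hv
      simp
      field_simp
  have hz₀i : ∀ y, ⟪v, y⟫_ℝ = 0 → ⟪z₀, inc y⟫_ℝ = 0 := by
    intro y hy
    by_cases hv : v = 0
    · simp only [z₀, hv, if_true, hzp]
    · simp only [z₀, hv, if_false, inc.inner_map_map, inner_smul_left, hy, mul_zero]
  let η : Unit ⊕ (Fin s × Fin 2) ⊕ Fin r → EucSp (n + 1) :=
    Sum.elim (fun _ => z₀) (Sum.elim (fun ij => inc (if ij.2 = 0 then e (φ (.inl ij.1)) else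
      d (φ (.inl ij.1)))) (fun j => inc (e (φ (.inr j)))))
  have hee := orthonormal_iff_ite.1 he
  have hη : Orthonormal ℝ η := by
    rw [orthonormal_iff_ite]
    have hz₀n' : ‖z₀‖ = 1 := by
      rw [real_inner_self_eq_norm_sq] at hz₀n
      exact (pow_eq_one_iff_of_nonneg (norm_nonneg _) two_ne_zero).1 hz₀n
    have hed : ∀ i j, l i ≠ 0 → ⟪e j, d i⟫_ℝ = 0 := fun i j hi => by
      rw [real_inner_comm, hde i j hi]
    have hvd : ∀ i, l i ≠ 0 → ⟪v, d i⟫_ℝ = 0 := fun i hi => by rw [real_inner_comm, hdv i hi]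
    have hz₀i' : ∀ y, ⟪v, y⟫_ℝ = 0 → ⟪inc y, z₀⟫_ℝ = 0 := fun y hy => by
      rw [real_inner_comm, hz₀i y hy]
    rintro (⟨⟩ | ⟨i, a⟩ | j) (⟨⟩ | ⟨i', a'⟩ | j') <;> (try fin_cases a) <;> (try fin_cases a') <;>
      simp [η, hee, hdd, hde, hed, hz₀i, hz₀i', hve, hvd, hφ, hz₀n', inc.inner_map_map]
  let bas := EuclideanSpace.basisFun (Unit ⊕ (Fin s × Fin 2) ⊕ Fin r) ℝ
  let β₀ : HelicoidSpace s r →ₗ[ℝ] EucSp (n + 1) := bas.toBasis.constr ℝ η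
  have hβ₀ : ∀ x, β₀ x = ∑ i, x i • η i := by
    intro x
    simp only [β₀, Module.Basis.constr_apply_fintype]
    rfl
  let β : HelicoidSpace s r →ₗᵢ[ℝ] EucSp (n + 1) := β₀.isometryOfOrthonormal (v := bas.toBasis)
    (by simp [bas.orthonormal]) (by
      convert! hη using 1
      funext i
      simp only [Function.comp_apply, β₀, Module.Basis.constr_basis])
  refine ⟨s, r, φ, ‖v‖, fun i => l (φ (.inl i)), _, inc.toAffineIsometry,
    (AffineIsometryEquiv.vaddConst ℝ (inc o)).toAffineIsometry.comp
      β.toAffineIsometry, hsr, hφ, fun τ u => ?_⟩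
  have hβ : ∀ x, β x = ∑ i, x i • η i := hβ₀
  change inc _ = β _ + inc o
  rw [hβ, Fintype.sum_sum_type, Fintype.sum_sum_type, Fintype.sum_prod_type,
    ← φ.sum_comp, Fintype.sum_sum_type]
  simp only [map_add, map_sum, map_smul, helicoidParam, helicoidFrame, η, hφ', Sum.elim_inl,
    Sum.elim_inr, ← hz₀]
  simp [smul_smul, mul_comm, Finset.sum_add_distrib]
  abel

end Embedding

/-! ### Second derivatives and lines lying in an immersed submanifold -/

section Calculus

variable {W X Y : Type*} [NormedAddCommGroup W] [NormedSpace ℝ W]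
  [NormedAddCommGroup X] [NormedSpace ℝ X] [NormedAddCommGroup Y] [NormedSpace ℝ Y]

theorem fderiv_fderiv_comp {G : X → Y} {θ : W → X} {x : W} (hG : ContDiffAt ℝ 2 G (θ x))
    (hθ : ContDiffAt ℝ 2 θ x) (ξ η : W) :
    fderiv ℝ (fderiv ℝ (G ∘ θ)) x ξ η =
      fderiv ℝ (fderiv ℝ G) (θ x) (fderiv ℝ θ x ξ) (fderiv ℝ θ x η) +
        fderiv ℝ G (θ x) (fderiv ℝ (fderiv ℝ θ) x ξ η) := by
  have h1 : fderiv ℝ (G ∘ θ) =ᶠ[𝓝 x] fun y => fderiv ℝ G (θ y) ∘L fderiv ℝ θ y := by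
    have hG' : ∀ᶠ y in 𝓝 x, ContDiffAt ℝ 2 G (θ y) :=
      hθ.continuousAt.eventually (hG.eventually (by simp))
    filter_upwards [hG', hθ.eventually (by simp)] with y h2 h3
    exact fderiv_comp y (h2.differentiableAt (by simp)) (h3.differentiableAt (by simp))
  have dG : HasFDerivAt (fderiv ℝ G) (fderiv ℝ (fderiv ℝ G) (θ x)) (θ x) :=
    ((hG.fderiv_right (m := 1) (by norm_num)).differentiableAt (by simp)).hasFDerivAt
  have dθ : HasFDerivAt (fderiv ℝ θ) (fderiv ℝ (fderiv ℝ θ) x) x :=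
    ((hθ.fderiv_right (m := 1) (by norm_num)).differentiableAt (by simp)).hasFDerivAt
  have dGθ : HasFDerivAt (fun y => fderiv ℝ G (θ y))
      (fderiv ℝ (fderiv ℝ G) (θ x) ∘L fderiv ℝ θ x) x :=
    dG.comp x (hθ.differentiableAt (by simp)).hasFDerivAt
  rw [h1.fderiv_eq, (dGθ.clm_comp dθ).fderiv]
  simp [add_comm]

/-- A continuous curve in the domain of an immersion `F` over a straight line is smooth, and the
second derivative of `F` along it is tangential. -/
theorem hasDerivAt_of_comp_eq_line [FiniteDimensional ℝ W] [FiniteDimensional ℝ Y] {F : W → Y}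
    {x ξ : W} (hF : ContDiffAt ℝ ∞ F x)
    (hi : Function.Injective (fderiv ℝ F x)) {γ : ℝ → W} (hγ : ContinuousAt γ 0) (hγ0 : γ 0 = x)
    (hl : ∀ᶠ s in 𝓝 (0 : ℝ), F (γ s) = F x + s • fderiv ℝ F x ξ) :
    HasDerivAt γ ξ 0 ∧ fderiv ℝ (fderiv ℝ F) x ξ ξ ∈ (fderiv ℝ F x).range := by
  have : CompleteSpace W := FiniteDimensional.complete ℝ W
  -- Composing `F` with a left inverse of its derivative gives a local diffeomorphism, which
  -- expresses the merely continuous `γ` through the smooth line.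
  obtain ⟨L₀, hL₀⟩ := LinearMap.exists_leftInverse_of_injective (fderiv ℝ F x : W →ₗ[ℝ] Y)
    (LinearMap.ker_eq_bot.2 hi)
  let L : Y →L[ℝ] W := LinearMap.toContinuousLinearMap L₀
  have hL : ∀ w, L (fderiv ℝ F x w) = w := fun w => LinearMap.congr_fun hL₀ w
  have hG : ContDiffAt ℝ ∞ (fun y => L (F y)) x := L.contDiff.contDiffAt.comp x hF
  have hGd : HasFDerivAt (fun y => L (F y))
      ((ContinuousLinearEquiv.refl ℝ W : W ≃L[ℝ] W) : W →L[ℝ] W) x := by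
    have h1 := L.hasFDerivAt.comp x (hF.differentiableAt (by simp)).hasFDerivAt
    convert! h1 using 1
    ext w
    exact (hL w).symm
  let Φ := hG.toOpenPartialHomeomorph _ hGd (by simp)
  have hΦx : x ∈ Φ.source := hG.mem_toOpenPartialHomeomorph_source hGd (by simp)
  have hinv : ContDiffAt ℝ ∞ Φ.symm (L (F x)) := hG.to_localInverse hGd (by simp)
  have hγeq : γ =ᶠ[𝓝 0] fun s => Φ.symm (L (F x + s • fderiv ℝ F x ξ)) := by
    have hs : ∀ᶠ s in 𝓝 (0 : ℝ), γ s ∈ Φ.source :=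
      hγ.eventually (by rw [hγ0]; exact Φ.open_source.mem_nhds hΦx)
    filter_upwards [hs, hl] with s h1 h2
    rw [← h2]
    exact (Φ.left_inv h1).symm
  have hline : ContDiffAt ℝ ∞ (fun s : ℝ => L (F x + s • fderiv ℝ F x ξ)) 0 :=
    (L.contDiff.comp (contDiff_const.add (contDiff_id.smul contDiff_const))).contDiffAt
  have hγs : ContDiffAt ℝ ∞ γ 0 := by
    refine ContDiffAt.congr_of_eventuallyEq ?_ hγeq
    refine ContDiffAt.comp (f := fun s : ℝ => L (F x + s • fderiv ℝ F x ξ)) 0 ?_ hline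
    simpa using hinv
  have hFx : HasFDerivAt F (fderiv ℝ F x) (γ 0) := by
    rw [hγ0]; exact (hF.differentiableAt (by simp)).hasFDerivAt
  have hd0 : HasDerivAt γ (deriv γ 0) 0 := (hγs.differentiableAt (by simp)).hasDerivAt
  have hline' : ∀ s, HasDerivAt (fun s : ℝ => F x + s • fderiv ℝ F x ξ) (fderiv ℝ F x ξ) s := by
    intro s
    simpa using ((hasDerivAt_id s).smul_const (fderiv ℝ F x ξ)).const_add (F x)
  have e1 : deriv γ 0 = ξ :=
    hi ((hFx.comp_hasDerivAt 0 hd0).unique ((hline' 0).congr_of_eventuallyEq hl))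
  refine ⟨e1 ▸ hd0, ?_⟩
  have hγ2 : ContDiffAt ℝ 2 γ 0 := contDiffAt_infty.1 hγs 2
  have hF2 : ContDiffAt ℝ 2 F (γ 0) := by rw [hγ0]; exact contDiffAt_infty.1 hF 2
  -- The image of `γ` has constant velocity. Differentiating once more shows that the second
  -- derivative of `F` on `ξ` cancels the image of `γ''`, which is tangent.
  have ev : ∀ᶠ s in 𝓝 (0 : ℝ), fderiv ℝ F (γ s) (deriv γ s) = fderiv ℝ F x ξ := by
    filter_upwards [hγ2.eventually (by simp), hγ2.continuousAt.eventually (hF2.eventually (by simp)),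
      hl.eventually_nhds] with s h1 h2 h3
    exact ((h2.differentiableAt (by simp)).hasFDerivAt.comp_hasDerivAt s
      (h1.differentiableAt (by simp)).hasDerivAt).unique ((hline' s).congr_of_eventuallyEq h3)
  have dF : HasFDerivAt (fderiv ℝ F) (fderiv ℝ (fderiv ℝ F) x) (γ 0) := by
    have := ((hF2.fderiv_right (m := 1) (by norm_num)).differentiableAt (by simp)).hasFDerivAt
    rwa [hγ0] at this ⊢
  have hγ1 : HasDerivAt (deriv γ) (deriv (deriv γ) 0) 0 := by
    have h1 : ContDiffAt ℝ 1 (deriv γ) 0 := ContDiffAt.derivWithin hγ2 (by norm_num)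
    exact (h1.differentiableAt (by simp)).hasDerivAt
  have h2 := (dF.comp_hasDerivAt 0 hd0).clm_apply hγ1
  have h3 := h2.unique ((hasDerivAt_const (0 : ℝ) (fderiv ℝ F x ξ)).congr_of_eventuallyEq ev)
  rw [e1, Function.comp_apply, hγ0] at h3
  refine ⟨-deriv (deriv γ) 0, ?_⟩
  change fderiv ℝ F x (-deriv (deriv γ) 0) = _
  rw [map_neg, neg_eq_iff_eq_neg, eq_neg_iff_add_eq_zero, add_comm]
  exact h3

end Calculus

/-! ### Passage between charts -/

section Charts

variable {M : Type*} [TopologicalSpace M] {m : ℕ} [ChartedSpace (EucSp m) M] {Y : Type*}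

/-- The map `f` on `M` in the preferred chart at `p`. -/
def chartRep (m : ℕ) [ChartedSpace (EucSp m) M] (f : M → Y) (p : M) : EucSp m → Y :=
  f ∘ (extChartAt (𝓡 m) p).symm

/-- The change from the preferred chart at `p` to the preferred chart at `q`. -/
def chartChange (m : ℕ) [ChartedSpace (EucSp m) M] (p q : M) : EucSp m → EucSp m :=
  extChartAt (𝓡 m) q ∘ (extChartAt (𝓡 m) p).symm

theorem eventually_chart_symm_mem {p q : M} {x : EucSp m}
    (hx : x ∈ (extChartAt (𝓡 m) p).target)
    (hq : (extChartAt (𝓡 m) p).symm x ∈ (extChartAt (𝓡 m) q).source) :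
    ∀ᶠ y in 𝓝 x, y ∈ (extChartAt (𝓡 m) p).target ∧
      (extChartAt (𝓡 m) p).symm y ∈ (extChartAt (𝓡 m) q).source :=
  Filter.Eventually.and ((isOpen_extChartAt_target p).mem_nhds hx)
    (((continuousOn_extChartAt_symm p).continuousAt
      ((isOpen_extChartAt_target p).mem_nhds hx)).eventually
        ((isOpen_extChartAt_source q).mem_nhds hq))

theorem chartRep_eventuallyEq_comp (f : M → Y) {p q : M} {x : EucSp m}
    (hx : x ∈ (extChartAt (𝓡 m) p).target)
    (hq : (extChartAt (𝓡 m) p).symm x ∈ (extChartAt (𝓡 m) q).source) :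
    chartRep m f p =ᶠ[𝓝 x] chartRep m f q ∘ chartChange m p q := by
  filter_upwards [eventually_chart_symm_mem hx hq] with y hy
  exact congrArg f ((extChartAt (𝓡 m) q).left_inv hy.2).symm

theorem chartChange_mem_target {p q : M} {x : EucSp m}
    (hq : (extChartAt (𝓡 m) p).symm x ∈ (extChartAt (𝓡 m) q).source) :
    chartChange m p q x ∈ (extChartAt (𝓡 m) q).target :=
  (extChartAt (𝓡 m) q).map_source hq

theorem chart_symm_chartChange {p q : M} {x : EucSp m}
    (hq : (extChartAt (𝓡 m) p).symm x ∈ (extChartAt (𝓡 m) q).source) :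
    (extChartAt (𝓡 m) q).symm (chartChange m p q x) = (extChartAt (𝓡 m) p).symm x :=
  (extChartAt (𝓡 m) q).left_inv hq

theorem chartChange_chartChange {p q : M} {x : EucSp m}
    (hx : x ∈ (extChartAt (𝓡 m) p).target)
    (hq : (extChartAt (𝓡 m) p).symm x ∈ (extChartAt (𝓡 m) q).source) :
    chartChange m q p (chartChange m p q x) = x := by
  rw [chartChange, Function.comp_apply, chart_symm_chartChange hq,
    (extChartAt (𝓡 m) p).right_inv hx]

variable [IsManifold (𝓡 m) ∞ M]

theorem contDiffAt_chartChange {p q : M} {x : EucSp m}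
    (hx : x ∈ (extChartAt (𝓡 m) p).target)
    (hq : (extChartAt (𝓡 m) p).symm x ∈ (extChartAt (𝓡 m) q).source) :
    ContDiffAt ℝ ∞ (chartChange m p q) x := by
  have h := contDiffWithinAt_ext_coord_change (I := 𝓡 m) (n := ∞) q p (y := x)
    (by
      rw [PartialEquiv.trans_source]
      exact ⟨hx, hq⟩)
  rwa [ModelWithCorners.range_eq_univ, contDiffWithinAt_univ] at h

theorem surjective_fderiv_chartChange {p q : M} {x : EucSp m}
    (hx : x ∈ (extChartAt (𝓡 m) p).target)
    (hq : (extChartAt (𝓡 m) p).symm x ∈ (extChartAt (𝓡 m) q).source) :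
    Function.Surjective (fderiv ℝ (chartChange m p q) x) := by
  have hy := chartChange_mem_target hq
  have hp : (extChartAt (𝓡 m) q).symm (chartChange m p q x) ∈ (extChartAt (𝓡 m) p).source := by
    rw [chart_symm_chartChange hq]
    exact (extChartAt (𝓡 m) p).map_target hx
  have h1 : HasFDerivAt (chartChange m q p) _ (chartChange m p q x) :=
    ((contDiffAt_chartChange hy hp).differentiableAt (by simp)).hasFDerivAt
  have h2 : HasFDerivAt (chartChange m p q) (fderiv ℝ (chartChange m p q) x)
      (chartChange m q p (chartChange m p q x)) := by
    rw [chartChange_chartChange hx hq]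
    exact ((contDiffAt_chartChange hx hq).differentiableAt (by simp)).hasFDerivAt
  have h3 : chartChange m p q ∘ chartChange m q p =ᶠ[𝓝 (chartChange m p q x)] id := by
    filter_upwards [eventually_chart_symm_mem hy hp] with y hy
    exact chartChange_chartChange hy.1 hy.2
  have h4 := (h2.comp _ h1).unique ((hasFDerivAt_id _).congr_of_eventuallyEq h3)
  intro η
  exact ⟨_, DFunLike.congr_fun h4 η⟩

variable [NormedAddCommGroup Y] [NormedSpace ℝ Y]

theorem contDiffAt_chartRep {f : M → Y} {p : M} {x : EucSp m}
    (hx : x ∈ (extChartAt (𝓡 m) p).target)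
    (hf : ContMDiffAt (𝓡 m) 𝓘(ℝ, Y) ∞ f ((extChartAt (𝓡 m) p).symm x)) :
    ContDiffAt ℝ ∞ (chartRep m f p) x := by
  rw [← contMDiffAt_iff_contDiffAt]
  exact hf.comp x ((contMDiffOn_extChartAt_symm p).contMDiffAt
    ((isOpen_extChartAt_target p).mem_nhds hx))

theorem fderiv_chartRep {f : M → Y} (hf : ContMDiff (𝓡 m) 𝓘(ℝ, Y) ∞ f) {p q : M} {x : EucSp m}
    (hx : x ∈ (extChartAt (𝓡 m) p).target)
    (hq : (extChartAt (𝓡 m) p).symm x ∈ (extChartAt (𝓡 m) q).source) :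
    fderiv ℝ (chartRep m f p) x =
      fderiv ℝ (chartRep m f q) (chartChange m p q x) ∘L fderiv ℝ (chartChange m p q) x := by
  rw [(chartRep_eventuallyEq_comp f hx hq).fderiv_eq]
  exact fderiv_comp x ((contDiffAt_chartRep (chartChange_mem_target hq)
    hf.contMDiffAt).differentiableAt (by simp))
    ((contDiffAt_chartChange hx hq).differentiableAt (by simp))

end Charts

section Immersion

variable {M : Type*} [TopologicalSpace M] {m n : ℕ} [ChartedSpace (EucSp m) M]
  {f : M → EucSp n}

theorem differentialAt_eq_fderiv (hf : ContMDiff (𝓡 m) (𝓡 n) ∞ f) (q : M) :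
    differentialAt m f q = fderiv ℝ (chartRep m f q) (extChartAt (𝓡 m) q q) := by
  have h := ((hf q).mdifferentiableAt (by simp)).mfderiv
  simpa [differentialAt, chartRep, writtenInExtChartAt] using! h

variable [IsManifold (𝓡 m) ∞ M]

/-- The definition uses the preferred chart of the moving point; this replaces it by one fixed
chart, the chart change having surjective derivative. -/
theorem tangentPlane_eq_range (hf : ContMDiff (𝓡 m) (𝓡 n) ∞ f) {p : M} {x : EucSp m}
    (hx : x ∈ (extChartAt (𝓡 m) p).target) :
    tangentPlane m f ((extChartAt (𝓡 m) p).symm x) = (fderiv ℝ (chartRep m f p) x).range := by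
  have hq := mem_extChartAt_source (I := 𝓡 m) ((extChartAt (𝓡 m) p).symm x)
  rw [tangentPlane, differentialAt_eq_fderiv hf, fderiv_chartRep hf hx hq]
  ext y
  constructor
  · rintro ⟨η, rfl⟩
    obtain ⟨ξ, rfl⟩ := surjective_fderiv_chartChange hx hq η
    exact ⟨ξ, rfl⟩
  · rintro ⟨ξ, rfl⟩
    exact ⟨_, rfl⟩

theorem IsSmoothImmersion.injective_fderiv_chartRep (hf : IsSmoothImmersion m f) {p : M}
    {x : EucSp m} (hx : x ∈ (extChartAt (𝓡 m) p).target) :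
    Function.Injective (fderiv ℝ (chartRep m f p) x) := by
  have hq := mem_extChartAt_source (I := 𝓡 m) ((extChartAt (𝓡 m) p).symm x)
  have h1 := hf.2 ((extChartAt (𝓡 m) p).symm x)
  rw [differentialAt_eq_fderiv hf.1] at h1
  rw [fderiv_chartRep hf.1 hx hq]
  exact h1.comp (LinearMap.injective_iff_surjective
    (f := (fderiv ℝ (chartChange m p _) x : EucSp m →ₗ[ℝ] EucSp m)).2
      (surjective_fderiv_chartChange hx hq))

end Immersion

/-! ### The rulings in a chart -/

section Ruled

variable {M : Type*} [TopologicalSpace M] {m n k : ℕ} [ChartedSpace (EucSp m) M]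
  {f : M → EucSp n} {E : M → Submodule ℝ (EucSp n)}

theorem IsRuledAlong.exists_curve (hR : IsRuledAlong f E) {p : M} {x : EucSp m}
    (hx : x ∈ (extChartAt (𝓡 m) p).target) {e : EucSp n} (he : e ∈ chartRep m E p x) :
    ∃ γ : ℝ → EucSp m, ContinuousAt γ 0 ∧ γ 0 = x ∧ ∀ᶠ s in 𝓝 0,
      chartRep m f p (γ s) = chartRep m f p x + s • e ∧ chartRep m E p (γ s) = chartRep m E p x := by
  obtain ⟨ε, hε, σ, hσ, hσ0, hσE⟩ := hR ((extChartAt (𝓡 m) p).symm x)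
  let e' : E ((extChartAt (𝓡 m) p).symm x) := ⟨e, he⟩
  have hl : ContinuousAt (fun s : ℝ => s • e') 0 := by fun_prop
  have hσc : ContinuousAt (fun s : ℝ => σ (s • e')) 0 := by
    refine ContinuousAt.comp (f := fun s : ℝ => s • e') (g := σ) ?_ hl
    rw [zero_smul]
    exact hσ.continuousAt (Metric.ball_mem_nhds _ hε)
  have hps : σ ((0 : ℝ) • e') ∈ (extChartAt (𝓡 m) p).source := by
    rw [zero_smul, hσ0]
    exact (extChartAt (𝓡 m) p).map_target hx
  refine ⟨fun s => extChartAt (𝓡 m) p (σ (s • e')), ?_, ?_, ?_⟩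
  · exact ContinuousAt.comp (f := fun s : ℝ => σ (s • e'))
      ((continuousOn_extChartAt p).continuousAt ((isOpen_extChartAt_source p).mem_nhds hps)) hσc
  · simp only [zero_smul, hσ0]
    exact (extChartAt (𝓡 m) p).right_inv hx
  · have hb : ∀ᶠ s in 𝓝 (0 : ℝ), s • e' ∈ Metric.ball (0 : E ((extChartAt (𝓡 m) p).symm x)) ε :=
      hl.eventually (by
        simp only [zero_smul]
        exact Metric.ball_mem_nhds _ hε)
    filter_upwards [hb, hσc.eventually ((isOpen_extChartAt_source p).mem_nhds hps)] with s h1 h2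
    obtain ⟨h3, h4⟩ := hσE _ h1
    simp only [chartRep, Function.comp_apply, (extChartAt (𝓡 m) p).left_inv h2]
    exact ⟨h3, h4⟩

/-- The `k` spanning fields of a `k`-dimensional space are independent, so they assemble into an
injective operator whose range is the plane. -/
theorem IsSmoothPlaneField.contDiffAt_planeProj [IsManifold (𝓡 m) ∞ M]
    (hE : IsSmoothPlaneField m k f E) {p : M}
    {x : EucSp m} (hx : x ∈ (extChartAt (𝓡 m) p).target) :
    ContDiffAt ℝ ∞ (planeProj (chartRep m E p)) x := by
  obtain ⟨U, hU, hxU, X, hX, hXE⟩ := hE.smooth ((extChartAt (𝓡 m) p).symm x)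
  let A : EucSp m → EucSp k →L[ℝ] EucSp n := fun y =>
    ∑ i, (EuclideanSpace.proj i : EucSp k →L[ℝ] ℝ).smulRight (chartRep m (X i) p y)
  have hA : ContDiffAt ℝ ∞ A x := by
    refine ContDiffAt.sum fun i _ => ContDiffAt.smulRight contDiffAt_const ?_
    exact contDiffAt_chartRep hx ((hX i).contMDiffAt (hU.mem_nhds hxU))
  have hAE : ∀ᶠ y in 𝓝 x, (A y).range = chartRep m E p y := by
    filter_upwards [((continuousOn_extChartAt_symm p).continuousAt
      ((isOpen_extChartAt_target p).mem_nhds hx)).eventually (hU.mem_nhds hxU)] with y hy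
    rw [chartRep, Function.comp_apply, hXE _ hy]
    ext z
    rw [Submodule.mem_span_range_iff_exists_fun]
    constructor
    · rintro ⟨c, rfl⟩
      exact ⟨c, by simp [A, chartRep]⟩
    · rintro ⟨c, rfl⟩
      exact ⟨WithLp.toLp 2 c, by simp [A, chartRep]⟩
  have hAi : ∀ᶠ y in 𝓝 x, Function.Injective (A y) := by
    filter_upwards [hAE] with y hy
    have h1 := LinearMap.finrank_range_add_finrank_ker (A y : EucSp k →ₗ[ℝ] EucSp n)
    have h2 : Module.finrank ℝ (A y : EucSp k →ₗ[ℝ] EucSp n).range = k := by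
      have := hE.finrank_eq ((extChartAt (𝓡 m) p).symm y)
      change Module.finrank ℝ ↥(chartRep m E p y) = k at this
      rw [← hy] at this
      exact this
    rw [h2, finrank_euclideanSpace_fin] at h1
    exact LinearMap.ker_eq_bot.1 (Submodule.finrank_eq_zero.1 (by omega))
  refine (contDiffAt_starProjection_range hA hAi).congr_of_eventuallyEq ?_
  filter_upwards [hAE] with y hy
  simp only [planeProj, hy]

end Ruled

/-! ### Austerity makes the ruled submanifold minimal -/

section Austere

theorem Matrix.IsHermitian.trace_eq_zero_of_map_neg_roots {ι : Type*} [Fintype ι] [DecidableEq ι]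
    {S : Matrix ι ι ℝ} (hS : S.IsHermitian)
    (h : S.charpoly.roots.map (fun t => -t) = S.charpoly.roots) : S.trace = 0 := by
  have h1 := Matrix.trace_eq_sum_roots_charpoly_of_splits hS.splits_charpoly
  have h2 := congrArg Multiset.sum h
  rw [Multiset.sum_map_neg', ← h1] at h2
  linarith

/-- If the quadratic forms of `H` normal to the range of `D` have symmetric spectrum and `H` is
tangential on a hyperplane of directions, it is tangential on the orthogonal direction. -/
theorem apply_apply_mem_range_of_austere {W Y : Type*} [NormedAddCommGroup W] [NormedSpace ℝ W]
    [NormedAddCommGroup Y] [InnerProductSpace ℝ Y] [FiniteDimensional ℝ Y]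
    {k : ℕ} {D : W →L[ℝ] Y} {H : W →L[ℝ] W →L[ℝ] Y} {E : Submodule ℝ Y}
    (hsymm : ∀ ξ η, H ξ η = H η ξ) (hE : E ≤ D.range)
    (hk : Module.finrank ℝ E = k) (hH : ∀ ξ, D ξ ∈ E → H ξ ξ ∈ D.range)
    (haus : ∀ e : Fin (k + 1) → W, Orthonormal ℝ (fun i => D (e i)) → ∀ ν ∈ D.rangeᗮ,
      let S : Matrix (Fin (k + 1)) (Fin (k + 1)) ℝ :=
        Matrix.of fun i j => ⟪D.rangeᗮ.starProjection (H (e i) (e j)), ν⟫_ℝ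
      S.charpoly.roots.map (fun t => -t) = S.charpoly.roots)
    {η : W} (hη : D η ∈ Eᗮ) : H η η ∈ D.range := by
  by_cases hη0 : D η = 0
  · exact hH η (by rw [hη0]; exact E.zero_mem)
  have hn : ‖D η‖ ≠ 0 := norm_ne_zero_iff.2 hη0
  -- The basis is adapted: an orthonormal basis of `E` completed by the unit vector along `D η`. The
  -- diagonal entries from `E` vanish, so trace zero kills the one from `η`.
  let b := (stdOrthonormalBasis ℝ E).reindex (finCongr hk)
  choose ζ hζ using fun i => hE (b i).2
  replace hζ : ∀ i, D (ζ i) = b i := hζ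
  let e : Fin (k + 1) → W := Fin.cons (‖D η‖⁻¹ • η) ζ
  have he : Orthonormal ℝ (fun i => D (e i)) := by
    have hb := b.orthonormal.comp_linearIsometry E.subtypeₗᵢ
    rw [orthonormal_iff_ite] at hb ⊢
    have h0 : ∀ i, ⟪D η, (b i : Y)⟫_ℝ = 0 := fun i => by
      rw [real_inner_comm]; exact hη _ (b i).2
    have h0' : ∀ i, ⟪(b i : Y), D η⟫_ℝ = 0 := fun i => hη _ (b i).2
    refine Fin.cases (Fin.cases ?_ fun j => ?_) fun i => Fin.cases ?_ fun j => ?_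
    · simp only [e, Fin.cons_zero, map_smul, inner_smul_left, inner_smul_right,
        real_inner_self_eq_norm_sq, conj_trivial, if_true]
      field_simp
    · simp [e, hζ, inner_smul_left, h0, (Fin.succ_ne_zero j).symm]
    · simp [e, hζ, inner_smul_right, h0']
    · simpa [e, hζ] using hb i j
  have hN : ∀ y ∈ D.range, D.rangeᗮ.starProjection y = 0 := fun y hy => by
    rw [Submodule.starProjection_apply_eq_zero_iff]
    exact D.range.le_orthogonal_orthogonal hy
  have key : ∀ ν ∈ D.rangeᗮ, ⟪D.rangeᗮ.starProjection (H η η), ν⟫_ℝ = 0 := by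
    intro ν hν
    have h1 := haus e he ν hν
    have h2 := Matrix.IsHermitian.trace_eq_zero_of_map_neg_roots
      (by ext i j; simp [hsymm (e i) (e j)]) h1
    rw [Matrix.trace, Fin.sum_univ_succ] at h2
    have h3 : ∀ i, H (ζ i) (ζ i) ∈ D.range := fun i => hH _ (by rw [hζ]; exact (b i).2)
    simp only [e, Matrix.diag_apply, Matrix.of_apply, Fin.cons_zero, Fin.cons_succ, map_smul,
      smul_apply, hN _ (h3 _), inner_zero_left, Finset.sum_const_zero, add_zero, inner_smul_left,
      conj_trivial] at h2
    simpa [hn] using h2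
  have h4 := key _ (Submodule.starProjection_apply_mem D.rangeᗮ (H η η))
  rw [inner_self_eq_zero, Submodule.starProjection_apply_eq_zero_iff,
    Submodule.orthogonal_orthogonal] at h4
  exact h4

variable {M : Type*} [TopologicalSpace M] {m n k : ℕ} [ChartedSpace (EucSp m) M]
  {f : M → EucSp n} {E : M → Submodule ℝ (EucSp n)} [IsManifold (𝓡 m) ∞ M]

theorem IsAustere.fderiv_fderiv_mem_range (hA : IsAustere m f) (hf : IsSmoothImmersion m f)
    (hE : IsSmoothPlaneField m k f E) (hR : IsRuledAlong f E) (hk : k + 1 = m) {p : M}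
    {η : EucSp m} (hη : fderiv ℝ (chartRep m f p) (extChartAt (𝓡 m) p p) η ∈ (E p)ᗮ) :
    fderiv ℝ (fderiv ℝ (chartRep m f p)) (extChartAt (𝓡 m) p p) η η ∈
      (fderiv ℝ (chartRep m f p) (extChartAt (𝓡 m) p p)).range := by
  subst hk
  have hx := mem_extChartAt_target (I := 𝓡 (k + 1)) p
  have hp : chartRep (k + 1) E p (extChartAt (𝓡 (k + 1)) p p) = E p := by simp [chartRep]
  have hF : ContDiffAt ℝ ∞ (chartRep (k + 1) f p) (extChartAt (𝓡 (k + 1)) p p) :=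
    contDiffAt_chartRep hx hf.1.contMDiffAt
  refine apply_apply_mem_range_of_austere (E := E p) (k := k) ?_ ?_ (hE.finrank_eq p) ?_ ?_ hη
  · exact hF.isSymmSndFDerivAt (by
      rw [minSmoothness_of_isRCLikeNormedField]
      exact WithTop.coe_le_coe.2 le_top)
  · rw [← differentialAt_eq_fderiv hf.1]
    exact hE.le_tangent p
  · intro ξ hξ
    rw [← hp] at hξ
    obtain ⟨γ, h1, h2, h3⟩ := hR.exists_curve hx hξ
    exact (hasDerivAt_of_comp_eq_line hF (hf.injective_fderiv_chartRep hx) h1 h2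
      (h3.mono fun s hs => hs.1)).2
  · intro e he ν hν
    have h := hA p e
    simp only [secondFundamentalForm, tangentPlane, differentialAt_eq_fderiv hf.1] at h
    exact h he ν hν

/-- Austerity is stated in the preferred chart at each point. In another chart the second derivative
changes only by a tangential term, so minimality holds throughout one fixed chart. -/
theorem IsAustere.ruledMinimal (hA : IsAustere m f) (hf : IsSmoothImmersion m f)
    (hE : IsSmoothPlaneField m k f E) (hR : IsRuledAlong f E) (hk : k + 1 = m) (p : M) :
    RuledMinimal (extChartAt (𝓡 m) p).target (chartRep m f p) (chartRep m E p) where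
  isOpen := isOpen_extChartAt_target p
  smooth := fun x hx => (contDiffAt_chartRep hx hf.1.contMDiffAt).contDiffWithinAt
  injective := fun x hx => hf.injective_fderiv_chartRep hx
  le_range := fun x hx => by
    rw [← tangentPlane_eq_range hf.1 hx]
    exact hE.le_tangent _
  finrank_eq := fun x hx => by
    rw [finrank_euclideanSpace_fin]
    exact (congrArg (· + 1) (hE.finrank_eq ((extChartAt (𝓡 m) p).symm x))).trans hk
  smooth_proj := fun x hx => (hE.contDiffAt_planeProj hx).contDiffWithinAt
  fderiv_proj := fun x hx ξ hξ => by
    obtain ⟨γ, h1, h2, h3⟩ := hR.exists_curve hx hξ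
    have h4 := (hasDerivAt_of_comp_eq_line (contDiffAt_chartRep hx hf.1.contMDiffAt)
      (hf.injective_fderiv_chartRep hx) h1 h2 (h3.mono fun s hs => hs.1)).1
    have h5 : HasFDerivAt (planeProj (chartRep m E p))
        (fderiv ℝ (planeProj (chartRep m E p)) x) (γ 0) := by
      rw [h2]
      exact ((hE.contDiffAt_planeProj hx).differentiableAt (by simp)).hasFDerivAt
    refine (h5.comp_hasDerivAt 0 h4).unique
      ((hasDerivAt_const (0 : ℝ) (planeProj (chartRep m E p) x)).congr_of_eventuallyEq ?_)
    filter_upwards [h3] with s hs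
    simp only [Function.comp_apply, planeProj, hs.2]
  ruled := fun x hx e he => hR.exists_curve hx he
  minimal := fun x hx ξ hξ => by
    have hq := mem_extChartAt_source (I := 𝓡 m) ((extChartAt (𝓡 m) p).symm x)
    have hF : ContDiffAt ℝ ∞ (chartRep m f ((extChartAt (𝓡 m) p).symm x))
        (chartChange m p ((extChartAt (𝓡 m) p).symm x) x) :=
      contDiffAt_chartRep (chartChange_mem_target hq) hf.1.contMDiffAt
    rw [← tangentPlane_eq_range hf.1 hx, tangentPlane, differentialAt_eq_fderiv hf.1,
      (chartRep_eventuallyEq_comp f hx hq).fderiv.fderiv_eq,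
      fderiv_fderiv_comp (contDiffAt_infty.1 hF 2)
        (contDiffAt_infty.1 (contDiffAt_chartChange hx hq) 2)]
    refine Submodule.add_mem _ (hA.fderiv_fderiv_mem_range hf hE hR hk ?_) ⟨_, rfl⟩
    rw [fderiv_chartRep hf.1 hx hq] at hξ
    exact hξ

end Austere

/-! ### From a moving frame to the helicoid parametrization -/

section LocalDiffeomorph

variable {M : Type*} [TopologicalSpace M] {m n k : ℕ} [ChartedSpace (EucSp m) M]

/-- On a ball in each chart the map is constant, hence locally constant on `M`, and `M` is
connected. -/
theorem eq_of_hasFDerivAt_chartRep_zero [ConnectedSpace M] {Z : Type*} [NormedAddCommGroup Z]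
    [NormedSpace ℝ Z] {g : M → Z}
    (hg : ∀ p : M, ∀ x ∈ (extChartAt (𝓡 m) p).target,
      HasFDerivAt (chartRep m g p) (0 : EucSp m →L[ℝ] Z) x) (p q : M) : g p = g q := by
  refine IsLocallyConstant.apply_eq_of_preconnectedSpace ?_ p q
  rw [IsLocallyConstant.iff_eventually_eq]
  intro p
  obtain ⟨ε, hε, hB⟩ := Metric.isOpen_iff.1 (isOpen_extChartAt_target (I := 𝓡 m) p) _
    (mem_extChartAt_target (I := 𝓡 m) p)
  filter_upwards [(continuousAt_extChartAt (I := 𝓡 m) p).eventually (Metric.ball_mem_nhds _ hε),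
    extChartAt_source_mem_nhds (I := 𝓡 m) p] with q hq hq'
  have h1 := Metric.isOpen_ball.is_const_of_fderiv_eq_zero
    (𝕜 := ℝ) (convex_ball (extChartAt (𝓡 m) p p) ε).isPreconnected
    (fun y hy => (hg p y (hB hy)).differentiableAt.differentiableWithinAt)
    (fun y hy => (hg p y (hB hy)).fderiv) hq (Metric.mem_ball_self hε)
  simpa only [chartRep, Function.comp_apply, (extChartAt (𝓡 m) p).left_inv hq',
    extChartAt_to_inv] using h1

variable [IsManifold (𝓡 m) ∞ M]

theorem isLocalDiffeomorphAt_comp_extChartAt {X : Type*} [NormedAddCommGroup X] [NormedSpace ℝ X]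
    [CompleteSpace X] {V : Set (EucSp m)} (hV : IsOpen V) {g : EucSp m → X}
    (hg : ContDiffOn ℝ ∞ g V) {p : M} (hp : extChartAt (𝓡 m) p p ∈ V) (A : EucSp m ≃L[ℝ] X)
    (hA : fderiv ℝ g (extChartAt (𝓡 m) p p) = A) :
    IsLocalDiffeomorphAt (𝓡 m) 𝓘(ℝ, X) ∞ (g ∘ extChartAt (𝓡 m) p) p := by
  obtain ⟨Φ, hΦp, hΦV, hΦ, hΦs, -⟩ := exists_openPartialHomeomorph_contDiffAt_symm hV hg hp A hA
  refine ⟨{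
    toPartialEquiv := (extChartAt (𝓡 m) p).trans Φ.toPartialEquiv
    open_source := (continuousOn_extChartAt p).isOpen_inter_preimage
      (isOpen_extChartAt_source p) Φ.open_source
    open_target := by
      rw [PartialEquiv.trans_target]
      exact Φ.symm.isOpen_inter_preimage (isOpen_extChartAt_target p)
    contMDiffOn_toFun := ?_
    contMDiffOn_invFun := ?_ }, ⟨mem_extChartAt_source p, hΦp⟩, fun q _ => (hΦ _).symm⟩
  · have h1 : ContMDiffOn (𝓡 m) 𝓘(ℝ, X) ∞ (g ∘ extChartAt (𝓡 m) p)
        ((extChartAt (𝓡 m) p).source ∩ extChartAt (𝓡 m) p ⁻¹' V) := by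
      refine hg.contMDiffOn.comp (t := V) ?_ fun q hq => hq.2
      have := contMDiffOn_extChartAt (I := 𝓡 m) (n := ∞) (x := p)
      rw [← extChartAt_source (𝓡 m)] at this
      exact this.mono Set.inter_subset_left
    refine (h1.mono fun q hq => ⟨hq.1, hΦV hq.2⟩).congr fun q _ => hΦ _
  · refine (contMDiffOn_extChartAt_symm p).comp (t := (extChartAt (𝓡 m) p).target) ?_
      fun y hy => hy.2
    have h2 : ContDiffOn ℝ ∞ Φ.symm Φ.target := fun y hy => (hΦs y hy).contDiffWithinAt
    exact h2.contMDiffOn.mono Set.inter_subset_left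

/-- The change of parameters is given by the coordinates `τ` and `u`. It is a local diffeomorphism
because `f` is an immersion that factors through these coordinates, so no regularity of the helicoid
parametrization is needed. -/
theorem isGeneralizedHelicoid_of_frame {f : M → EucSp n} (hf : IsSmoothImmersion m f)
    (hk : k + 1 = m) {e d : Fin k → EucSp n} {l : Fin k → ℝ} {o v : EucSp n}
    (he : Orthonormal ℝ e) (hve : ∀ i, ⟪v, e i⟫_ℝ = 0)
    (hdv : ∀ i, l i ≠ 0 → ⟪d i, v⟫_ℝ = 0) (hde : ∀ i j, l i ≠ 0 → ⟪d i, e j⟫_ℝ = 0)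
    (hdd : ∀ i j, l i ≠ 0 → l j ≠ 0 → ⟪d i, d j⟫_ℝ = if i = j then 1 else 0)
    (h : ∀ p : M, ∃ (V : Set (EucSp m)) (τ : EucSp m → ℝ) (u : Fin k → EucSp m → ℝ), IsOpen V ∧
      extChartAt (𝓡 m) p p ∈ V ∧ ContDiffOn ℝ ∞ τ V ∧ (∀ i, ContDiffOn ℝ ∞ (u i) V) ∧
      ∀ y ∈ V, chartRep m f p y = o + τ y • v + ∑ i, u i y • helicoidFrame e d l (τ y) i) :
    IsGeneralizedHelicoid m f := by
  obtain ⟨s, r, φ, l₀, l', N, A, B, hsr, hl', hAB⟩ := exists_congruent_helicoidParam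
    (o := o) he hve hdv hde hdd
  refine ⟨s, r, by omega, l₀, l', hl', N, A, B, fun p => ?_⟩
  obtain ⟨V, τ, u, hV, hpV, hτ, hu, hF⟩ := h p
  set x := extChartAt (𝓡 m) p p with hx
  let g : EucSp m → ℝ × EucSp s × EucSp r := fun y => (τ y,
    WithLp.toLp 2 (fun i => u (φ (.inl i)) y), WithLp.toLp 2 (fun j => u (φ (.inr j)) y))
  have hg : ContDiffOn ℝ ∞ g V :=
    hτ.prodMk ((contDiffOn_euclidean.2 fun i => hu (φ (.inl i))).prodMk
      (contDiffOn_euclidean.2 fun j => hu (φ (.inr j))))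
  have dg : HasFDerivAt g (fderiv ℝ g x) x :=
    ((hg.contDiffAt (hV.mem_nhds hpV)).differentiableAt (by simp)).hasFDerivAt
  have hinj : Function.Injective (fderiv ℝ g x) := by
    rw [injective_iff_map_eq_zero]
    intro ξ hξ
    have hx0 : x + (0 : ℝ) • ξ = x := by simp
    have dgl : HasDerivAt (fun t : ℝ => g (x + t • ξ)) 0 0 := hξ ▸ dg.hasLineDerivAt ξ
    have dτ : HasDerivAt (fun t : ℝ => τ (x + t • ξ)) 0 0 :=
      HasFDerivAt.comp_hasDerivAt (l := Prod.fst) (0 : ℝ)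
        (ContinuousLinearMap.fst ℝ ℝ (EucSp s × EucSp r)).hasFDerivAt dgl
    have du₁ : ∀ i, HasDerivAt (fun t : ℝ => u (φ (.inl i)) (x + t • ξ)) 0 0 := fun i =>
      HasFDerivAt.comp_hasDerivAt (l := fun z : ℝ × EucSp s × EucSp r => z.2.1 i) (0 : ℝ)
        ((EuclideanSpace.proj i : EucSp s →L[ℝ] ℝ) ∘L ContinuousLinearMap.fst ℝ (EucSp s) (EucSp r)
          ∘L ContinuousLinearMap.snd ℝ ℝ (EucSp s × EucSp r)).hasFDerivAt dgl
    have du₂ : ∀ i, HasDerivAt (fun t : ℝ => u (φ (.inr i)) (x + t • ξ)) 0 0 := fun i =>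
      HasFDerivAt.comp_hasDerivAt (l := fun z : ℝ × EucSp s × EucSp r => z.2.2 i) (0 : ℝ)
        ((EuclideanSpace.proj i : EucSp r →L[ℝ] ℝ) ∘L ContinuousLinearMap.snd ℝ (EucSp s) (EucSp r)
          ∘L ContinuousLinearMap.snd ℝ ℝ (EucSp s × EucSp r)).hasFDerivAt dgl
    have du : ∀ i, HasDerivAt (fun t : ℝ => u i (x + t • ξ)) 0 0 := by
      intro i
      obtain ⟨j, rfl⟩ := φ.surjective i
      rcases j with j | j
      exacts [du₁ j, du₂ j]
    have de : ∀ i, HasDerivAt (fun t : ℝ => helicoidFrame e d l (τ (x + t • ξ)) i) 0 0 := by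
      intro i
      have h1 : DifferentiableAt ℝ (fun t => helicoidFrame e d l t i) (τ (x + (0 : ℝ) • ξ)) := by
        unfold helicoidFrame
        fun_prop
      have h2 := HasDerivAt.scomp (0 : ℝ) h1.hasDerivAt dτ
      rw [zero_smul] at h2
      exact h2
    have dF : HasDerivAt (fun t : ℝ => chartRep m f p (x + t • ξ)) 0 0 := by
      have h1 := ((dτ.smul_const v).const_add o).add
        (HasDerivAt.fun_sum fun i (_ : i ∈ Finset.univ) => (du i).smul (de i))
      have hn : ∀ᶠ t : ℝ in 𝓝 0, x + t • ξ ∈ V := by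
        have hc : ContinuousAt (fun t : ℝ => x + t • ξ) 0 := by fun_prop
        exact hc.eventually (by simpa using hV.mem_nhds hpV)
      refine HasDerivAt.congr_of_eventuallyEq (by simpa using h1) ?_
      filter_upwards [hn] with t ht
      exact hF _ ht
    have hxt : x ∈ (extChartAt (𝓡 m) p).target := mem_extChartAt_target p
    have dF' : HasDerivAt (fun t : ℝ => chartRep m f p (x + t • ξ))
        (fderiv ℝ (chartRep m f p) x ξ) 0 :=
      ((contDiffAt_chartRep hxt hf.1.contMDiffAt).differentiableAt
        (by simp)).hasFDerivAt.hasLineDerivAt ξ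
    exact hf.injective_fderiv_chartRep hxt ((dF'.unique dF).trans (map_zero _).symm)
  let L := LinearMap.linearEquivOfInjective (fderiv ℝ g x : EucSp m →ₗ[ℝ] ℝ × EucSp s × EucSp r) hinj
    (by simp; omega)
  refine ⟨g ∘ extChartAt (𝓡 m) p, isLocalDiffeomorphAt_comp_extChartAt hV hg hpV
    L.toContinuousLinearEquiv (by ext ξ : 1; rfl), ?_⟩
  filter_upwards [(continuousAt_extChartAt p).eventually (hV.mem_nhds hpV),
    extChartAt_source_mem_nhds (I := 𝓡 m) p] with q hq hq'
  have h1 := hF _ hq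
  rw [chartRep, Function.comp_apply, (extChartAt (𝓡 m) p).left_inv hq'] at h1
  rw [h1, hAB]
  rfl

end LocalDiffeomorph

/-! ### The degenerate case: parallel tangent spaces -/

section Planar

variable {W Y : Type*} [NormedAddCommGroup W] [InnerProductSpace ℝ W] [FiniteDimensional ℝ W]
  [NormedAddCommGroup Y] [InnerProductSpace ℝ Y] [FiniteDimensional ℝ Y]
  {V : Set W} {F : W → Y} {E : W → Submodule ℝ Y}

/-- If the ruling planes turn only within the tangent spaces, the tangent spaces are parallel. -/
theorem RuledMinimal.hasFDerivAt_tangentProj (h : RuledMinimal V F E)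
    (hT : ∀ x ∈ V, ∀ ξ, ∀ e ∈ E x, fderiv ℝ (planeProj E) x ξ e ∈ (fderiv ℝ F x).range)
    {x : W} (hx : x ∈ V) :
    HasFDerivAt (planeProj fun y => (fderiv ℝ F y).range) (0 : W →L[ℝ] Y →L[ℝ] Y) x := by
  set T : W → Submodule ℝ Y := fun y => (fderiv ℝ F y).range with hTdef
  have hFs : ContDiffAt ℝ ∞ (fderiv ℝ F) x :=
    (h.smooth.fderiv_of_isOpen h.isOpen (m := ∞) (by simp)).contDiffAt (h.isOpen.mem_nhds hx)
  have hVx : ∀ᶠ y in 𝓝 x, y ∈ V := h.isOpen.mem_nhds hx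
  have hT₁ : HasFDerivAt (planeProj T) (fderiv ℝ (planeProj T) x) x :=
    ((contDiffAt_starProjection_range hFs (hVx.mono h.injective)).differentiableAt
      (by simp)).hasFDerivAt
  have hF2 : HasFDerivAt (fderiv ℝ F) (fderiv ℝ (fderiv ℝ F) x) x :=
    (hFs.differentiableAt (by simp)).hasFDerivAt
  set T' := fderiv ℝ (planeProj T) x with hT'
  set H := fderiv ℝ (fderiv ℝ F) x with hH
  set b : W → W → Y := fun ξ η => H ξ η - planeProj T x (H ξ η) with hb
  have hb1 : ∀ ξ η, T' ξ (fderiv ℝ F x η) = b ξ η := by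
    intro ξ η
    have h1 := HasDerivAt.clm_apply (hT₁.hasLineDerivAt ξ)
      (HasDerivAt.clm_apply (hF2.hasLineDerivAt ξ) (hasDerivAt_const (0 : ℝ) η))
    have h2 := HasDerivAt.clm_apply (hF2.hasLineDerivAt ξ) (hasDerivAt_const (0 : ℝ) η)
    have h3 := h1.unique (h2.congr_of_eventuallyEq (.of_forall fun t =>
      Submodule.starProjection_eq_self_iff.2 (LinearMap.mem_range_self _ η)))
    simp only [zero_smul, add_zero, map_zero] at h3
    rw [hb]
    linear_combination (norm := module) h3
  have hsymm : ∀ ξ η, b ξ η = b η ξ := by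
    intro ξ η
    have := ((h.smooth.contDiffAt (h.isOpen.mem_nhds hx)).isSymmSndFDerivAt (by
      rw [minSmoothness_of_isRCLikeNormedField]
      exact WithTop.coe_le_coe.2 le_top)) ξ η
    simp only [hb, hH, this]
  -- The vector `e` extends to the tangent field `planeProj E y e`. Differentiating the fact that it
  -- is fixed by the tangent projection, and using that its own derivative is tangent by `hT`,
  -- leaves the derivative of the tangent projection on `e` equal to zero.
  have hbE : ∀ ξ η, fderiv ℝ F x η ∈ E x → b ξ η = 0 := by
    intro ξ η hη
    rw [← hb1]
    set e := fderiv ℝ F x η with he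
    have hpe : planeProj E x e = e := Submodule.starProjection_eq_self_iff.2 hη
    have hp := HasDerivAt.clm_apply ((h.hasFDerivAt_proj hx).hasLineDerivAt ξ)
      (hasDerivAt_const (0 : ℝ) e)
    have h1 := HasDerivAt.clm_apply (hT₁.hasLineDerivAt ξ) hp
    have hn : ∀ᶠ t : ℝ in 𝓝 0, x + t • ξ ∈ V := by
      have hc : ContinuousAt (fun t : ℝ => x + t • ξ) 0 := by fun_prop
      exact hc.eventually (by simpa using hVx)
    have h3 := h1.unique (hp.congr_of_eventuallyEq (hn.mono fun t ht =>
      Submodule.starProjection_eq_self_iff.2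
        (h.le_range _ ht (Submodule.starProjection_apply_mem _ _))))
    have h4 : planeProj T x (fderiv ℝ (planeProj E) x ξ e) = fderiv ℝ (planeProj E) x ξ e :=
      Submodule.starProjection_eq_self_iff.2 (hT x hx ξ e hη)
    simpa [hpe, h4] using h3
  have hadd : ∀ ξ ξ' η, b (ξ + ξ') η = b ξ η + b ξ' η := by
    intro ξ ξ' η
    simp only [hb, map_add, add_apply]
    abel
  have hbd : ∀ ξ, b ξ ξ = 0 := by
    intro ξ
    -- Splitting `ξ` into its ruling part `ζ` and a part normal to the ruling reduces the claim to
    -- `hbE` and minimality; polarization then kills `b`.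
    obtain ⟨ζ, hζ⟩ : ∃ ζ, fderiv ℝ F x ζ = planeProj E x (fderiv ℝ F x ξ) :=
      h.le_range x hx (Submodule.starProjection_apply_mem (E x) _)
    have hζE : fderiv ℝ F x ζ ∈ E x := by
      rw [hζ]; exact Submodule.starProjection_apply_mem (E x) _
    have h1 := h.minimal x hx (ξ - ζ) (by
      rw [map_sub, hζ]; exact Submodule.sub_starProjection_mem_orthogonal _)
    have h2 : b (ξ - ζ) (ξ - ζ) = 0 := by
      simp only [hb]
      rw [sub_eq_zero]
      exact (Submodule.starProjection_eq_self_iff.2 h1).symm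
    have h3 : ξ = (ξ - ζ) + ζ := by abel
    rw [h3, hadd, hsymm _ (ξ - ζ + ζ), hsymm ζ, hadd, h2, hsymm ζ, hbE _ _ hζE, hadd, hbE _ _ hζE,
      hsymm, hbE _ _ hζE]
    simp
  have hb0 : ∀ ξ η, b ξ η = 0 := by
    intro ξ η
    have h1 := hbd (ξ + η)
    rw [hadd, hsymm ξ, hsymm η, hadd, hadd, hbd, hbd, hsymm η, zero_add, add_zero, ← two_smul ℝ,
      smul_eq_zero] at h1
    exact h1.resolve_left two_ne_zero
  convert! hT₁ using 1
  ext ξ : 1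
  have hl := hT₁.hasLineDerivAt ξ
  have h1 : T' ξ * planeProj T x = 0 := by
    ext y
    obtain ⟨η, hη⟩ : ∃ η, fderiv ℝ F x η = planeProj T x y :=
      Submodule.starProjection_apply_mem (T x) y
    rw [mul_apply_eq_comp, ← hη, hb1, hb0, zero_apply]
  have h2 : (T' ξ : Y →ₗ[ℝ] Y).IsSymmetric :=
    HasDerivAt.isSymmetric hl (.of_forall fun _ => planeProj_isSymmetric T _)
  have h3 : planeProj T x * T' ξ = 0 := by
    ext y
    refine ext_inner_right ℝ fun z => ?_
    have a1 := planeProj_isSymmetric T x (T' ξ y) z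
    have a2 := h2 y (planeProj T x z)
    have a3 : T' ξ (planeProj T x z) = 0 := DFunLike.congr_fun h1 z
    simp only [ContinuousLinearMap.coe_coe] at a1 a2
    rw [mul_apply_eq_comp, a1, a2, a3]
    simp
  -- The derivative of a projection is the sum of its two products with the projection, and both
  -- vanish here.
  have h4 := HasDerivAt.mul_eq_of_idempotent (s := 0) hl fun _ => planeProj_mul_self T _
  simp only [zero_smul, add_zero, h1, h3] at h4
  exact h4

end Planar

/-! ### Globalization over the connected manifold and conclusion -/

section Helicoid

variable {M : Type*} [TopologicalSpace M] {m n k : ℕ} [ChartedSpace (EucSp m) M]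
  [IsManifold (𝓡 m) ∞ M] {f : M → EucSp n} {E : M → Submodule ℝ (EucSp n)}

/-- With a constant tangent projection `P`, `f - P f` is constant too, so `f` lies in an affine
plane. This is the helicoid without rotating directions; one basis vector of the plane serves as the
axis. -/
theorem IsSmoothImmersion.isGeneralizedHelicoid_of_parallel [ConnectedSpace M]
    (hf : IsSmoothImmersion m f) (hk : k + 1 = m)
    (hT : ∀ p : M, ∀ x ∈ (extChartAt (𝓡 m) p).target,
      HasFDerivAt (planeProj fun y => (fderiv ℝ (chartRep m f p) y).range)
        (0 : EucSp m →L[ℝ] EucSp n →L[ℝ] EucSp n) x) :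
    IsGeneralizedHelicoid m f := by
  obtain ⟨p₀⟩ := (inferInstance : Nonempty M)
  have hproj : ∀ p : M, ∀ x ∈ (extChartAt (𝓡 m) p).target,
      chartRep m (planeProj (tangentPlane m f)) p x =
        planeProj (fun y => (fderiv ℝ (chartRep m f p) y).range) x := by
    intro p x hx
    simp only [chartRep, Function.comp_apply, planeProj, tangentPlane_eq_range hf.1 hx]
  have h1 : ∀ q, planeProj (tangentPlane m f) q = planeProj (tangentPlane m f) p₀ := fun q =>
    eq_of_hasFDerivAt_chartRep_zero (m := m) (fun p x hx => (hT p x hx).congr_of_eventuallyEq (by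
      filter_upwards [(isOpen_extChartAt_target p).mem_nhds hx] with y hy
      exact hproj p y hy)) q p₀
  set P := planeProj (tangentPlane m f) p₀ with hP
  have h2 : ∀ q, f q - P (f q) = f p₀ - P (f p₀) := fun q =>
    eq_of_hasFDerivAt_chartRep_zero (m := m) (g := fun q => f q - P (f q)) (fun p x hx => by
      have hF : HasFDerivAt (chartRep m f p) (fderiv ℝ (chartRep m f p) x) x :=
        ((contDiffAt_chartRep hx hf.1.contMDiffAt).differentiableAt (by simp)).hasFDerivAt
      convert! hF.sub (P.hasFDerivAt.comp x hF) using 1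
      ext ξ : 1
      have h3 : P (fderiv ℝ (chartRep m f p) x ξ) = fderiv ℝ (chartRep m f p) x ξ := by
        rw [← h1 ((extChartAt (𝓡 m) p).symm x)]
        refine Submodule.starProjection_eq_self_iff.2 ?_
        rw [tangentPlane_eq_range hf.1 hx]
        exact ⟨ξ, rfl⟩
      simp [h3]) q p₀
  have hdim : Module.finrank ℝ (tangentPlane m f p₀) = k + 1 := by
    rw [tangentPlane, LinearMap.finrank_range_of_inj (hf.2 p₀), finrank_euclideanSpace_fin, hk]
  let b := (stdOrthonormalBasis ℝ (tangentPlane m f p₀)).reindex (finCongr hdim)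
  have hb : Orthonormal ℝ fun i => (b i : EucSp n) :=
    b.orthonormal.comp_linearIsometry (tangentPlane m f p₀).subtypeₗᵢ
  have hPb : ∀ y, P y = ∑ i, ⟪(b i : EucSp n), y⟫_ℝ • (b i : EucSp n) := fun y => by
    rw [← frameProj_apply, frameProj_orthonormalBasis]
    rfl
  refine isGeneralizedHelicoid_of_frame hf hk (e := fun i => (b i.succ : EucSp n)) (d := 0)
    (l := 0) (o := f p₀ - P (f p₀)) (v := b 0) (hb.comp _ (Fin.succ_injective k))
    (fun i => hb.2 (Fin.succ_ne_zero i).symm) (fun i hi => absurd rfl hi)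
    (fun i j hi => absurd rfl hi) (fun i j hi => absurd rfl hi) fun p => ?_
  have hF : ContDiffOn ℝ ∞ (chartRep m f p) (extChartAt (𝓡 m) p).target :=
    fun x hx => (contDiffAt_chartRep hx hf.1.contMDiffAt).contDiffWithinAt
  refine ⟨(extChartAt (𝓡 m) p).target, fun y => ⟪(b 0 : EucSp n), chartRep m f p y⟫_ℝ,
    fun i y => ⟪(b i.succ : EucSp n), chartRep m f p y⟫_ℝ, isOpen_extChartAt_target p,
    mem_extChartAt_target p, contDiffOn_const.inner ℝ hF, fun i => contDiffOn_const.inner ℝ hF,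
    fun y hy => ?_⟩
  have h3 := h2 ((extChartAt (𝓡 m) p).symm y)
  rw [sub_eq_iff_eq_add, hPb (f ((extChartAt (𝓡 m) p).symm y)), Fin.sum_univ_succ, ← add_assoc] at h3
  simpa [helicoidFrame] using! h3

theorem fderiv_chartRep_apply {Z : Type*} [NormedAddCommGroup Z] [NormedSpace ℝ Z] {g : M → Z}
    {p q : M} {x : EucSp m} (hx : x ∈ (extChartAt (𝓡 m) p).target)
    (hq : (extChartAt (𝓡 m) p).symm x ∈ (extChartAt (𝓡 m) q).source)
    (hg : DifferentiableAt ℝ (chartRep m g q) (chartChange m p q x)) (ξ : EucSp m) :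
    fderiv ℝ (chartRep m g p) x ξ =
      fderiv ℝ (chartRep m g q) (chartChange m p q x) (fderiv ℝ (chartChange m p q) x ξ) := by
  rw [(chartRep_eventuallyEq_comp g hx hq).fderiv_eq,
    fderiv_comp x hg ((contDiffAt_chartChange hx hq).differentiableAt (by simp))]
  rfl

theorem movesAlong_chartRep_of_chartChange
    (hR : ∀ p : M, RuledMinimal (extChartAt (𝓡 m) p).target (chartRep m f p) (chartRep m E p))
    {K : EucSp n →L[ℝ] EucSp n} {a : EucSp n} {Q : ℝ → EucSp n →L[ℝ] EucSp n} {q : ℝ → EucSp n}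
    {p p' : M} {x : EucSp m} (hx : x ∈ (extChartAt (𝓡 m) p).target)
    (hp' : (extChartAt (𝓡 m) p).symm x ∈ (extChartAt (𝓡 m) p').source)
    (h : MovesAlong (chartRep m f p) (chartRep m E p) K a Q q x) :
    MovesAlong (chartRep m f p') (chartRep m E p') K a Q q (chartChange m p p' x) := by
  obtain ⟨r, ξ, h1, h2, h3, h4⟩ := h
  have hy := chartChange_mem_target hp'
  have e1 : chartRep m f p' (chartChange m p p' x) = chartRep m f p x :=
    (chartRep_eventuallyEq_comp f hx hp').self_of_nhds.symm
  have e2 : chartRep m E p' (chartChange m p p' x) = chartRep m E p x :=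
    (chartRep_eventuallyEq_comp E hx hp').self_of_nhds.symm
  have e3 : planeProj (chartRep m E p') (chartChange m p p' x) = planeProj (chartRep m E p) x := by
    simp only [planeProj, e2]
  refine ⟨r, fderiv ℝ (chartChange m p p') x ξ, e3.trans h1, ?_, ?_, ?_⟩
  · rw [planeFoot, e3, e1]
    exact h2
  · rw [← h3]
    exact (fderiv_chartRep_apply (g := planeProj E) hx hp'
      ((hR p').hasFDerivAt_proj hy).differentiableAt ξ).symm
  · rw [← h4]
    exact (fderiv_chartRep_apply (g := planeFoot f E) hx hp'
      ((hR p').hasFDerivAt_foot hy).differentiableAt ξ).symm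

theorem movesAlong_chartRep_iff
    (hR : ∀ p : M, RuledMinimal (extChartAt (𝓡 m) p).target (chartRep m f p) (chartRep m E p))
    {K : EucSp n →L[ℝ] EucSp n} {a : EucSp n} {Q : ℝ → EucSp n →L[ℝ] EucSp n} {q : ℝ → EucSp n}
    {p p' : M} {x : EucSp m} (hx : x ∈ (extChartAt (𝓡 m) p).target)
    (hp' : (extChartAt (𝓡 m) p).symm x ∈ (extChartAt (𝓡 m) p').source) :
    MovesAlong (chartRep m f p) (chartRep m E p) K a Q q x ↔
      MovesAlong (chartRep m f p') (chartRep m E p') K a Q q (chartChange m p p' x) := by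
  refine ⟨movesAlong_chartRep_of_chartChange hR hx hp', fun h => ?_⟩
  have := movesAlong_chartRep_of_chartChange hR (p' := p) (chartChange_mem_target hp') (by
    rw [chart_symm_chartChange hp']
    exact (extChartAt (𝓡 m) p).map_target hx) h
  rwa [chartChange_chartChange hx hp'] at this

/-- The motion of the ruling planes continues along a connected manifold. -/
theorem movesAlong_chartRep_of_connected [ConnectedSpace M]
    (hR : ∀ p : M, RuledMinimal (extChartAt (𝓡 m) p).target (chartRep m f p) (chartRep m E p))
    {K : EucSp n →L[ℝ] EucSp n} {a : EucSp n} {Q : ℝ → EucSp n →L[ℝ] EucSp n} {q : ℝ → EucSp n}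
    (hS : IsScrewMotion K a Q q) {p₀ : M} {x₀ : EucSp m} (hx₀ : x₀ ∈ (extChartAt (𝓡 m) p₀).target)
    (h₀ : MovesAlong (chartRep m f p₀) (chartRep m E p₀) K a Q q x₀) (p : M) :
    MovesAlong (chartRep m f p) (chartRep m E p) K a Q q (extChartAt (𝓡 m) p p) := by
  let S : M → Prop := fun p =>
    MovesAlong (chartRep m f p) (chartRep m E p) K a Q q (extChartAt (𝓡 m) p p)
  have hSx : ∀ p, ∀ x ∈ (extChartAt (𝓡 m) p).target,
      MovesAlong (chartRep m f p) (chartRep m E p) K a Q q x ↔ S ((extChartAt (𝓡 m) p).symm x) :=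
    fun p x hx => movesAlong_chartRep_iff hR hx (mem_extChartAt_source _)
  -- On a ruling patch the motion along the orbit holds at all points or at none.
  have hloc : IsLocallyConstant S := by
    rw [IsLocallyConstant.iff_eventually_eq]
    intro p
    obtain ⟨U, b, b', t, c, hxU, hU, hP⟩ := (hR p).exists_isRulingPatch
      (mem_extChartAt_target (I := 𝓡 m) p)
    have hall : ∀ x ∈ U, ∀ y ∈ U, MovesAlong (chartRep m f p) (chartRep m E p) K a Q q x →
        MovesAlong (chartRep m f p) (chartRep m E p) K a Q q y := by
      intro x hx y hy hM
      obtain ⟨r, -, h1⟩ := hP.exists_forall_movesAlong (hR p) hU hS hx hM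
      exact (h1 y hy).2.2
    filter_upwards [(continuousAt_extChartAt (I := 𝓡 m) p).eventually (hP.isOpen.mem_nhds hxU),
      extChartAt_source_mem_nhds (I := 𝓡 m) p] with z hz hz'
    have h1 := hSx p _ ((extChartAt (𝓡 m) p).map_source hz')
    rw [(extChartAt (𝓡 m) p).left_inv hz'] at h1
    exact propext ⟨fun h => hall _ hz _ hxU (h1.2 h), fun h => h1.1 (hall _ hxU _ hz h)⟩
  have h1 := hloc.apply_eq_of_preconnectedSpace ((extChartAt (𝓡 m) p₀).symm x₀) p
  exact h1.mp ((hSx p₀ x₀ hx₀).1 h₀)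

/-- At a point where the ruling planes turn out of the tangent space, they move along the orbit of
a helicoid frame. -/
theorem RuledMinimal.exists_isHelicoidFrame {W Y : Type*} [NormedAddCommGroup W] [NormedSpace ℝ W]
    [FiniteDimensional ℝ W]
    [NormedAddCommGroup Y] [InnerProductSpace ℝ Y] [FiniteDimensional ℝ Y]
    {V : Set W} {F : W → Y} {E : W → Submodule ℝ Y} (h : RuledMinimal V F E) {x : W} (hx : x ∈ V)
    {ξ : W} {e₀ : Y} (he₀ : e₀ ∈ E x)
    (hne : fderiv ℝ (planeProj E) x ξ e₀ ∉ (fderiv ℝ F x).range) (hk : Module.finrank ℝ (E x) = k) :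
    ∃ (K : Y →L[ℝ] Y) (a : Y) (e d : Fin k → Y) (l : Fin k → ℝ) (o v : Y),
      IsHelicoidFrame K a e d l o v ∧
      MovesAlong F E K a (fun r => frameProj (helicoidFrame e d l r))
        (fun r => o + r • v - frameProj (helicoidFrame e d l r) o) x := by
  obtain ⟨U, b, b', t, c, hxU, hU, hP⟩ := h.exists_isRulingPatch hx
  have hs := hP.t_mem x hxU
  have hpx : planeProj E (c (t x)) = planeProj E x := (hP.proj_eq x hxU).symm
  have hax : planeFoot F E (c (t x)) = planeFoot F E x := (hP.foot_eq x hxU).symm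
  have hPP : planeProj E x * planeProj E x = planeProj E x := planeProj_mul_self E x
  have hP₁ := IsRulingPatch.projVelocity_mul h hU hP hs
  have hPa := IsRulingPatch.projVelocity_foot h hU hP hs
  have hP₁s := IsRulingPatch.projVelocity_isSymmetric h hU hP hs
  obtain ⟨ζ, hζt, hζ⟩ := IsRulingPatch.exists_fderiv_eq_normalVelocity h hU hP hxU
  have dζ := IsRulingPatch.fderiv_proj h hU hP hxU ζ
  have dζ' := IsRulingPatch.fderiv_foot h hU hP hxU ζ
  rw [IsRulingPatch.fderiv_proj h hU hP hxU] at hne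
  rw [hζt, one_smul] at dζ dζ'
  rw [normalVelocity] at hζ
  rw [hpx] at hP₁ hPa
  rw [hax] at hPa
  have hPas : planeProj E x (planeFoot F E x) = 0 := planeProj_planeFoot F E x
  have hPs := planeProj_isSymmetric E x
  set P := planeProj E x with hPdef
  set P₁ := projVelocity E c (t x) with hP₁def
  set A := footVelocity F E c (t x) with hAdef
  set y₀ := planeFoot F E x with hy₀
  set K : Y →L[ℝ] Y := P₁ * P - P * P₁ with hKdef
  have e1 (z : Y) : P₁ (P z) + P (P₁ z) = P₁ z := DFunLike.congr_fun hP₁ z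
  have hw : K (F x) + (A + 2 • P₁ y₀) = P₁ (F x) + A := killing_apply_eq hPP hP₁ rfl
  have hw' : K y₀ + (A + 2 • P₁ y₀) = P₁ y₀ + A :=
    killing_apply_eq hPP hP₁ (by rw [hPas, sub_zero])
  have hPe : P e₀ = e₀ := Submodule.starProjection_eq_self_iff.2 he₀
  have hKe : K e₀ = P₁ e₀ := by
    have h1 := e1 e₀
    rw [hPe, add_eq_left] at h1
    simp [hKdef, hPe, h1]
  obtain ⟨e, d, l, o, v, hfr, hfe, ho⟩ := _root_.exists_isHelicoidFrame (E := E x) (K := K)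
    (k := A + 2 • P₁ y₀) (a := y₀) (y := F x) (e₀ := e₀) (m := k) (by
      intro z z'
      have a1 : ∀ u u', ⟪P u, u'⟫_ℝ = ⟪u, P u'⟫_ℝ := hPs
      have a2 : ∀ u u', ⟪P₁ u, u'⟫_ℝ = ⟪u, P₁ u'⟫_ℝ := hP₁s
      simp only [hKdef, sub_apply, mul_apply_eq_comp, inner_sub_left, inner_sub_right, a1, a2]
      ring) (by
      change K * P + P * K = K
      have h1 : P₁ * P * P = P₁ * P := by rw [mul_assoc, hPP]
      have h2 : P * (P * P₁) = P * P₁ := by rw [← mul_assoc, hPP]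
      rw [hKdef, sub_mul, mul_sub, h1, h2, ← mul_assoc]
      abel) (by
      change P _ = 0
      have h1 := e1 y₀
      rw [hPas, map_zero, zero_add] at h1
      rw [hw', map_add, h1, hPa]) rfl (by
      rw [hw, ← hζ]
      intro h0
      have : ζ = 0 := h.injective x hx (h0.trans (map_zero _).symm)
      rw [this, map_zero] at hζt
      exact zero_ne_one hζt) he₀ (by
      rw [hw, hKe, ← hζ]
      intro h0
      obtain ⟨μ, hμ⟩ := Submodule.mem_span_singleton.1 h0
      refine hne ⟨fderiv ℝ t x ξ • μ • ζ, ?_⟩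
      change fderiv ℝ F x _ = _
      rw [map_smul, map_smul, hμ]
      rfl) hk
  change frameProj e = P at hfe
  change o - P o = y₀ at ho
  refine ⟨K, A + 2 • P₁ y₀, e, d, l, o, v, hfr, 0, ζ, ?_, ?_, ?_, ?_⟩
  · simp only [helicoidFrame_zero, hfe, hPdef]
  · simp only [helicoidFrame_zero, hfe, zero_smul, add_zero, ho, hy₀]
  · simp only [helicoidFrame_zero, hfe]
    rw [dζ, hKdef, proj_deriv_eq_commutator hPP hP₁]
  · simp only [helicoidFrame_zero, hfe, zero_smul, add_zero, ho]
    rw [dζ', hKdef, foot_deriv_eq hP₁ hPas hPa]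

/-- Paired with `e j`, each of the two terms of `offDiag` applied to `e i` gives the full inner
product, which is thus twice itself. -/
theorem IsHelicoidFrame.inner_map_e {Y : Type*} [NormedAddCommGroup Y] [InnerProductSpace ℝ Y]
    {K : Y →L[ℝ] Y} {a : Y} {e d : Fin k → Y} {l : Fin k → ℝ} {o v : Y}
    (h : IsHelicoidFrame K a e d l o v) (i j : Fin k) : ⟪K (e i), e j⟫_ℝ = 0 := by
  classical
  have h1 := congrArg (fun z => ⟪e j, z⟫_ℝ) (DFunLike.congr_fun h.offDiag (e i))
  have he := orthonormal_iff_ite.1 h.orthonormal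
  simp only [add_apply, mul_apply_eq_comp, frameProj_apply, he, inner_add_right, inner_sum,
    inner_smul_right, ite_smul, one_smul, zero_smul, Finset.sum_ite_eq',
    Finset.mem_univ, if_true, mul_ite, mul_one, mul_zero, Finset.sum_ite_eq] at h1
  rw [real_inner_comm]
  linarith

/-- The coordinates along the ruling are the components of `f - o` in the moving frame; they are
smooth because the orbit parameter `r` is a smooth function on the patch. -/
theorem isGeneralizedHelicoid_of_movesAlong (hf : IsSmoothImmersion m f) (hk : k + 1 = m)
    (hR : ∀ p : M, RuledMinimal (extChartAt (𝓡 m) p).target (chartRep m f p) (chartRep m E p))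
    {K : EucSp n →L[ℝ] EucSp n} {a : EucSp n} {e d : Fin k → EucSp n} {l : Fin k → ℝ}
    {o v : EucSp n} (hfr : IsHelicoidFrame K a e d l o v)
    (hM : ∀ p, MovesAlong (chartRep m f p) (chartRep m E p) K a
      (fun r => frameProj (helicoidFrame e d l r))
      (fun r => o + r • v - frameProj (helicoidFrame e d l r) o) (extChartAt (𝓡 m) p p)) :
    IsGeneralizedHelicoid m f := by
  have hKe := hfr.map_e
  refine isGeneralizedHelicoid_of_frame hf hk (d := d) (l := l) (o := o) hfr.orthonormal
    hfr.v_e ?_ ?_ ?_ ?_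
  · intro i hi
    have h1 := hfr.skew (e i) v
    rw [hKe, hfr.map_v, inner_smul_left, inner_zero_right, neg_zero] at h1
    exact (mul_eq_zero.1 h1).resolve_left hi
  · intro i j hi
    have h1 := hfr.inner_map_e i j
    rw [hKe, inner_smul_left] at h1
    exact (mul_eq_zero.1 h1).resolve_left hi
  · intro i j hi hj
    have h1 := hfr.inner_map_frame 0 i j
    rw [helicoidFrame_zero, hKe, hKe, inner_smul_left, inner_smul_right,
      orthonormal_iff_ite.1 hfr.orthonormal] at h1
    rw [conj_trivial] at h1
    split_ifs at h1 ⊢ with hij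
    · subst hij
      field_simp at h1
      linarith
    · simpa [hi, hj] using h1
  · intro p
    obtain ⟨U, b, b', t, c, hxU, hU, hP⟩ := (hR p).exists_isRulingPatch
      (mem_extChartAt_target (I := 𝓡 m) p)
    obtain ⟨r, hr, hr'⟩ := hP.exists_forall_movesAlong (hR p) hU hfr.isScrewMotion hxU (hM p)
    refine ⟨U, r, fun i y => ⟪helicoidFrame e d l (r y) i, chartRep m f p y - o⟫_ℝ, hP.isOpen, hxU,
      hr, fun i => ?_, fun y hy => ?_⟩
    · refine ContDiffOn.inner ℝ ?_ (((hR p).smooth.mono hU).sub contDiffOn_const)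
      have h1 : ContDiff ℝ ∞ fun s => helicoidFrame e d l s i := by
        unfold helicoidFrame
        fun_prop
      exact h1.comp_contDiffOn hr
    · obtain ⟨h1, h2, -⟩ := hr' y hy
      rw [planeFoot, h1] at h2
      rw [← frameProj_apply, map_sub]
      linear_combination (norm := module) h2

end Helicoid

end

theorem mainTheorem9 {M : Type*} [TopologicalSpace M] [T2Space M] [SecondCountableTopology M]
    [ConnectedSpace M] [ChartedSpace (EucSp 4) M] [IsManifold (𝓡 4) ∞ M]
    (n : ℕ) (f : M → EucSp n) (hf : IsSmoothImmersion 4 f) (hA : IsAustere 4 f)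
    (hR : IsRuledByPlanes 4 3 f) :
    IsGeneralizedHelicoid 4 f := by
  obtain ⟨E, hE, hRE⟩ := hR
  have h := fun p : M => hA.ruledMinimal hf hE hRE rfl p
  -- Either the rulings always turn inside the tangent space, or at one point they turn out of it;
  -- that single point determines the helicoid everywhere.
  by_cases hT : ∀ p : M, ∀ x ∈ (extChartAt (𝓡 4) p).target, ∀ ξ, ∀ e ∈ chartRep 4 E p x,
      fderiv ℝ (planeProj (chartRep 4 E p)) x ξ e ∈ (fderiv ℝ (chartRep 4 f p) x).range
  · exact hf.isGeneralizedHelicoid_of_parallel (k := 3) rfl fun p x hx =>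
      (h p).hasFDerivAt_tangentProj (hT p) hx
  · push Not at hT
    obtain ⟨p, x, hx, ξ, e₀, he₀, hne⟩ := hT
    obtain ⟨K, a, e, d, l, o, v, hfr, hM⟩ := (h p).exists_isHelicoidFrame hx he₀ hne
      (hE.finrank_eq _)
    exact isGeneralizedHelicoid_of_movesAlong hf rfl h hfr
      (movesAlong_chartRep_of_connected h hfr.isScrewMotion hx hM)
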